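/- **Setting.** Let $p\in\mathbb C^2$. A formal hypersurface $M$ at $p$ is given by a formal power series $\rho(Z,\bar Z)=\sum\rho_{I\bar J}(Z-p)^I\overline{(Z-p)^J}$ with $\rho_{I\bar J}=\overline{\rho_{J\bar I}}$, $\rho(p)=0$, $d\rho(p)\ne0$; a germ at $p$ of a real-analytic hypersurface is identified with the Taylor series of a defining function. $\mathrm{Aut}_f(M,p)$ is the group of all invertible formal holomorphic maps $H:(\mathbb C^2,p)\to(\mathbb C^2,p)$ with $\rho(H(Z),\overline{H(Z)})=a(Z,\bar Z)\rho(Z,\bar Z)$ for some formal power series $a$. $J^k_p(\mathbb C^2)$ is the Lie group of $k$-jets at $p$ of invertible formal (equivalently, local biholomorphic) maps fixing $p$. In formal normal coordinates $(z,w)$ at $p$, $M$ is given by $\operatorname{Im}w=\varphi(z,\bar z,\operatorname{Re}w)$ with $\varphi(z,\chi,s)=\sum_{\alpha,\mu}\varphi_{\alpha,\mu}(\chi)z^\alpha s^\mu$ real and $\varphi(z,0,s)=\varphi(0,\chi,s)=0$. Write $(\alpha,\mu)\preceq(\beta,\nu)$ if $\alpha+\mu\le\beta+\nu$ and $\mu\le\nu$.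 Then $\Lambda_M\subset\mathbb N^3$ is the set of $(\alpha,n,\mu)$ such that $\varphi_{\alpha,\mu}\not\equiv0$, $\varphi_{\beta,\nu}\equiv0$ for all $(\beta,\nu)\prec(\alpha,\mu)$, and $n$ is the order of vanishing of $\varphi_{\alpha,\mu}(\chi)$ at $\chi=0$; this set does not depend on the normal coordinates. Put $$N_M=\bigcap_{(\alpha,n,\mu)\in\Lambda_M}\{(\gamma,\delta)\in U(1)\times\{\pm1\}:\gamma^{n-\alpha}\delta^{\mu-1}=1\}\subset U(1)\times U(1).$$ **Theorem.** Let $M$ be a real-analytic or formal hypersurface in $\mathbb C^2$ at $p$. Assume that $\Lambda_M$ contains at least two points, and let $(\alpha,n,\mu)\in\Lambda_M$ be one with $\alpha\ne n$. 1. For some $k\ge1$, jet evaluation $H\mapsto j^k_pH$ embeds $\mathrm{Aut}_f(M,p)$ as a closed Lie subgroup of $J^k_p(\mathbb C^2)$ of real dimension at most $1$. 2. Suppose that $\alpha+n=\alpha'+n'$ for some $(\alpha',n',\mu')\in\Lambda_M$ different from $(\alpha,n,\mu)$, or that the number $$\frac{(\alpha'+n')\mu-(\alpha+n)\mu'}{(\alpha'+n')-(\alpha+n)}\qquad(*)$$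 is not the same positive integer for all $(\alpha',n',\mu')\in\Lambda_M$ different from $(\alpha,n,\mu)$. Then $N_M$ is finite, and $\mathrm{Aut}_f(M,p)$ embeds as a subgroup of $N_M$: in any normal coordinates the map $H=(F,G)\mapsto(F_z(0),G_w(0))$ is an injective group homomorphism into $N_M$. In particular, $\#\mathrm{Aut}_f(M,p)\le2(n-\alpha)$. 3. If $\alpha+n\ne\alpha'+n'$ for all $(\alpha',n',\mu')\in\Lambda_M$ different from $(\alpha,n,\mu)$ and $(*)$ equals the same positive integer $k$ for all of them, then jet evaluation embeds $\mathrm{Aut}_f(M,p)$ as a closed Lie subgroup of $J^k_p(\mathbb C^2)$ for this $k$, of real dimension at most $1$. -/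

import Mathlib

noncomputable section

open scoped ContDiff

/-! ### Substitution of power series -/

namespace MvPowerSeries

section Substitution

variable {σ τ : Type*}

theorem degree_le_order_monomialSubst {u : σ → MvPowerSeries τ ℂ}
    (hu : ∀ i, constantCoeff (u i) = 0) (d : σ →₀ ℕ) :
    (d.degree : ℕ∞) ≤ (d.prod fun s e => u s ^ e).order := by
  induction d using Finsupp.induction_linear with
  | zero => simp
  | add f g hf hg =>
    rw [Finsupp.prod_add_index' (by simp) (by intros; rw [pow_add]), map_add, Nat.cast_add]
    exact (add_le_add hf hg).trans le_order_mul
  | single a b =>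
    rw [Finsupp.prod_single_index (by simp), Finsupp.degree_single]
    exact le_order_pow_of_constantCoeff_eq_zero b (hu a)

theorem order_monomialSubst_sub [Finite σ] {u v : σ → MvPowerSeries τ ℂ}
    (hu : ∀ i, constantCoeff (u i) = 0) (hv : ∀ i, constantCoeff (v i) = 0) {m : ℕ}
    (huv : ∀ i, (m : ℕ∞) ≤ (u i - v i).order) (d : σ →₀ ℕ) :
    ((m + d.degree : ℕ) : ℕ∞) ≤
      ((d.prod fun s e => u s ^ e) - (d.prod fun s e => v s ^ e)).order + 1 := by
  have key : ∀ f g : σ →₀ ℕ,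
      ((m + f.degree : ℕ) : ℕ∞) ≤
        ((f.prod fun s e => u s ^ e) - (f.prod fun s e => v s ^ e)).order + 1 →
      ((m + g.degree : ℕ) : ℕ∞) ≤
        ((g.prod fun s e => u s ^ e) - (g.prod fun s e => v s ^ e)).order + 1 →
      ((m + (f + g).degree : ℕ) : ℕ∞) ≤
        (((f + g).prod fun s e => u s ^ e) - ((f + g).prod fun s e => v s ^ e)).order + 1 := by
    intro f g hf hg
    rw [Finsupp.prod_add_index' (by simp) (by intros; rw [pow_add]),
      Finsupp.prod_add_index' (by simp) (by intros; rw [pow_add])]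
    have h1 := degree_le_order_monomialSubst hu f
    have h2 := degree_le_order_monomialSubst hv g
    set uf := f.prod fun s e => u s ^ e
    set ug := g.prod fun s e => u s ^ e
    set vf := f.prod fun s e => v s ^ e
    set vg := g.prod fun s e => v s ^ e
    have e : uf * ug - vf * vg = uf * (ug - vg) + (uf - vf) * vg := by ring
    rw [e]
    refine le_trans ?_ (add_le_add_left min_order_le_add 1)
    rw [← min_add_add_right, le_min_iff, map_add]
    push_cast at hf hg ⊢
    constructor
    · calc (m : ℕ∞) + (f.degree + g.degree) = f.degree + (m + g.degree) := by ring
        _ ≤ uf.order + ((ug - vg).order + 1) := add_le_add h1 hg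
        _ = uf.order + (ug - vg).order + 1 := by ring
        _ ≤ _ := add_le_add_left le_order_mul 1
    · calc (m : ℕ∞) + (f.degree + g.degree) = (m + f.degree) + g.degree := by ring
        _ ≤ ((uf - vf).order + 1) + vg.order := add_le_add hf h2
        _ = (uf - vf).order + vg.order + 1 := by ring
        _ ≤ _ := add_le_add_left le_order_mul 1
  induction d using Finsupp.induction_linear with
  | zero => simp
  | add f g hf hg => exact key f g hf hg
  | single a b =>
    induction b with
    | zero => simp
    | succ b ih =>
      rw [Finsupp.single_add]
      refine key _ _ ih ?_
      rw [Finsupp.prod_single_index (by simp), Finsupp.prod_single_index (by simp),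
        Finsupp.degree_single]
      push_cast
      simpa using add_le_add_left (huv a) 1

/-- Changing the substituted series in degrees `≥ m` changes the result in degrees `≥ m`. -/
theorem coeff_subst_congr [Finite σ] {u v : σ → MvPowerSeries τ ℂ}
    (hu : ∀ i, constantCoeff (u i) = 0) (hv : ∀ i, constantCoeff (v i) = 0) {m : ℕ}
    (huv : ∀ i, (m : ℕ∞) ≤ (u i - v i).order) (r : ℕ) (f : MvPowerSeries σ ℂ)
    (hf : ∀ d : σ →₀ ℕ, d.degree ≤ r → d ≠ 0 → coeff d f = 0)
    (e : τ →₀ ℕ) (he : e.degree < m + r) :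
    coeff e (subst u f) = coeff e (subst v f) := by
  rw [coeff_subst (hasSubst_of_constantCoeff_zero hu),
    coeff_subst (hasSubst_of_constantCoeff_zero hv)]
  refine finsum_congr fun d => ?_
  by_cases hd : d.degree ≤ r
  · by_cases h0 : d = 0
    · subst h0; simp
    · simp [hf d hd h0]
  · congr 1
    rw [← sub_eq_zero, ← map_sub]
    apply coeff_of_lt_order
    have h := order_monomialSubst_sub hu hv huv d
    have h2 : ((e.degree + 1 + 1 : ℕ) : ℕ∞) ≤ ((m + d.degree : ℕ) : ℕ∞) := by
      exact_mod_cast (by omega)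
    have h3 := h2.trans h
    rw [Nat.cast_add (e.degree + 1) 1, Nat.cast_one] at h3
    have h4 := (ENat.add_le_add_iff_right (by simp)).1 h3
    exact lt_of_lt_of_le (by exact_mod_cast Nat.lt_succ_self _) h4

/-- Changing the outer series in degrees `≥ m` changes the composite in degrees `≥ m`. -/
theorem le_order_subst_of_le [Finite σ] {u : σ → MvPowerSeries τ ℂ}
    (hu : ∀ i, constantCoeff (u i) = 0) {m : ℕ∞} {f : MvPowerSeries σ ℂ} (hf : m ≤ f.order) :
    m ≤ (subst u f).order := by
  refine le_trans ?_ (le_order_subst (hasSubst_of_constantCoeff_zero hu) f)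
  have h1 : (1 : ℕ∞) ≤ ⨅ i, (u i).order :=
    le_iInf fun i => one_le_order_iff_constCoeff_eq_zero.2 (hu i)
  calc m = 1 * m := (one_mul m).symm
    _ ≤ _ := mul_le_mul' h1 hf

/-- A series minus its linear part has no terms of degree `≤ 1`, if its constant term vanishes. -/
theorem coeff_sub_linear [Fintype σ] {f : MvPowerSeries σ ℂ} (hf : constantCoeff f = 0)
    (d : σ →₀ ℕ) (hd : d.degree ≤ 1) :
    coeff d (f - ∑ i, coeff (Finsupp.single i 1) f • X i) = 0 := by
  classical
  rcases Nat.lt_or_eq_of_le hd with h | h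
  · obtain rfl : d = 0 := by
      rw [← Finsupp.degree_eq_zero_iff]; omega
    simp [hf]
  · have : d ∈ Set.range (fun a : σ ↦ Finsupp.single a 1) := by
      rw [Finsupp.range_single_one]; exact h
    obtain ⟨a, rfl⟩ := this
    simp [coeff_X, Finsupp.single_left_inj]

/-- The chain rule at the origin. -/
theorem coeff_single_subst [Fintype σ] {u : σ → MvPowerSeries τ ℂ}
    (hu : ∀ i, constantCoeff (u i) = 0) {f : MvPowerSeries σ ℂ} (hf : constantCoeff f = 0)
    (j : τ) :
    coeff (Finsupp.single j 1) (subst u f) =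
      ∑ i, coeff (Finsupp.single i 1) f * coeff (Finsupp.single j 1) (u i) := by
  have hs := hasSubst_of_constantCoeff_zero hu
  have h2 : ((2 : ℕ) : ℕ∞) ≤ (f - ∑ i, coeff (Finsupp.single i 1) f • X i).order :=
    nat_le_order fun d hd => coeff_sub_linear hf d (by omega)
  have h3 := le_order_subst_of_le hu h2
  have h4 : coeff (Finsupp.single j 1)
      (subst u (f - ∑ i, coeff (Finsupp.single i 1) f • X i)) = 0 := by
    apply coeff_of_lt_order
    refine lt_of_lt_of_le ?_ h3
    rw [Finsupp.degree_single]; norm_num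
  rw [subst_sub hs, map_sub, sub_eq_zero] at h4
  rw [h4, ← coe_substAlgHom hs, map_sum, map_sum]
  refine Finset.sum_congr rfl fun i _ => ?_
  rw [map_smul, coe_substAlgHom, subst_X hs, map_smul, smul_eq_mul]

/-- The formal inverse function theorem: existence of a right inverse. -/
theorem exists_subst_eq_X {σ : Type*} [Fintype σ] [DecidableEq σ] {H : σ → MvPowerSeries σ ℂ}
    (hH : ∀ i, constantCoeff (H i) = 0)
    (hdet : (Matrix.of fun i j => coeff (Finsupp.single j 1) (H i)).det ≠ 0) :
    ∃ K : σ → MvPowerSeries σ ℂ, (∀ i, constantCoeff (K i) = 0) ∧ ∀ i, subst K (H i) = X i := by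
  set A : Matrix σ σ ℂ := Matrix.of fun i j => coeff (Finsupp.single j 1) (H i) with hA
  have hAB : A * A⁻¹ = 1 := Matrix.mul_nonsing_inv A (isUnit_iff_ne_zero.2 hdet)
  set h : σ → MvPowerSeries σ ℂ := fun i => H i - ∑ j, A i j • X j with hh
  have hh1 : ∀ i (d : σ →₀ ℕ), d.degree ≤ 1 → coeff d (h i) = 0 := fun i d hd =>
    coeff_sub_linear (hH i) d hd
  have hh0 : ∀ i, constantCoeff (h i) = 0 := fun i => by
    rw [← coeff_zero_eq_constantCoeff_apply]; exact hh1 i 0 (by simp)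
  let T : (σ → MvPowerSeries σ ℂ) → σ → MvPowerSeries σ ℂ := fun K i =>
    ∑ j, A⁻¹ i j • (X j - subst K (h j))
  have hT0 : ∀ K, (∀ i, constantCoeff (K i) = 0) → ∀ i, constantCoeff (T K i) = 0 := by
    intro K hK i
    simp only [T, map_sum]
    refine Finset.sum_eq_zero fun j _ => ?_
    rw [← coeff_zero_eq_constantCoeff_apply, map_smul, coeff_zero_eq_constantCoeff_apply, map_sub,
      constantCoeff_subst_eq_zero (hasSubst_of_constantCoeff_zero hK) hK (hh0 j)]
    simp
  have hTc : ∀ K L : σ → MvPowerSeries σ ℂ, (∀ i, constantCoeff (K i) = 0) →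
      (∀ i, constantCoeff (L i) = 0) → ∀ m : ℕ, (∀ i, (m : ℕ∞) ≤ (K i - L i).order) →
      ∀ i, ((m + 1 : ℕ) : ℕ∞) ≤ (T K i - T L i).order := by
    intro K L hK hL m hm i
    refine nat_le_order fun d hd => ?_
    rw [map_sub, sub_eq_zero]
    simp only [T, map_sum, map_smul, map_sub]
    refine Finset.sum_congr rfl fun j _ => ?_
    rw [coeff_subst_congr hK hL hm 1 (h j) (fun d hd _ => hh1 j d hd) d hd]
  let S : ℕ → σ → MvPowerSeries σ ℂ := fun n => T^[n] 0
  have hS0 : ∀ n i, constantCoeff (S n i) = 0 := by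
    intro n
    induction n with
    | zero => intro i; simp [S]
    | succ n ih =>
      simp only [S, Function.iterate_succ_apply'] at ih ⊢
      exact hT0 _ ih
  have hSn : ∀ (n : ℕ) i, (n : ℕ∞) ≤ (S (n + 1) i - S n i).order := by
    intro n
    induction n with
    | zero => intro i; simp
    | succ n ih =>
      have := hTc _ _ (hS0 (n + 1)) (hS0 n) n ih
      intro i
      have e : ∀ n, S (n + 1) = T (S n) := fun n => Function.iterate_succ_apply' T n 0
      rw [e (n + 1), e n]
      rw [e n] at this
      exact this i
  have hSc : ∀ n k i (d : σ →₀ ℕ), d.degree < n → coeff d (S (n + k) i) = coeff d (S n i) := by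
    intro n k i d hd
    induction k with
    | zero => rfl
    | succ k ih =>
      rw [← ih, ← sub_eq_zero, ← map_sub]
      apply coeff_of_lt_order
      refine lt_of_lt_of_le ?_ (hSn (n + k) i)
      exact_mod_cast (by omega)
  let K : σ → MvPowerSeries σ ℂ := fun i d => coeff d (S (d.degree + 1) i)
  have hKc : ∀ i (d : σ →₀ ℕ), coeff d (K i) = coeff d (S (d.degree + 1) i) := fun _ _ => rfl
  have hKS : ∀ (n : ℕ) i, (n : ℕ∞) ≤ (K i - S n i).order := by
    intro n i
    refine nat_le_order fun d hd => ?_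
    rw [map_sub, sub_eq_zero, hKc]
    obtain ⟨k, rfl⟩ := Nat.exists_eq_add_of_le (Nat.succ_le_of_lt hd)
    exact (hSc (d.degree + 1) k i d (by omega)).symm
  have hK0 : ∀ i, constantCoeff (K i) = 0 := by
    intro i
    rw [← coeff_zero_eq_constantCoeff_apply, hKc, coeff_zero_eq_constantCoeff_apply, hS0]
  have hfix : ∀ i, T K i = K i := by
    intro i
    ext d
    have h1 := hTc K (S d.degree) hK0 (hS0 _) d.degree (hKS _) i
    have h2 := hKS (d.degree + 1) i
    have e : S (d.degree + 1) = T (S d.degree) := Function.iterate_succ_apply' T _ 0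
    rw [← e] at h1
    have g1 := coeff_of_lt_order (lt_of_lt_of_le (by exact_mod_cast Nat.lt_succ_self _) h1)
    have g2 := coeff_of_lt_order (lt_of_lt_of_le (by exact_mod_cast Nat.lt_succ_self _) h2)
    rw [map_sub, sub_eq_zero] at g1 g2
    rw [g1, g2]
  refine ⟨K, hK0, fun i => ?_⟩
  have hs := hasSubst_of_constantCoeff_zero hK0
  have e1 : H i = ∑ j, A i j • X j + h i := by simp [hh]
  have e2 : subst K (H i) = ∑ j, A i j • K j + subst K (h i) := by
    rw [e1, subst_add hs]
    congr 1
    rw [← coe_substAlgHom hs, map_sum]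
    refine Finset.sum_congr rfl fun j _ => ?_
    rw [map_smul, coe_substAlgHom, subst_X hs]
  have e3 : ∑ j, A i j • K j = X i - subst K (h i) := by
    calc ∑ j, A i j • K j = ∑ j, A i j • T K j := by simp only [hfix]
      _ = ∑ j, A i j • ∑ l, A⁻¹ j l • (X l - subst K (h l)) := rfl
      _ = ∑ l, (A * A⁻¹) i l • (X l - subst K (h l)) := by
          simp only [Finset.smul_sum, smul_smul, Matrix.mul_apply, Finset.sum_smul]
          rw [Finset.sum_comm]
      _ = X i - subst K (h i) := by
          rw [hAB]; simp [Matrix.one_apply, ite_smul]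
  rw [e2, e3, sub_add_cancel]

end Substitution

end MvPowerSeries

/-! ### Formal holomorphic maps -/

/-- An invertible formal holomorphic map `(ℂ², p) → (ℂ², q)`, written in the centred coordinates
`Z - p` and `Z' - q`: a pair of formal power series without constant term whose Jacobian
determinant at the base point is nonzero. -/
@[ext]
structure FormalBihol where
  /-- the two components -/
  toFun : Fin 2 → MvPowerSeries (Fin 2) ℂ
  constantCoeff_eq_zero : ∀ j, MvPowerSeries.constantCoeff (toFun j) = 0
  det_ne_zero :
    (Matrix.of fun i j => MvPowerSeries.coeff (Finsupp.single j 1) (toFun i)).det ≠ 0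

namespace FormalBihol

open MvPowerSeries

/-- The Jacobian matrix `∂H/∂Z` at the base point. -/
def jacobian (H : FormalBihol) : Matrix (Fin 2) (Fin 2) ℂ :=
  Matrix.of fun i j => coeff (Finsupp.single j 1) (H.toFun i)

theorem hasSubst (H : FormalBihol) : HasSubst H.toFun :=
  hasSubst_of_constantCoeff_zero H.constantCoeff_eq_zero

theorem jacobian_subst {H K : Fin 2 → MvPowerSeries (Fin 2) ℂ}
    (hH : ∀ j, constantCoeff (H j) = 0) (hK : ∀ j, constantCoeff (K j) = 0) :
    (Matrix.of fun i j => coeff (Finsupp.single j 1) (subst K (H i))) =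
      (Matrix.of fun i j => coeff (Finsupp.single j 1) (H i)) *
        (Matrix.of fun i j => coeff (Finsupp.single j 1) (K i)) := by
  ext i j
  simp only [Matrix.of_apply, Matrix.mul_apply]
  exact coeff_single_subst hK (hH i) j

theorem jacobian_X :
    (Matrix.of fun i j => coeff (Finsupp.single j 1) (X i : MvPowerSeries (Fin 2) ℂ)) = 1 := by
  classical
  ext i j
  simp [coeff_X, Matrix.one_apply, Finsupp.single_left_inj, eq_comm]

/-- Composition `H ∘ K`. -/
instance : Mul FormalBihol where
  mul H K :=
    { toFun := fun j => subst K.toFun (H.toFun j)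
      constantCoeff_eq_zero := fun j => constantCoeff_subst_eq_zero K.hasSubst
        K.constantCoeff_eq_zero (H.constantCoeff_eq_zero j)
      det_ne_zero := by
        rw [jacobian_subst H.constantCoeff_eq_zero K.constantCoeff_eq_zero, Matrix.det_mul]
        exact mul_ne_zero H.det_ne_zero K.det_ne_zero }

/-- The identity map. -/
instance : One FormalBihol where
  one :=
    { toFun := X
      constantCoeff_eq_zero := fun j => constantCoeff_X j
      det_ne_zero := by rw [jacobian_X]; simp }

theorem mul_toFun (H K : FormalBihol) (j : Fin 2) :
    (H * K).toFun j = subst K.toFun (H.toFun j) := rfl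

theorem one_toFun : (1 : FormalBihol).toFun = X := rfl

theorem exists_mul_eq_one (H : FormalBihol) : ∃ K : FormalBihol, H * K = 1 := by
  obtain ⟨K, hK0, hK⟩ := exists_subst_eq_X H.constantCoeff_eq_zero H.det_ne_zero
  refine ⟨⟨K, hK0, fun h0 => ?_⟩, FormalBihol.ext (funext hK)⟩
  have h := congrArg Matrix.det (jacobian_subst H.constantCoeff_eq_zero hK0)
  simp only [hK] at h
  rw [jacobian_X, Matrix.det_mul, h0] at h
  simp at h

/-- The inverse map. -/
instance : Inv FormalBihol where
  inv H := H.exists_mul_eq_one.choose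

/-- Invertible formal maps fixing the base point form a group under composition. -/
instance : Group FormalBihol :=
  Group.ofRightAxioms
    (fun a b c => FormalBihol.ext (funext fun j => by
      simp only [mul_toFun]
      rw [subst_comp_subst_apply b.hasSubst c.hasSubst]
      rfl))
    (fun a => FormalBihol.ext (funext fun j => by
      rw [mul_toFun, one_toFun, subst_self]; rfl))
    (fun a => a.exists_mul_eq_one.choose_spec)

/-- The map `(Z, Z̄) ↦ (H(Z), \overline{H(Z)})` as a family of formal power series in the
variables `Z` (left summand) and `Z̄` (right summand). -/
def complexify (H : FormalBihol) : Fin 2 ⊕ Fin 2 → MvPowerSeries (Fin 2 ⊕ Fin 2) ℂ :=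
  Sum.elim (fun j => rename Sum.inl (H.toFun j))
    (fun j => rename Sum.inr (map (starRingEnd ℂ) (H.toFun j)))

theorem complexify_inl (H : FormalBihol) (j : Fin 2) :
    H.complexify (Sum.inl j) = rename Sum.inl (H.toFun j) := rfl

theorem complexify_inr (H : FormalBihol) (j : Fin 2) :
    H.complexify (Sum.inr j) = rename Sum.inr (map (starRingEnd ℂ) (H.toFun j)) := rfl

theorem constantCoeff_complexify (H : FormalBihol) (i : Fin 2 ⊕ Fin 2) :
    constantCoeff (H.complexify i) = 0 := by
  rcases i with i | i <;> simp [complexify, H.constantCoeff_eq_zero]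

theorem hasSubst_complexify (H : FormalBihol) : HasSubst H.complexify :=
  hasSubst_of_constantCoeff_zero H.constantCoeff_complexify

theorem subst_complexify (H K : FormalBihol) (f : MvPowerSeries (Fin 2 ⊕ Fin 2) ℂ) :
    subst (H * K).complexify f = subst K.complexify (subst H.complexify f) := by
  rw [subst_comp_subst_apply H.hasSubst_complexify K.hasSubst_complexify]
  congr 1
  have hc : HasSubst fun j => map (starRingEnd ℂ) (K.toFun j) := K.hasSubst.map _
  funext i
  rcases i with i | i
  · simp only [complexify_inl, mul_toFun]
    rw [rename_eq_subst, rename_eq_subst, subst_comp_subst_apply K.hasSubst (HasSubst.X_comp _),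
      subst_comp_subst_apply (HasSubst.X_comp _) K.hasSubst_complexify]
    congr 1
    funext j
    rw [Function.comp_apply, subst_X K.hasSubst_complexify, ← rename_eq_subst]
    rfl
  · simp only [complexify_inr, mul_toFun]
    rw [map_subst K.hasSubst, rename_eq_subst, rename_eq_subst,
      subst_comp_subst_apply hc (HasSubst.X_comp _),
      subst_comp_subst_apply (HasSubst.X_comp _) K.hasSubst_complexify]
    congr 1
    funext j
    rw [Function.comp_apply, subst_X K.hasSubst_complexify, ← rename_eq_subst]
    rfl

theorem complexify_one : (1 : FormalBihol).complexify = X := by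
  funext i
  rcases i with i | i <;> simp [complexify, one_toFun]

end FormalBihol

/-! ### Jets -/

/-- The space of coefficients of order `1, …, k` of pairs of power series in two variables;
a finite-dimensional complex vector space. -/
abbrev JetSpace (k : ℕ) : Type :=
  Fin 2 → {I : Fin 2 →₀ ℕ // 1 ≤ I.degree ∧ I.degree ≤ k} → ℂ

instance (k : ℕ) : Finite {I : Fin 2 →₀ ℕ // 1 ≤ I.degree ∧ I.degree ≤ k} :=
  ((Finsupp.finite_of_degree_le k).subset fun _ h => h.2).to_subtype

instance (k : ℕ) : Fintype {I : Fin 2 →₀ ℕ // 1 ≤ I.degree ∧ I.degree ≤ k} :=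
  Fintype.ofFinite _

namespace FormalBihol

/-- The Taylor coefficients of order `1, …, k` of an invertible formal map at the base point. -/
def jetCoeffs (k : ℕ) (H : FormalBihol) : JetSpace k :=
  fun j I => MvPowerSeries.coeff I.1 (H.toFun j)

open MvPowerSeries in
theorem le_order_sub_of_jetCoeffs_eq {k : ℕ} {H K : FormalBihol}
    (h : jetCoeffs k H = jetCoeffs k K) (j : Fin 2) :
    ((k + 1 : ℕ) : ℕ∞) ≤ (H.toFun j - K.toFun j).order := by
  refine nat_le_order fun d hd => ?_
  rw [map_sub, sub_eq_zero]
  rcases Nat.eq_zero_or_pos d.degree with h0 | h0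
  · rw [Finsupp.degree_eq_zero_iff] at h0
    subst h0
    rw [coeff_zero_eq_constantCoeff_apply, coeff_zero_eq_constantCoeff_apply,
      H.constantCoeff_eq_zero, K.constantCoeff_eq_zero]
  · exact congrFun (congrFun h j) ⟨d, h0, by omega⟩

open MvPowerSeries in
/-- The `k`-jet of a composition depends only on the `k`-jets of the factors. -/
theorem jetCoeffs_mul_congr {k : ℕ} {H H' K K' : FormalBihol}
    (hH : jetCoeffs k H = jetCoeffs k H') (hK : jetCoeffs k K = jetCoeffs k K') :
    jetCoeffs k (H * K) = jetCoeffs k (H' * K') := by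
  funext j I
  have h1 : coeff I.1 (subst K.toFun (H.toFun j)) = coeff I.1 (subst K.toFun (H'.toFun j)) := by
    rw [← sub_eq_zero, ← map_sub, ← subst_sub K.hasSubst]
    apply coeff_of_lt_order
    refine lt_of_lt_of_le ?_ (le_order_subst_of_le K.constantCoeff_eq_zero
      (le_order_sub_of_jetCoeffs_eq hH j))
    exact_mod_cast Nat.lt_succ_of_le I.2.2
  have h2 : coeff I.1 (subst K.toFun (H'.toFun j)) = coeff I.1 (subst K'.toFun (H'.toFun j)) :=
    coeff_subst_congr K.constantCoeff_eq_zero K'.constantCoeff_eq_zero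
      (le_order_sub_of_jetCoeffs_eq hK) 0 _
      (fun d hd hd0 => absurd ((Finsupp.degree_eq_zero_iff d).1 (by omega)) hd0) _
      (by have := I.2.2; omega)
  exact h1.trans h2

theorem jetCoeffs_inv_congr {k : ℕ} {H H' : FormalBihol}
    (hH : jetCoeffs k H = jetCoeffs k H') : jetCoeffs k H⁻¹ = jetCoeffs k H'⁻¹ := by
  have h := jetCoeffs_mul_congr (k := k) (H := H⁻¹) (H' := H⁻¹) rfl
    (jetCoeffs_mul_congr hH.symm (rfl : jetCoeffs k H'⁻¹ = jetCoeffs k H'⁻¹))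
  rw [mul_inv_cancel, mul_one, ← mul_assoc, inv_mul_cancel, one_mul] at h
  exact h

end FormalBihol

/-- The jet group of order `k` at the base point: the `k`-jets of invertible formal maps of
`ℂ²` fixing the base point. -/
def JetGroup (k : ℕ) : Type := {c : JetSpace k // ∃ H : FormalBihol, H.jetCoeffs k = c}

namespace JetGroup

variable {k : ℕ}

/-- The coordinates of a jet. -/
def coords (c : JetGroup k) : JetSpace k := c.1

/-- The jet group carries the topology of its coordinates. -/
instance : TopologicalSpace (JetGroup k) := TopologicalSpace.induced coords inferInstance

/-- A formal map with a given jet. -/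
def rep (c : JetGroup k) : FormalBihol := c.2.choose

theorem jetCoeffs_rep (c : JetGroup k) : c.rep.jetCoeffs k = c.coords := c.2.choose_spec

/-- The jet of a formal map. -/
def mk (k : ℕ) (H : FormalBihol) : JetGroup k := ⟨H.jetCoeffs k, H, rfl⟩

theorem mk_surjective : Function.Surjective (mk k) := by
  rintro ⟨_, H, rfl⟩; exact ⟨H, rfl⟩

theorem jetCoeffs_rep_mk (H : FormalBihol) : (mk k H).rep.jetCoeffs k = H.jetCoeffs k :=
  jetCoeffs_rep _

instance : Mul (JetGroup k) := ⟨fun a b => mk k (a.rep * b.rep)⟩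
instance : One (JetGroup k) := ⟨mk k 1⟩
instance : Inv (JetGroup k) := ⟨fun a => mk k a.rep⁻¹⟩

theorem mk_mul (H K : FormalBihol) : mk k (H * K) = mk k H * mk k K :=
  Subtype.ext (FormalBihol.jetCoeffs_mul_congr (jetCoeffs_rep_mk H).symm (jetCoeffs_rep_mk K).symm)

theorem mk_inv (H : FormalBihol) : mk k H⁻¹ = (mk k H)⁻¹ :=
  Subtype.ext (FormalBihol.jetCoeffs_inv_congr (jetCoeffs_rep_mk H).symm)

/-- The group structure on jets induced by composition of maps. -/
instance : Group (JetGroup k) :=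
  Group.ofRightAxioms
    (fun a b c => by
      obtain ⟨H, rfl⟩ := mk_surjective a
      obtain ⟨K, rfl⟩ := mk_surjective b
      obtain ⟨L, rfl⟩ := mk_surjective c
      rw [← mk_mul, ← mk_mul, ← mk_mul, ← mk_mul, mul_assoc])
    (fun a => by
      obtain ⟨H, rfl⟩ := mk_surjective a
      exact (mk_mul H 1).symm.trans (by rw [mul_one]))
    (fun a => by
      obtain ⟨H, rfl⟩ := mk_surjective a
      rw [← mk_inv, ← mk_mul, mul_inv_cancel]; rfl)

/-- Jet evaluation, as a group homomorphism. -/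
def eval (k : ℕ) : FormalBihol →* JetGroup k := MonoidHom.mk' (mk k) mk_mul

end JetGroup

/-- `S` is a (smooth, embedded) real submanifold of dimension `d` of the finite-dimensional space
`E`: near each of its points, a local diffeomorphism of `E` straightens it to a linear subspace
of dimension `d`. -/
def IsEmbeddedSubmanifold {E : Type*} [NormedAddCommGroup E] [NormedSpace ℝ E]
    [FiniteDimensional ℝ E] (d : ℕ) (S : Set E) : Prop :=
  ∀ x ∈ S, ∃ (e : OpenPartialHomeomorph E E) (V : Submodule ℝ E),
    x ∈ e.source ∧ ContDiffOn ℝ ∞ e e.source ∧ ContDiffOn ℝ ∞ e.symm e.target ∧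
    Module.finrank ℝ V = d ∧ ∀ y ∈ e.source, y ∈ S ↔ e y ∈ V

/-- `S` is a closed Lie subgroup of real dimension `d` of the jet group (the jet group being an
open subset of `JetSpace k` if `k ≥ 1`): a closed subgroup which is an embedded real submanifold
of dimension `d`. -/
def IsClosedLieSubgroup {k : ℕ} (d : ℕ) (S : Subgroup (JetGroup k)) : Prop :=
  IsClosed (S : Set (JetGroup k)) ∧
    IsEmbeddedSubmanifold d (JetGroup.coords '' (S : Set (JetGroup k)))

/-! ### Formal hypersurfaces -/

/-- A formal real hypersurface in `ℂ²` at a point `p`, given by a formal power series `ρ` in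
`Z - p` (left summand of the variables) and its conjugate (right summand), with `ρ(p) = 0`,
`ρ_{I J̄} = conj ρ_{J Ī}` and `dρ(p) ≠ 0`. A germ of a real-analytic hypersurface is identified
with the Taylor series of a defining function. -/
structure FormalHypersurface where
  /-- the defining power series -/
  rho : MvPowerSeries (Fin 2 ⊕ Fin 2) ℂ
  constantCoeff_eq_zero : MvPowerSeries.constantCoeff rho = 0
  real : ∀ I : Fin 2 ⊕ Fin 2 →₀ ℕ, MvPowerSeries.coeff (I.mapDomain Sum.swap) rho =
    starRingEnd ℂ (MvPowerSeries.coeff I rho)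
  differential_ne_zero : ∃ i, MvPowerSeries.coeff (Finsupp.single i 1) rho ≠ 0

namespace FormalHypersurface

open MvPowerSeries

/-- The group `Aut_f(M, p)` of formal automorphisms: invertible formal maps `H` fixing `p` with
`ρ(H(Z), \overline{H(Z)}) = a(Z, Z̄) ρ(Z, Z̄)` for some formal power series `a`. -/
def Aut (M : FormalHypersurface) : Subgroup FormalBihol where
  carrier := {H | ∃ a : MvPowerSeries (Fin 2 ⊕ Fin 2) ℂ, subst H.complexify M.rho = a * M.rho}
  one_mem' := ⟨1, by rw [FormalBihol.complexify_one, subst_self, one_mul, id]⟩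
  mul_mem' := by
    rintro H K ⟨a, ha⟩ ⟨b, hb⟩
    refine ⟨subst K.complexify a * b, ?_⟩
    rw [FormalBihol.subst_complexify, ha, subst_mul K.hasSubst_complexify, hb, mul_assoc]
  inv_mem' := by
    rintro H ⟨a, ha⟩
    set K := H⁻¹ with hK
    have h1 : M.rho = subst K.complexify a * subst K.complexify M.rho := by
      rw [← subst_mul K.hasSubst_complexify, ← ha, ← FormalBihol.subst_complexify, hK,
        mul_inv_cancel, FormalBihol.complexify_one, subst_self, id]
    have h2 : constantCoeff (subst K.complexify M.rho) = 0 :=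
      constantCoeff_subst_eq_zero K.hasSubst_complexify K.constantCoeff_complexify
        M.constantCoeff_eq_zero
    have h3 : constantCoeff (subst K.complexify a) ≠ 0 := by
      intro h0
      obtain ⟨i, hi⟩ := M.differential_ne_zero
      apply hi
      rw [h1]
      apply coeff_of_lt_order
      rw [Finsupp.degree_single]
      refine lt_of_lt_of_le ?_ le_order_mul
      calc ((1 : ℕ) : ℕ∞) < 1 + 1 := by norm_num
        _ ≤ _ := add_le_add (one_le_order_iff_constCoeff_eq_zero.2 h0)
          (one_le_order_iff_constCoeff_eq_zero.2 h2)
    refine ⟨(subst K.complexify a)⁻¹, ?_⟩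
    nth_rewrite 2 [h1]
    rw [← mul_assoc, MvPowerSeries.inv_mul_cancel _ h3, one_mul]

end FormalHypersurface

/-- The coefficient of `z^a χ^b s^m` in a formal power series `φ(z, χ, s)`. -/
def coeff₃ (φ : MvPowerSeries (Fin 3) ℂ) (a b m : ℕ) : ℂ :=
  MvPowerSeries.coeff (Finsupp.equivFunOnFinite.symm ![a, b, m]) φ

/-- `φ(z, χ, s)` is real, `\bar φ(χ, z, s) = φ(z, χ, s)`, and satisfies
`φ(z, 0, s) = φ(0, χ, s) = 0`. -/
structure IsNormalGraph (φ : MvPowerSeries (Fin 3) ℂ) : Prop where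
  real : ∀ a b m, coeff₃ φ b a m = starRingEnd ℂ (coeff₃ φ a b m)
  left : ∀ a m, coeff₃ φ a 0 m = 0
  right : ∀ b m, coeff₃ φ 0 b m = 0

open MvPowerSeries in
/-- The defining series `Im w - φ(z, z̄, Re w)`, in the variables `z, w` (`inl 0`, `inl 1`) and
`z̄, w̄` (`inr 0`, `inr 1`). -/
def graphSeries (φ : MvPowerSeries (Fin 3) ℂ) : MvPowerSeries (Fin 2 ⊕ Fin 2) ℂ :=
  C (1 / (2 * Complex.I)) * (X (Sum.inl 1) - X (Sum.inr 1)) -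
    subst ![X (Sum.inl 0), X (Sum.inr 0), C (1 / 2) * (X (Sum.inl 1) + X (Sum.inr 1))] φ

/-- The partial order on `ℕ × ℕ` with `(α, μ) ⪯ (β, ν)` iff `α + μ ≤ β + ν` and `μ ≤ ν`;
this is its strict part. -/
def PairLT (x y : ℕ × ℕ) : Prop := x.1 + x.2 ≤ y.1 + y.2 ∧ x.2 ≤ y.2 ∧ x ≠ y

/-- `(α₀, μ₀)` is an invariant pair of `φ = ∑ φ_{α,μ}(χ) z^α s^μ`: the series `φ_{α₀,μ₀}` is not
zero, but all `φ_{α,μ}` with `(α, μ) ≺ (α₀, μ₀)` are. -/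
def IsInvariantPair (φ : MvPowerSeries (Fin 3) ℂ) (x : ℕ × ℕ) : Prop :=
  (∃ b, coeff₃ φ x.1 b x.2 ≠ 0) ∧ ∀ y, PairLT y x → ∀ b, coeff₃ φ y.1 b y.2 = 0

namespace FormalHypersurface

/-- `Z' = (z, w) = Φ(Z)` are formal normal coordinates at `p` in which `M` is given by
`Im w = φ(z, z̄, Re w)`. -/
def IsNormalCoord (M : FormalHypersurface) (Φ : FormalBihol)
    (φ : MvPowerSeries (Fin 3) ℂ) : Prop :=
  IsNormalGraph φ ∧ ∃ a : (MvPowerSeries (Fin 2 ⊕ Fin 2) ℂ)ˣ,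
    M.rho = a * MvPowerSeries.subst Φ.complexify (graphSeries φ)

/-- The invariant set `Λ_M` of triples `(α, n, μ)`: in some normal coordinates, `(α, μ)` is an
invariant pair and `n` is the order of vanishing of `φ_{α,μ}(χ)` at `χ = 0`. (The set of these
triples is the same in all normal coordinates.) -/
def Lambda (M : FormalHypersurface) : Set (ℕ × ℕ × ℕ) :=
  {t | ∃ Φ φ, M.IsNormalCoord Φ φ ∧ IsInvariantPair φ (t.1, t.2.2) ∧
    IsLeast {n | coeff₃ φ t.1 n t.2.2 ≠ 0} t.2.1}

end FormalHypersurface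

/-- The group `D(k, l) = {(γ, δ) ∈ U(1) × {1, -1} : γ^k δ^l = 1}`. -/
def torusSubgroup (k l : ℤ) : Subgroup (Circle × Circle) where
  carrier := {x | (x.2 = 1 ∨ x.2 = -1) ∧ x.1 ^ k * x.2 ^ l = 1}
  one_mem' := by simp
  mul_mem' := by
    rintro x y ⟨hx, hx'⟩ ⟨hy, hy'⟩
    refine ⟨?_, ?_⟩
    · rcases hx with h | h <;> rcases hy with h' | h' <;> simp [h, h']
    · rw [Prod.fst_mul, Prod.snd_mul, mul_zpow, mul_zpow, mul_mul_mul_comm, hx', hy', one_mul]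
  inv_mem' := by
    rintro x ⟨hx, hx'⟩
    refine ⟨?_, ?_⟩
    · rcases hx with h | h <;> simp [h]
    · rw [Prod.fst_inv, Prod.snd_inv, inv_zpow, inv_zpow, ← mul_inv, hx', inv_one]

namespace FormalHypersurface

/-- The group `N_M = ⋂ D(n - α, μ - 1)`, the intersection over all `(α, n, μ) ∈ Λ_M`. -/
def N (M : FormalHypersurface) : Subgroup (Circle × Circle) :=
  ⨅ t ∈ M.Lambda, torusSubgroup ((t.2.1 : ℤ) - t.1) ((t.2.2 : ℤ) - 1)

end FormalHypersurface

/-- The fraction `((α' + n') μ - (α + n) μ') / ((α' + n') - (α + n))` of two triples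
`t = (α, n, μ)` and `t' = (α', n', μ')`; only used if `α' + n' ≠ α + n`. -/
def tripleRatio (t t' : ℕ × ℕ × ℕ) : ℚ :=
  (((t'.1 : ℚ) + t'.2.1) * t.2.2 - ((t.1 : ℚ) + t.2.1) * t'.2.2) /
    (((t'.1 : ℚ) + t'.2.1) - ((t.1 : ℚ) + t.2.1))

end

/-! In normal coordinates an automorphism H = (F, G) is a solution of one equation on the
complexified graph w = s + iφ(z, χ, s), w̄ = s − iφ(z, χ, s), namely (G(z, w) − Ḡ(χ, w̄)) / 2i =
φ(F(z, w), F̄(χ, w̄), (G(z, w) + Ḡ(χ, w̄)) / 2); see `IsGraphMap` and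
`FormalHypersurface.mem_aut_iff`. The proof compares a few coefficients of this equation near the
monomials z^α χ^n s^μ with (α, n, μ) in Λ_M. Two gradings used together isolate one such monomial:
terms of φ with more factors z or s are heavier in the grading (K, 2, αK + 1), while terms with
fewer than μ factors s carry many extra factors z and are excluded by the grading (p, 0, 1). This is
`coeff_subst_perturb`, which yields the master identity `IsGraphMap.coeff_eq`.

Linear part. The Jacobian is upper triangular with diagonal (γ, δ) and δ real, and the lowest
coefficient gives δ = γ^α γ̄^n δ^μ for each triple (`FormalBihol.MapsGraph.jacobian_relation`). The
unit parts of γ and δ therefore define a character into N_M, which is finite because α ≠ n. The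
moduli satisfy (α + n) log|γ| = (1 − μ) log|δ|; two triples force |γ| = |δ| = 1 unless the fraction
(*) equals 1.

Higher orders. Let F = z + O(w^j) and G = w + O(w^(j+1)) with j ≥ 1. Then F has no term w^j
(`IsGraphMap.coeff_fst_pure`), and in order w^(j+1) the series G has only a term c w^(j+1) with c
real. If x is the coefficient of z w^j in F, each triple gives (j + 1)c = αx + n x̄ + μc
(`IsGraphMap.resonance`). As α ≠ n, c = 0 forces x = 0, and then all coefficients of this order
vanish (`IsGraphMap.agreesWithId_succ`). If c ≠ 0, then x is real and two triples force (*) to be j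
+ 1 (`IsGraphMap.coeff_snd_eq_zero_of_ratio`). So an automorphism is determined by its diagonal and
at most one resonant coefficient. Without resonance the character is injective, which is the finite
case.

Resonant case. The kernel of the character consists of the automorphisms with positive diagonal. It
has to be shown that a nontrivial kernel is a one-parameter group and not a discrete one. The
coefficients of the iterates K^m are exponential polynomials in m with real exponents
(`FormalBihol.exists_expPoly`). An exponential polynomial vanishing at all natural numbers is zero
(`expPoly.eq_zero_of_forall_nat`), so the graph equation for all K^m extends to real exponents
(`FormalBihol.MapsGraph.exists_flow`). By determinacy this flow exhausts the kernel. The k-jets of a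
coset of the kernel then form an affine line if k ≥ 2, and a curve x^q P + x Q, x > 0, with q < 0 if
k = 1. Finitely many disjoint closed submanifolds of this kind make up the image
(`isClosedLieSubgroup_of_ker`). -/

noncomputable section

namespace MvPowerSeries

/-! ### Ideals of series of large weight -/

section WeightIdeal

variable {σ τ R : Type*} [CommRing R]

/-- The ideal of power series all of whose terms have weight at least `N`. -/
def weightIdeal (w : σ → ℕ) (N : ℕ) : Ideal (MvPowerSeries σ R) where
  carrier := {f | ∀ d, Finsupp.weight w d < N → coeff d f = 0}
  zero_mem' := by intro d _; simp
  add_mem' := by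
    intro f g hf hg d hd
    rw [map_add, hf d hd, hg d hd, add_zero]
  smul_mem' := by
    classical
    intro c f hf d hd
    rw [smul_eq_mul, coeff_mul]
    refine Finset.sum_eq_zero fun p hp => ?_
    rw [hf p.2, mul_zero]
    rw [← Finset.HasAntidiagonal.mem_antidiagonal.1 hp, map_add] at hd
    omega

variable {w : σ → ℕ} {M N : ℕ} {f g : MvPowerSeries σ R}

theorem coeff_eq_zero_of_mem_weightIdeal (hf : f ∈ weightIdeal w N) {d : σ →₀ ℕ}
    (hd : Finsupp.weight w d < N) : coeff d f = 0 := hf d hd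

theorem coeff_eq_of_sub_mem_weightIdeal (h : f - g ∈ weightIdeal w N) {d : σ →₀ ℕ}
    (hd : Finsupp.weight w d < N) : coeff d f = coeff d g := by
  rw [← sub_eq_zero, ← map_sub]; exact h d hd

theorem weightIdeal_anti (h : M ≤ N) (hf : f ∈ weightIdeal w N) : f ∈ weightIdeal w M :=
  fun d hd => hf d (hd.trans_le h)

theorem mem_weightIdeal_zero : f ∈ weightIdeal w 0 := fun _ hd => absurd hd (Nat.not_lt_zero _)

theorem mul_mem_weightIdeal (hf : f ∈ weightIdeal w M) (hg : g ∈ weightIdeal w N) :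
    f * g ∈ weightIdeal w (M + N) := by
  classical
  intro d hd
  rw [coeff_mul]
  refine Finset.sum_eq_zero fun p hp => ?_
  rw [← Finset.HasAntidiagonal.mem_antidiagonal.1 hp, map_add] at hd
  rcases lt_or_ge (Finsupp.weight w p.1) M with h | h
  · rw [hf _ h, zero_mul]
  · rw [hg p.2 (by omega), mul_zero]

theorem pow_mem_weightIdeal (hf : f ∈ weightIdeal w M) (n : ℕ) :
    f ^ n ∈ weightIdeal w (n * M) := by
  induction n with
  | zero => rw [zero_mul]; exact mem_weightIdeal_zero
  | succ n ih =>
    rw [pow_succ, Nat.succ_mul]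
    exact mul_mem_weightIdeal ih hf

theorem monomial_mem_weightIdeal {d : σ →₀ ℕ} {r : R} (h : N ≤ Finsupp.weight w d) :
    monomial d r ∈ weightIdeal w N := by
  classical
  intro e he
  rw [coeff_monomial, if_neg]
  rintro rfl
  omega

theorem X_mem_weightIdeal (i : σ) : (X i : MvPowerSeries σ R) ∈ weightIdeal w (w i) :=
  monomial_mem_weightIdeal (by rw [Finsupp.weight_single, one_smul])

theorem smul_mem_weightIdeal (c : R) (hf : f ∈ weightIdeal w N) : c • f ∈ weightIdeal w N := by
  intro d hd
  rw [coeff_smul, hf d hd, mul_zero]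

theorem C_mul_mem_weightIdeal (c : R) (hf : f ∈ weightIdeal w N) : C c * f ∈ weightIdeal w N :=
  Ideal.mul_mem_left _ _ hf

theorem prod_mem_weightIdeal {v : τ → ℕ} {u : τ → MvPowerSeries σ R}
    (hu : ∀ i, u i ∈ weightIdeal w (v i)) (d : τ →₀ ℕ) :
    (d.prod fun s e => u s ^ e) ∈ weightIdeal w (Finsupp.weight v d) := by
  induction d using Finsupp.induction_linear with
  | zero => rw [map_zero]; exact mem_weightIdeal_zero
  | add f g hf hg =>
    rw [Finsupp.prod_add_index' (by simp) (by intros; rw [pow_add]), map_add]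
    exact mul_mem_weightIdeal hf hg
  | single a b =>
    rw [Finsupp.prod_single_index (by simp), Finsupp.weight_single, smul_eq_mul]
    exact pow_mem_weightIdeal (hu a) b

/-- Telescoping a b − a' b' = a (b − b') + (a − a') b' shows that a gain of ε over the leading
weight survives products. In this form a perturbation of the arguments of a series is tracked
monomial by monomial. -/
theorem prod_sub_prod_mem_weightIdeal {v : τ → ℕ} {ε : ℕ} {u u' : τ → MvPowerSeries σ R}
    (hu' : ∀ i, u' i ∈ weightIdeal w (v i)) (h : ∀ i, u i - u' i ∈ weightIdeal w (v i + ε))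
    (d : τ →₀ ℕ) :
    ((d.prod fun s e => u s ^ e) - d.prod fun s e => u' s ^ e) ∈
      weightIdeal w (Finsupp.weight v d + ε) := by
  have hu : ∀ i, u i ∈ weightIdeal w (v i) := fun i => by
    have := add_mem (weightIdeal_anti (Nat.le_add_right _ ε) (h i)) (hu' i)
    rwa [sub_add_cancel] at this
  have key : ∀ f g : τ →₀ ℕ,
      ((f.prod fun s e => u s ^ e) - f.prod fun s e => u' s ^ e) ∈
        weightIdeal w (Finsupp.weight v f + ε) →
      ((g.prod fun s e => u s ^ e) - g.prod fun s e => u' s ^ e) ∈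
        weightIdeal w (Finsupp.weight v g + ε) →
      (((f + g).prod fun s e => u s ^ e) - (f + g).prod fun s e => u' s ^ e) ∈
        weightIdeal w (Finsupp.weight v (f + g) + ε) := by
    intro f g hf hg
    rw [Finsupp.prod_add_index' (by simp) (by intros; rw [pow_add]),
      Finsupp.prod_add_index' (by simp) (by intros; rw [pow_add]), map_add]
    have e : ∀ a b a' b' : MvPowerSeries σ R, a * b - a' * b' = a * (b - b') + (a - a') * b' := by
      intros; ring
    rw [e]
    refine add_mem (weightIdeal_anti (by omega)
      (mul_mem_weightIdeal (prod_mem_weightIdeal hu f) hg)) (weightIdeal_anti (by omega)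
      (mul_mem_weightIdeal hf (prod_mem_weightIdeal hu' g)))
  induction d using Finsupp.induction_linear with
  | zero => simp
  | add f g hf hg => exact key f g hf hg
  | single a b =>
    induction b with
    | zero => simp
    | succ b ih =>
      rw [Finsupp.single_add]
      refine key _ _ ih ?_
      rw [Finsupp.prod_single_index (by simp), Finsupp.prod_single_index (by simp),
        Finsupp.weight_single, one_smul, pow_one, pow_one]
      exact h a

theorem subst_mem_weightIdeal {v : τ → ℕ} {u : τ → MvPowerSeries σ R} (hs : HasSubst u)
    (hu : ∀ i, u i ∈ weightIdeal w (v i)) {f : MvPowerSeries τ R} (hf : f ∈ weightIdeal v N) :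
    subst u f ∈ weightIdeal w N := by
  intro e he
  rw [coeff_subst hs]
  refine finsum_eq_zero_of_forall_eq_zero fun d => ?_
  rcases lt_or_ge (Finsupp.weight v d) N with h | h
  · rw [hf d h, zero_smul]
  · rw [prod_mem_weightIdeal hu d e (by omega), smul_zero]

/-- The binomial expansion up to second order. -/
theorem add_pow_sub_mem_weightIdeal {a ε : ℕ} (hf : f ∈ weightIdeal w a)
    (hg : g ∈ weightIdeal w (a + ε)) (n : ℕ) :
    (f + g) ^ n - f ^ n - (n : MvPowerSeries σ R) * f ^ (n - 1) * g ∈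
      weightIdeal w (n * a + 2 * ε) := by
  have hfg : f + g ∈ weightIdeal w a := add_mem hf (weightIdeal_anti (by omega) hg)
  have h1 : ∀ m : ℕ, (m : MvPowerSeries σ R) * f ^ (m - 1) * g ∈ weightIdeal w (m * a + ε) := by
    intro m
    rcases m with _ | m
    · simp
    · rw [mul_assoc]
      refine Ideal.mul_mem_left _ _ (weightIdeal_anti (le_of_eq ?_)
        (mul_mem_weightIdeal (pow_mem_weightIdeal hf m) hg))
      rw [Nat.succ_mul]; ring
  induction n with
  | zero => simp
  | succ n ih =>
    have e : (f + g) ^ (n + 1) - f ^ (n + 1) - ((n + 1 : ℕ) : MvPowerSeries σ R) * f ^ (n + 1 - 1) * g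
        = ((f + g) ^ n - f ^ n - (n : MvPowerSeries σ R) * f ^ (n - 1) * g) * (f + g) +
          (n : MvPowerSeries σ R) * f ^ (n - 1) * g * g := by
      rcases n with _ | n
      · simp
      · simp only [Nat.add_sub_cancel, pow_succ]; push_cast; ring
    rw [e]
    refine add_mem (weightIdeal_anti (le_of_eq ?_) (mul_mem_weightIdeal ih hfg))
      (weightIdeal_anti (le_of_eq ?_) (mul_mem_weightIdeal (h1 n) hg)) <;> ring

/-- The linear part of a perturbed product of three powers. -/
theorem mul_pow_sub_mem_weightIdeal {x y r : Fin 3 → MvPowerSeries σ R} {a : Fin 3 → ℕ} {ε : ℕ}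
    (hε : 1 ≤ ε) (hx : ∀ i, x i ∈ weightIdeal w (a i))
    (hy : ∀ i, y i ∈ weightIdeal w (a i + ε)) (hr : ∀ i, r i ∈ weightIdeal w (a i + ε + 1))
    (k l m : ℕ) :
    (x 0 + (y 0 + r 0)) ^ k * (x 1 + (y 1 + r 1)) ^ l * (x 2 + (y 2 + r 2)) ^ m
        - x 0 ^ k * x 1 ^ l * x 2 ^ m
        - ((k : MvPowerSeries σ R) * (x 0 ^ (k - 1) * y 0 * x 1 ^ l * x 2 ^ m) +
            (l : MvPowerSeries σ R) * (x 0 ^ k * (x 1 ^ (l - 1) * y 1) * x 2 ^ m) +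
            (m : MvPowerSeries σ R) * (x 0 ^ k * x 1 ^ l * (x 2 ^ (m - 1) * y 2))) ∈
      weightIdeal w (k * a 0 + l * a 1 + m * a 2 + ε + 1) := by
  have hyr : ∀ i, y i + r i ∈ weightIdeal w (a i + ε) := fun i =>
    add_mem (hy i) (weightIdeal_anti (by omega) (hr i))
  have hlin : ∀ (i : Fin 3) (n : ℕ), (n : MvPowerSeries σ R) * x i ^ (n - 1) * y i ∈
      weightIdeal w (n * a i + ε) := by
    intro i n
    rcases n with _ | n
    · simp
    · rw [mul_assoc]
      refine Ideal.mul_mem_left _ _ (weightIdeal_anti (le_of_eq ?_)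
        (mul_mem_weightIdeal (pow_mem_weightIdeal (hx i) n) (hy i)))
      rw [Nat.succ_mul]; ring
  have hrem : ∀ (i : Fin 3) (n : ℕ), ∃ q ∈ weightIdeal w (n * a i + ε + 1),
      (x i + (y i + r i)) ^ n = x i ^ n + (n : MvPowerSeries σ R) * x i ^ (n - 1) * y i + q := by
    intro i n
    refine ⟨(x i + (y i + r i)) ^ n - x i ^ n - (n : MvPowerSeries σ R) * x i ^ (n - 1) * y i,
      ?_, by ring⟩
    have e : (x i + (y i + r i)) ^ n - x i ^ n - (n : MvPowerSeries σ R) * x i ^ (n - 1) * y i =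
        ((x i + (y i + r i)) ^ n - x i ^ n -
          (n : MvPowerSeries σ R) * x i ^ (n - 1) * (y i + r i)) +
          (n : MvPowerSeries σ R) * (x i ^ (n - 1) * r i) := by ring
    rw [e]
    refine add_mem (weightIdeal_anti (by omega) (add_pow_sub_mem_weightIdeal (hx i) (hyr i) n)) ?_
    rcases n with _ | n
    · simp
    · refine Ideal.mul_mem_left _ _ (weightIdeal_anti (le_of_eq ?_)
        (mul_mem_weightIdeal (pow_mem_weightIdeal (hx i) n) (hr i)))
      rw [Nat.succ_mul]; ring
  obtain ⟨q0, hq0, e0⟩ := hrem 0 k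
  obtain ⟨q1, hq1, e1⟩ := hrem 1 l
  obtain ⟨q2, hq2, e2⟩ := hrem 2 m
  have p0 := pow_mem_weightIdeal (hx 0) k
  have p1 := pow_mem_weightIdeal (hx 1) l
  have p2 := pow_mem_weightIdeal (hx 2) m
  have l0 := hlin 0 k
  have l1 := hlin 1 l
  have l2 := hlin 2 m
  rw [e0, e1, e2]
  generalize hP0 : x 0 ^ k = P0 at *
  generalize hP1 : x 1 ^ l = P1 at *
  generalize hP2 : x 2 ^ m = P2 at *
  -- Beyond the terms linear in a single y, each product contains a remainder q or two linear
  -- factors; the latter gain 2ε ≥ ε + 1, which uses `hε`.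
  have E : (P0 + (k : MvPowerSeries σ R) * x 0 ^ (k - 1) * y 0 + q0) *
        (P1 + (l : MvPowerSeries σ R) * x 1 ^ (l - 1) * y 1 + q1) *
        (P2 + (m : MvPowerSeries σ R) * x 2 ^ (m - 1) * y 2 + q2) - P0 * P1 * P2 -
      ((k : MvPowerSeries σ R) * (x 0 ^ (k - 1) * y 0 * P1 * P2) +
            (l : MvPowerSeries σ R) * (P0 * (x 1 ^ (l - 1) * y 1) * P2) +
            (m : MvPowerSeries σ R) * (P0 * P1 * (x 2 ^ (m - 1) * y 2))) =
      q0 * (P1 + (l : MvPowerSeries σ R) * x 1 ^ (l - 1) * y 1 + q1) *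
          (P2 + (m : MvPowerSeries σ R) * x 2 ^ (m - 1) * y 2 + q2) +
      (P0 + (k : MvPowerSeries σ R) * x 0 ^ (k - 1) * y 0) * q1 *
          (P2 + (m : MvPowerSeries σ R) * x 2 ^ (m - 1) * y 2 + q2) +
      (P0 + (k : MvPowerSeries σ R) * x 0 ^ (k - 1) * y 0) *
        (P1 + (l : MvPowerSeries σ R) * x 1 ^ (l - 1) * y 1) * q2 +
      P0 * ((l : MvPowerSeries σ R) * x 1 ^ (l - 1) * y 1) *
        ((m : MvPowerSeries σ R) * x 2 ^ (m - 1) * y 2) +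
      ((k : MvPowerSeries σ R) * x 0 ^ (k - 1) * y 0) * P1 *
        ((m : MvPowerSeries σ R) * x 2 ^ (m - 1) * y 2) +
      ((k : MvPowerSeries σ R) * x 0 ^ (k - 1) * y 0) *
        ((l : MvPowerSeries σ R) * x 1 ^ (l - 1) * y 1) *
          (P2 + (m : MvPowerSeries σ R) * x 2 ^ (m - 1) * y 2) := by ring
  rw [E]
  generalize (k : MvPowerSeries σ R) * x 0 ^ (k - 1) * y 0 = L0 at *
  generalize (l : MvPowerSeries σ R) * x 1 ^ (l - 1) * y 1 = L1 at *
  generalize (m : MvPowerSeries σ R) * x 2 ^ (m - 1) * y 2 = L2 at *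
  have s0 : P0 + L0 ∈ weightIdeal w (k * a 0) := add_mem p0 (weightIdeal_anti (by omega) l0)
  have s1 : P1 + L1 ∈ weightIdeal w (l * a 1) := add_mem p1 (weightIdeal_anti (by omega) l1)
  have s2 : P2 + L2 ∈ weightIdeal w (m * a 2) := add_mem p2 (weightIdeal_anti (by omega) l2)
  have t1 : P1 + L1 + q1 ∈ weightIdeal w (l * a 1) := add_mem s1 (weightIdeal_anti (by omega) hq1)
  have t2 : P2 + L2 + q2 ∈ weightIdeal w (m * a 2) := add_mem s2 (weightIdeal_anti (by omega) hq2)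
  have aux : ∀ {A B C' : MvPowerSeries σ R} {i j k' n : ℕ}, A ∈ weightIdeal w i →
      B ∈ weightIdeal w j → C' ∈ weightIdeal w k' → n ≤ i + j + k' →
      A * B * C' ∈ weightIdeal w n := fun hA hB hC hn =>
    weightIdeal_anti hn (mul_mem_weightIdeal (mul_mem_weightIdeal hA hB) hC)
  refine add_mem (add_mem (add_mem (add_mem (add_mem ?_ ?_) ?_) ?_) ?_) ?_
  · exact aux hq0 t1 t2 (by omega)
  · exact aux s0 hq1 t2 (by omega)
  · exact aux s0 s1 hq2 (by omega)
  · exact aux p0 l1 l2 (by omega)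
  · exact aux l0 p1 l2 (by omega)
  · exact aux l0 l1 s2 (by omega)

end WeightIdeal

end MvPowerSeries

open MvPowerSeries

/-! ### Exponents in two and three variables -/

/-- The exponent of `z^a χ^b s^m`. -/
def tri (a b m : ℕ) : Fin 3 →₀ ℕ := Finsupp.equivFunOnFinite.symm ![a, b, m]

/-- The exponent of `z^a w^m`. -/
def duo (a m : ℕ) : Fin 2 →₀ ℕ := Finsupp.equivFunOnFinite.symm ![a, m]

theorem coeff₃_eq (φ : MvPowerSeries (Fin 3) ℂ) (a b m : ℕ) :
    coeff₃ φ a b m = coeff (tri a b m) φ := rfl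

@[simp] theorem tri_zero (a b m : ℕ) : tri a b m 0 = a := rfl
@[simp] theorem tri_one (a b m : ℕ) : tri a b m 1 = b := rfl
@[simp] theorem tri_two (a b m : ℕ) : tri a b m 2 = m := rfl
@[simp] theorem duo_zero (a m : ℕ) : duo a m 0 = a := rfl
@[simp] theorem duo_one (a m : ℕ) : duo a m 1 = m := rfl

theorem tri_eta (d : Fin 3 →₀ ℕ) : tri (d 0) (d 1) (d 2) = d := by
  ext i; fin_cases i <;> rfl

theorem duo_eta (d : Fin 2 →₀ ℕ) : duo (d 0) (d 1) = d := by
  ext i; fin_cases i <;> rfl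

theorem tri_inj {a b m a' b' m' : ℕ} :
    tri a b m = tri a' b' m' ↔ a = a' ∧ b = b' ∧ m = m' := by
  constructor
  · intro h
    exact ⟨DFunLike.congr_fun h 0, DFunLike.congr_fun h 1, DFunLike.congr_fun h 2⟩
  · rintro ⟨rfl, rfl, rfl⟩; rfl

theorem duo_inj {a m a' m' : ℕ} : duo a m = duo a' m' ↔ a = a' ∧ m = m' := by
  constructor
  · intro h
    exact ⟨DFunLike.congr_fun h 0, DFunLike.congr_fun h 1⟩
  · rintro ⟨rfl, rfl⟩; rfl

theorem tri_le_iff {a b m a' b' m' : ℕ} :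
    tri a b m ≤ tri a' b' m' ↔ a ≤ a' ∧ b ≤ b' ∧ m ≤ m' := by
  constructor
  · intro h
    exact ⟨h 0, h 1, h 2⟩
  · rintro ⟨h0, h1, h2⟩ i
    fin_cases i <;> assumption

theorem tri_sub (a b m a' b' m' : ℕ) :
    tri a b m - tri a' b' m' = tri (a - a') (b - b') (m - m') := by
  ext i; fin_cases i <;> rfl

theorem weight_three (w : Fin 3 → ℕ) (d : Fin 3 →₀ ℕ) :
    Finsupp.weight w d = d 0 * w 0 + d 1 * w 1 + d 2 * w 2 := by
  rw [Finsupp.weight_eq_sum, Fin.sum_univ_three]; simp only [smul_eq_mul]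

theorem weight_two (w : Fin 2 → ℕ) (d : Fin 2 →₀ ℕ) :
    Finsupp.weight w d = d 0 * w 0 + d 1 * w 1 := by
  rw [Finsupp.weight_eq_sum, Fin.sum_univ_two]; simp only [smul_eq_mul]

theorem prod_three {R : Type*} [CommMonoid R] (u : Fin 3 → R) (d : Fin 3 →₀ ℕ) :
    (d.prod fun s e => u s ^ e) = u 0 ^ d 0 * u 1 ^ d 1 * u 2 ^ d 2 := by
  rw [Finsupp.prod_fintype _ _ (fun _ => pow_zero _), Fin.prod_univ_three]

theorem prod_two {R : Type*} [CommMonoid R] (u : Fin 2 → R) (d : Fin 2 →₀ ℕ) :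
    (d.prod fun s e => u s ^ e) = u 0 ^ d 0 * u 1 ^ d 1 := by
  rw [Finsupp.prod_fintype _ _ (fun _ => pow_zero _), Fin.prod_univ_two]

theorem X_pow_three {R : Type*} [CommRing R] (a b m : ℕ) :
    (X 0 ^ a * X 1 ^ b * X 2 ^ m : MvPowerSeries (Fin 3) R) = monomial (tri a b m) 1 := by
  rw [monomial_eq', map_one, one_mul, prod_three]; rfl

theorem X_pow_two {R : Type*} [CommRing R] (a m : ℕ) :
    (X 0 ^ a * X 1 ^ m : MvPowerSeries (Fin 2) R) = monomial (duo a m) 1 := by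
  rw [monomial_eq', map_one, one_mul, prod_two]; rfl

/-! ### Series without terms below a given exponent -/

/-- `φ(z, 0, s) = φ(0, χ, s) = 0`, all `φ_{β,ν}` with `(β, ν) ≺ (α, μ)` vanish, and `φ_{α,μ}(χ)`
vanishes to order at least `n`. -/
structure VanishesBelow (φ : MvPowerSeries (Fin 3) ℂ) (α n μ : ℕ) : Prop where
  left : ∀ a m, coeff₃ φ a 0 m = 0
  right : ∀ b m, coeff₃ φ 0 b m = 0
  low : ∀ y, PairLT y (α, μ) → ∀ b, coeff₃ φ y.1 b y.2 = 0
  order : ∀ b < n, coeff₃ φ α b μ = 0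

namespace VanishesBelow

variable {φ ψ : MvPowerSeries (Fin 3) ℂ} {α n μ : ℕ}

theorem constantCoeff (h : VanishesBelow φ α n μ) : MvPowerSeries.constantCoeff φ = 0 := by
  rw [← coeff_zero_eq_constantCoeff_apply]
  have := h.left 0 0
  rwa [coeff₃_eq, show tri 0 0 0 = 0 by ext i; fin_cases i <;> rfl] at this

/-- The order ≺ compares both m and a + m. A surviving term with m < μ must therefore exceed α + μ
in a + m, so what it lacks in s it more than makes up for in z. -/
theorem support (h : VanishesBelow φ α n μ) {a b m : ℕ} (hc : coeff₃ φ a b m ≠ 0) :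
    1 ≤ a ∧ 1 ≤ b ∧ (m < μ → α + μ < a + m) ∧ (m = μ → α ≤ a) ∧ (m = μ → a = α → n ≤ b) := by
  refine ⟨?_, ?_, ?_, ?_, ?_⟩
  · by_contra h0
    obtain rfl : a = 0 := by omega
    exact hc (h.right b m)
  · by_contra h0
    obtain rfl : b = 0 := by omega
    exact hc (h.left a m)
  · intro hm
    by_contra h0
    refine hc (h.low (a, m) ⟨by simpa using by omega, by simpa using by omega, ?_⟩ b)
    simp only [ne_eq, Prod.mk.injEq]; omega
  · rintro rfl
    by_contra h0
    refine hc (h.low (a, m) ⟨by simpa using by omega, le_rfl, ?_⟩ b)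
    simp only [ne_eq, Prod.mk.injEq]; omega
  · rintro rfl rfl
    by_contra h0
    exact hc (h.order b (by omega))

theorem mem_of_forall (h : VanishesBelow φ α n μ) {w : Fin 3 → ℕ} {N : ℕ}
    (H : ∀ a b m, 1 ≤ a → 1 ≤ b → (m ≤ μ → α ≤ a) → N ≤ a * w 0 + b * w 1 + m * w 2) :
    φ ∈ weightIdeal w N := by
  intro d hd
  by_contra hc
  rw [← tri_eta d] at hc
  obtain ⟨h1, h2, h3, h4, h5⟩ := h.support hc
  have := H (d 0) (d 1) (d 2) h1 h2 (fun hm => by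
    rcases Nat.lt_or_ge (d 2) μ with h' | h'
    · have := h3 h'; omega
    · exact h4 (by omega))
  rw [weight_three] at hd
  omega

/-- The lightest possible term of φ is z^α χ, of weight αK + 2. Giving s the weight αK + 1 makes φ
strictly heavier than s, so that s is the leading part of s ± iφ. -/
theorem mem_weightIdeal_main (h : VanishesBelow φ α n μ) {K : ℕ} :
    φ ∈ weightIdeal ![K, 2, α * K + 1] (α * K + 1 + 1) := by
  refine h.mem_of_forall fun a b m ha hb hm => ?_
  simp only [Matrix.cons_val]
  rcases m with _ | m
  · have := Nat.mul_le_mul_right K (hm (Nat.zero_le _)); omega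
  · have : α * K + 1 ≤ (m + 1) * (α * K + 1) := Nat.le_mul_of_pos_left _ (by omega)
    omega

/-- Divisibility of φ by z suffices: in this grading replacing w by s ± iφ does not lower weights.
-/
theorem mem_weightIdeal_first (h : VanishesBelow φ α n μ) {p : ℕ} (hp : 1 ≤ p) :
    φ ∈ weightIdeal ![p, 0, 1] 1 := by
  refine h.mem_of_forall fun a b m ha hb hm => ?_
  simp only [Matrix.cons_val]
  have : 1 * 1 ≤ a * p := Nat.mul_le_mul ha hp
  omega

/-- The grading is tuned so that φ exceeds s by α²μ + α. Two factors φ then overshoot every exponent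
z^x χ^b s^(μ+j) with x ≤ α, as soon as at least j + 1 factors s + cφ are present. Powers of s + cφ
may thus be linearized in φ. -/
theorem mem_weightIdeal_square (h : VanishesBelow φ α n μ) :
    φ ∈ weightIdeal ![α * (μ + 1) + 1, 0, α ^ 2] (α ^ 2 + (α ^ 2 * μ + α)) := by
  refine h.mem_of_forall fun a b m ha hb hm => ?_
  simp only [Matrix.cons_val]
  rcases Nat.lt_or_ge μ m with hm' | hm'
  · have h1 : 1 * (α * (μ + 1) + 1) ≤ a * (α * (μ + 1) + 1) := Nat.mul_le_mul_right _ ha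
    have h2 : (μ + 1) * α ^ 2 ≤ m * α ^ 2 := Nat.mul_le_mul_right _ hm'
    nlinarith [Nat.zero_le (α * μ)]
  · have h1 : α * (α * (μ + 1) + 1) ≤ a * (α * (μ + 1) + 1) := Nat.mul_le_mul_right _ (hm hm')
    nlinarith

end VanishesBelow

/-- Perturbing the arguments of `ψ` around a scaling: only the lowest term of `ψ` contributes. -/
theorem coeff_subst_perturb {ψ : MvPowerSeries (Fin 3) ℂ} {α n μ K p ε : ℕ}
    (h : VanishesBelow ψ α n μ) (hK : 2 * n ≤ K) (hp : 1 ≤ p) {u : Fin 3 → ℂ}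
    {Y : Fin 3 → MvPowerSeries (Fin 3) ℂ} (hY : ∀ i, constantCoeff (Y i) = 0)
    (h0 : Y 0 - u 0 • X 0 ∈ weightIdeal ![K, 2, α * K + 1] (K + ε))
    (h1 : Y 1 - u 1 • X 1 ∈ weightIdeal ![K, 2, α * K + 1] (2 + ε))
    (h2 : Y 2 - u 2 • X 2 ∈ weightIdeal ![K, 2, α * K + 1] (α * K + 1 + ε))
    (g0 : Y 0 ∈ weightIdeal ![p, 0, 1] p) (g2 : Y 2 ∈ weightIdeal ![p, 0, 1] 1)
    {x b y : ℕ} (he1 : x * K + b * 2 + y * (α * K + 1) ≤ α * K + n * 2 + μ * (α * K + 1) + ε)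
    (he2 : x * p + y < α * p + p + μ) :
    coeff (tri x b y) (subst Y ψ) = u 0 ^ x * u 1 ^ b * u 2 ^ y * coeff (tri x b y) ψ +
      coeff₃ ψ α n μ * coeff (tri x b y) (Y 0 ^ α * Y 1 ^ n * Y 2 ^ μ -
        (u 0 • X 0) ^ α * (u 1 • X 1) ^ n * (u 2 • X 2) ^ μ) := by
  set e := tri x b y with he
  set w : Fin 3 → ℕ := ![K, 2, α * K + 1] with hw
  have hsY := hasSubst_of_constantCoeff_zero hY
  have hsu : HasSubst (u • (X : Fin 3 → MvPowerSeries (Fin 3) ℂ)) := HasSubst.smul_X u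
  have hresc : coeff e (subst (u • (X : Fin 3 → MvPowerSeries (Fin 3) ℂ)) ψ) =
      u 0 ^ x * u 1 ^ b * u 2 ^ y * coeff e ψ := by
    rw [← rescale_eq_subst, coeff_rescale, prod_three]; rfl
  -- Comparing with the rescaled series monomial by monomial leaves a sum over the support of ψ, of
  -- which only z^α χ^n s^μ is to survive.
  rw [← hresc, ← sub_eq_iff_eq_add', coeff_subst hsY, coeff_subst hsu,
    ← finsum_sub_distrib (coeff_subst_finite hsY ψ e) (coeff_subst_finite hsu ψ e)]
  rw [finsum_eq_single _ (tri α n μ)]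
  · simp only [smul_eq_mul, prod_three, tri_zero, tri_one, tri_two, map_sub, coeff₃_eq]
    simp only [Pi.smul_apply']
    ring
  intro d hd
  rw [← smul_sub, ← map_sub]
  by_cases hc : coeff₃ ψ (d 0) (d 1) (d 2) = 0
  · rw [coeff₃_eq, tri_eta] at hc
    rw [hc, zero_smul]
  obtain ⟨s1, s2, s3, s4, s5⟩ := h.support hc
  have hX : ∀ i, (u • (X : Fin 3 → MvPowerSeries (Fin 3) ℂ)) i ∈ weightIdeal w (w i) := fun i =>
    smul_mem_weightIdeal _ (X_mem_weightIdeal i)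
  have hYX : ∀ i, Y i - (u • (X : Fin 3 → MvPowerSeries (Fin 3) ℂ)) i ∈
      weightIdeal w (w i + ε) := by
    intro i; fin_cases i
    · exact h0
    · exact h1
    · exact h2
  have hD := prod_sub_prod_mem_weightIdeal hX hYX d
  suffices hz : coeff e ((d.prod fun s e => Y s ^ e) -
      d.prod fun s e => (u • (X : Fin 3 → MvPowerSeries (Fin 3) ℂ)) s ^ e) = 0 by
    rw [hz, smul_zero]
  -- Monomials with fewer than μ factors s can be light in the main grading, but their extra factors
  -- z exclude them in the grading (p, 0, 1). The remaining ones are excluded by the main grading.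
  by_cases hm : d 2 < μ
  · have hv : ∀ i, Y i ∈ weightIdeal ![p, 0, 1] ((![p, 0, 1] : Fin 3 → ℕ) i) := by
      intro i; fin_cases i
      · exact g0
      · exact mem_weightIdeal_zero
      · exact g2
    have hv' : ∀ i, (u • (X : Fin 3 → MvPowerSeries (Fin 3) ℂ)) i ∈
        weightIdeal ![p, 0, 1] ((![p, 0, 1] : Fin 3 → ℕ) i) := fun i =>
      smul_mem_weightIdeal _ (X_mem_weightIdeal i)
    have hP := sub_mem (prod_mem_weightIdeal hv d) (prod_mem_weightIdeal hv' d)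
    refine coeff_eq_zero_of_mem_weightIdeal hP ?_
    simp only [weight_three, Matrix.cons_val, he, tri_zero, tri_one, tri_two]
    have h3 := s3 hm
    obtain ⟨q, hq⟩ : ∃ q, d 0 = α + 1 + q + (μ - d 2) := ⟨d 0 - (α + 1 + (μ - d 2)), by omega⟩
    obtain ⟨r, hr⟩ : ∃ r, p = r + 1 := ⟨p - 1, by omega⟩
    have : (μ - d 2) ≤ (μ - d 2) * p := Nat.le_mul_of_pos_right _ hp
    have e1 : d 0 * p = α * p + p + q * p + (μ - d 2) * p := by rw [hq]; ring
    omega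
  · refine coeff_eq_zero_of_mem_weightIdeal hD ?_
    simp only [weight_three, hw, Matrix.cons_val, he, tri_zero, tri_one, tri_two]
    rcases Nat.eq_or_lt_of_le (not_lt.1 hm) with hm' | hm'
    · rcases Nat.eq_or_lt_of_le (s4 hm'.symm) with ha | ha
      · have hb := s5 hm'.symm ha.symm
        have hb' : d 1 ≠ n := by
          rintro hb'
          apply hd
          rw [← tri_eta d, hm', ha, hb']
        rw [← ha, ← hm']
        omega
      -- An extra factor z weighs K ≥ 2n, as much as χ^n. In the last case an extra s outweighs z^α,
      -- and the one factor z that is always present pays for χ^n.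
      · have h3 : (α + 1) * K ≤ d 0 * K := Nat.mul_le_mul_right _ ha
        rw [← hm', add_mul] at *
        omega
    · have h3 : 1 * K ≤ d 0 * K := Nat.mul_le_mul_right _ s1
      have h4 : (μ + 1) * (α * K + 1) ≤ d 2 * (α * K + 1) := Nat.mul_le_mul_right _ hm'
      rw [add_mul, one_mul] at h4
      omega

/-! ### The complexified graph -/

/-- The series `f(z, s + iφ)`. -/
def onGraph (φ : MvPowerSeries (Fin 3) ℂ) (f : MvPowerSeries (Fin 2) ℂ) :
    MvPowerSeries (Fin 3) ℂ := subst ![X 0, X 2 + C Complex.I * φ] f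

/-- The series `f(χ, s - iφ)`. -/
def onGraphConj (φ : MvPowerSeries (Fin 3) ℂ) (f : MvPowerSeries (Fin 2) ℂ) :
    MvPowerSeries (Fin 3) ℂ := subst ![X 1, X 2 + C (-Complex.I) * φ] f

theorem constantCoeff_graphFamily {φ : MvPowerSeries (Fin 3) ℂ} (h : constantCoeff φ = 0)
    (v : Fin 3) (c : ℂ) (i : Fin 2) :
    constantCoeff ((![X v, X 2 + C c * φ] : Fin 2 → MvPowerSeries (Fin 3) ℂ) i) = 0 := by
  fin_cases i <;> simp [h]

theorem hasSubst_graphFamily {φ : MvPowerSeries (Fin 3) ℂ} (h : constantCoeff φ = 0)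
    (v : Fin 3) (c : ℂ) :
    HasSubst (![X v, X 2 + C c * φ] : Fin 2 → MvPowerSeries (Fin 3) ℂ) :=
  hasSubst_of_constantCoeff_zero (constantCoeff_graphFamily h v c)

theorem subst_graphFamily_mem {φ : MvPowerSeries (Fin 3) ℂ} (h : constantCoeff φ = 0)
    {v : Fin 3} {c : ℂ} {w : Fin 3 → ℕ} {N : ℕ} (hφ : φ ∈ weightIdeal w (w 2))
    {f : MvPowerSeries (Fin 2) ℂ} (hf : f ∈ weightIdeal ![w v, w 2] N) :
    subst ![X v, X 2 + C c * φ] f ∈ weightIdeal w N := by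
  refine subst_mem_weightIdeal (hasSubst_graphFamily h v c) (fun i => ?_) hf
  fin_cases i
  · exact X_mem_weightIdeal v
  · exact add_mem (X_mem_weightIdeal 2) (C_mul_mem_weightIdeal c hφ)

/-- The coefficients of `z^a₀ χ^a₁ (s + cφ)^m` at exponents of low degree. -/
theorem coeff_graph_pow {φ : MvPowerSeries (Fin 3) ℂ} {α n μ : ℕ} (h : VanishesBelow φ α n μ)
    (hα : 1 ≤ α) (c : ℂ) {j a0 a1 m x b : ℕ} (hx : x ≤ α) (hm : j + 1 ≤ m)
    (hne : a0 ≠ x ∨ a1 ≠ b) :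
    coeff (tri x b (μ + j)) (X 0 ^ a0 * X 1 ^ a1 * (X 2 + C c * φ) ^ m) =
      if m = j + 1 ∧ x = α ∧ a0 = 0 ∧ a1 ≤ b then c * (j + 1) * coeff₃ φ α (b - a1) μ else 0 := by
  set w : Fin 3 → ℕ := ![α * (μ + 1) + 1, 0, α ^ 2] with hw
  have hX : (X 2 : MvPowerSeries (Fin 3) ℂ) ∈ weightIdeal w (α ^ 2) := X_mem_weightIdeal 2
  have hφ : C c * φ ∈ weightIdeal w (α ^ 2 + (α ^ 2 * μ + α)) :=
    C_mul_mem_weightIdeal c (h.mem_weightIdeal_square)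
  -- The terms quadratic in φ are too heavy for the exponent in question.
  have h1 := add_pow_sub_mem_weightIdeal hX hφ m
  have h2 := Ideal.mul_mem_left _ (X 0 ^ a0 * X 1 ^ a1 : MvPowerSeries (Fin 3) ℂ) h1
  rw [mul_sub, mul_sub, sub_sub] at h2
  rw [coeff_eq_of_sub_mem_weightIdeal h2]
  swap
  · rw [weight_three]
    simp only [hw, Matrix.cons_val, tri_zero, tri_one, tri_two]
    have e1 : x * (α * (μ + 1) + 1) ≤ α * (α * (μ + 1) + 1) := Nat.mul_le_mul_right _ hx
    have e2 : (j + 1) * α ^ 2 ≤ m * α ^ 2 := Nat.mul_le_mul_right _ hm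
    nlinarith
  -- The term without φ is z^a₀ χ^a₁ s^m, which `hne` excludes.
  rw [map_add, X_pow_three, coeff_monomial, if_neg, zero_add]
  swap
  · rw [tri_inj]; rintro ⟨rfl, rfl, -⟩; simp at hne
  have e : (X 0 ^ a0 * X 1 ^ a1 * ((m : MvPowerSeries (Fin 3) ℂ) * X 2 ^ (m - 1) * (C c * φ))) =
      C ((m : ℂ) * c) * (monomial (tri a0 a1 (m - 1)) 1 * φ) := by
    rw [← X_pow_three, map_mul, map_natCast]; ring
  rw [e, coeff_C_mul, coeff_monomial_mul]
  simp only [tri_le_iff, tri_sub, ← coeff₃_eq, one_mul]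
  split_ifs with h3 h4 h4
  · obtain ⟨rfl, rfl, rfl, -⟩ := h4
    rw [show μ + j - (j + 1 - 1) = μ by omega, Nat.sub_zero]
    push_cast; ring
  -- Since m − 1 ≥ j, this coefficient of φ has s-exponent at most μ and z-exponent at most α, so it
  -- vanishes unless both bounds are attained.
  · suffices hz : coeff₃ φ (x - a0) (b - a1) (μ + j - (m - 1)) = 0 by rw [hz, mul_zero]
    by_contra hc
    obtain ⟨s1, s2, s3, s4, s5⟩ := h.support hc
    apply h4
    rcases Nat.lt_or_ge (μ + j - (m - 1)) μ with h' | h'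
    · have := s3 h'; omega
    · have := s4 (by omega)
      omega
  · exfalso; omega
  · rw [mul_zero]

/-- The coefficients of `g(z, s + cφ)` (`v = 0`) or `g(χ, s + cφ)` (`v = 1`) for a series `g`
divisible by `w^(j+1)`. -/
theorem coeff_subst_graphFamily {φ : MvPowerSeries (Fin 3) ℂ} {α n μ : ℕ}
    (h : VanishesBelow φ α n μ) (hα : 1 ≤ α) (c : ℂ) {j x b : ℕ} (hx : x ≤ α) {v : Fin 3}
    {g : MvPowerSeries (Fin 2) ℂ} (hg : ∀ a m, m ≤ j → coeff (duo a m) g = 0)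
    (hv : (v = 0 ∧ 1 ≤ b) ∨ (v = 1 ∧ 1 ≤ x ∧
      ∀ a, 1 ≤ a → a ≤ b → coeff₃ φ α (b - a) μ * coeff (duo a (j + 1)) g = 0)) :
    coeff (tri x b (μ + j)) (subst ![X v, X 2 + C c * φ] g) =
      if x = α then c * (j + 1) * coeff₃ φ α b μ * coeff (duo 0 (j + 1)) g else 0 := by
  rw [coeff_subst (hasSubst_graphFamily h.constantCoeff v c)]
  have key : ∀ d : Fin 2 →₀ ℕ, coeff d g • coeff (tri x b (μ + j))
      (d.prod fun s e => (![X v, X 2 + C c * φ] : Fin 2 → MvPowerSeries (Fin 3) ℂ) s ^ e) =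
      if d = duo 0 (j + 1) ∧ x = α then
        c * (j + 1) * coeff₃ φ α b μ * coeff (duo 0 (j + 1)) g else 0 := by
    intro d
    rw [prod_two]
    simp only [Matrix.cons_val]
    by_cases hm : d 1 ≤ j
    · have h0 := hg (d 0) (d 1) hm
      rw [duo_eta] at h0
      rw [h0, zero_smul, if_neg]
      rintro ⟨rfl, -⟩
      simp at hm
    -- For v = 0 a term z^a w^(j+1) with a ≥ 1 would need a coefficient of φ with z-exponent below
    -- α, hence contributes nothing. For v = 1 a term χ^a w^(j+1) would contribute φ_{α,μ} at
    -- χ^(b−a), and the last hypothesis in `hv` removes it.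
    rcases hv with ⟨rfl, hb⟩ | ⟨rfl, hx1, hv⟩
    · have := coeff_graph_pow h hα c (j := j) (a0 := d 0) (a1 := 0) (m := d 1) (b := b) hx
        (by omega) (Or.inr (by omega))
      rw [pow_zero, mul_one] at this
      rw [this]
      by_cases hd : d = duo 0 (j + 1) ∧ x = α
      · obtain ⟨rfl, rfl⟩ := hd
        simp; ring
      · rw [if_neg hd, if_neg, smul_zero]
        rintro ⟨h1, h2, h3, -⟩
        exact hd ⟨by rw [← duo_eta d, h1, h3], h2⟩
    · have := coeff_graph_pow h hα c (j := j) (a0 := 0) (a1 := d 0) (m := d 1) (b := b) hx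
        (by omega) (Or.inl (by omega))
      rw [pow_zero, one_mul] at this
      rw [this]
      by_cases hd : d = duo 0 (j + 1) ∧ x = α
      · obtain ⟨rfl, rfl⟩ := hd
        simp; ring
      · rw [if_neg hd]
        split_ifs with h1
        · obtain ⟨h1, h2, -, h3⟩ := h1
          have hd0 : 1 ≤ d 0 := by
            rcases Nat.eq_zero_or_pos (d 0) with h0 | h0
            · exact absurd ⟨by rw [← duo_eta d, h1, h0], h2⟩ hd
            · exact h0
          have := hv (d 0) hd0 h3
          rw [← h1, duo_eta] at this
          rw [smul_eq_mul]
          linear_combination (c * (j + 1)) * this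
        · rw [smul_zero]
  rw [finsum_congr key]
  rw [finsum_eq_single _ (duo 0 (j + 1))]
  · simp
  · intro d hd
    rw [if_neg (fun h => hd h.1)]

/-! ### The equation of a map between two graphs -/

/-- The series with conjugate coefficients. -/
def conjSeries (f : MvPowerSeries (Fin 2) ℂ) : MvPowerSeries (Fin 2) ℂ := map (starRingEnd ℂ) f

theorem coeff_conjSeries (f : MvPowerSeries (Fin 2) ℂ) (d : Fin 2 →₀ ℕ) :
    coeff d (conjSeries f) = starRingEnd ℂ (coeff d f) := rfl

theorem constantCoeff_conjSeries {f : MvPowerSeries (Fin 2) ℂ} (hf : constantCoeff f = 0) :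
    constantCoeff (conjSeries f) = 0 := by
  rw [conjSeries, constantCoeff_map, hf, map_zero]

theorem conjSeries_mem {f : MvPowerSeries (Fin 2) ℂ} {w : Fin 2 → ℕ} {N : ℕ}
    (hf : f ∈ weightIdeal w N) : conjSeries f ∈ weightIdeal w N := fun d hd => by
  rw [coeff_conjSeries, hf d hd, map_zero]

theorem coeff_duo_zero {f : MvPowerSeries (Fin 2) ℂ} (hf : constantCoeff f = 0) :
    coeff (duo 0 0) f = 0 := by
  rw [show duo 0 0 = 0 by ext i; fin_cases i <;> rfl, coeff_zero_eq_constantCoeff_apply, hf]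

/-- `(F, G)` maps the graph `Im w = φ` into the graph `Im w = ψ`. -/
def IsGraphMap (φ ψ : MvPowerSeries (Fin 3) ℂ) (F G : MvPowerSeries (Fin 2) ℂ) : Prop :=
  C (1 / (2 * Complex.I)) * (onGraph φ G - onGraphConj φ (conjSeries G)) =
    subst ![onGraph φ F, onGraphConj φ (conjSeries F),
      C (1 / 2) * (onGraph φ G + onGraphConj φ (conjSeries G))] ψ

section

variable {φ ψ : MvPowerSeries (Fin 3) ℂ} {F G : MvPowerSeries (Fin 2) ℂ}

theorem constantCoeff_onGraph (hφ : constantCoeff φ = 0) {f : MvPowerSeries (Fin 2) ℂ}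
    (hf : constantCoeff f = 0) : constantCoeff (onGraph φ f) = 0 :=
  constantCoeff_subst_eq_zero (hasSubst_graphFamily hφ 0 _) (constantCoeff_graphFamily hφ 0 _) hf

theorem constantCoeff_onGraphConj (hφ : constantCoeff φ = 0) {f : MvPowerSeries (Fin 2) ℂ}
    (hf : constantCoeff f = 0) : constantCoeff (onGraphConj φ f) = 0 :=
  constantCoeff_subst_eq_zero (hasSubst_graphFamily hφ 1 _) (constantCoeff_graphFamily hφ 1 _) hf

theorem onGraph_mem (hφ0 : constantCoeff φ = 0) {w : Fin 3 → ℕ} {N : ℕ}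
    (hφ : φ ∈ weightIdeal w (w 2)) {f : MvPowerSeries (Fin 2) ℂ}
    (hf : f ∈ weightIdeal ![w 0, w 2] N) : onGraph φ f ∈ weightIdeal w N :=
  subst_graphFamily_mem hφ0 hφ hf

theorem onGraphConj_mem (hφ0 : constantCoeff φ = 0) {w : Fin 3 → ℕ} {N : ℕ}
    (hφ : φ ∈ weightIdeal w (w 2)) {f : MvPowerSeries (Fin 2) ℂ}
    (hf : f ∈ weightIdeal ![w 1, w 2] N) : onGraphConj φ f ∈ weightIdeal w N :=
  subst_graphFamily_mem hφ0 hφ hf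

theorem onGraph_add_monomial (hφ : constantCoeff φ = 0) (c : ℂ) (a m : ℕ)
    (f : MvPowerSeries (Fin 2) ℂ) :
    onGraph φ (C c * (X 0 ^ a * X 1 ^ m) + f) =
      C c * (X 0 ^ a * (X 2 + C Complex.I * φ) ^ m) + onGraph φ f := by
  have hs := hasSubst_graphFamily hφ 0 Complex.I
  rw [onGraph, subst_add hs, ← smul_eq_C_mul (X 0 ^ a * X 1 ^ m) c, subst_smul hs, subst_mul hs, subst_pow hs,
    subst_pow hs, subst_X hs, subst_X hs, smul_eq_C_mul]
  rfl

theorem onGraphConj_add_monomial (hφ : constantCoeff φ = 0) (c : ℂ) (a m : ℕ)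
    (f : MvPowerSeries (Fin 2) ℂ) :
    onGraphConj φ (C c * (X 0 ^ a * X 1 ^ m) + f) =
      C c * (X 1 ^ a * (X 2 + C (-Complex.I) * φ) ^ m) + onGraphConj φ f := by
  have hs := hasSubst_graphFamily hφ 1 (-Complex.I)
  rw [onGraphConj, subst_add hs, ← smul_eq_C_mul (X 0 ^ a * X 1 ^ m) c, subst_smul hs, subst_mul hs, subst_pow hs,
    subst_pow hs, subst_X hs, subst_X hs, smul_eq_C_mul]
  rfl

theorem conjSeries_add_monomial (c : ℂ) (a m : ℕ) (f : MvPowerSeries (Fin 2) ℂ) :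
    conjSeries (C c * (X 0 ^ a * X 1 ^ m) + f) =
      C (starRingEnd ℂ c) * (X 0 ^ a * X 1 ^ m) + conjSeries f := by
  simp [conjSeries]

/-! ### The graph equation along χ = 0. -/

/-- The coefficients of `f(z, s + cφ)` and `f(χ, s + cφ)` along `χ = 0`. -/
theorem coeff_subst_graphFamily_zero (hl : ∀ a m, coeff₃ φ a 0 m = 0) (c : ℂ) (v : Fin 3)
    (hv : v = 0 ∨ v = 1) (f : MvPowerSeries (Fin 2) ℂ) (a m : ℕ) :
    coeff (tri a 0 m) (subst ![X v, X 2 + C c * φ] f) =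
      if v = 0 ∨ a = 0 then coeff (duo a m) f else 0 := by
  have hφ0 : constantCoeff φ = 0 := by
    rw [← coeff_zero_eq_constantCoeff_apply,
      show (0 : Fin 3 →₀ ℕ) = tri 0 0 0 by ext i; fin_cases i <;> rfl]
    exact hl 0 0
  -- Counting powers of χ only, φ has positive weight, so along χ = 0 the substitution reduces to w
  -- = s.
  have hφ : φ ∈ weightIdeal ![0, 1, 0] 1 := by
    intro d hd
    simp only [weight_three, Matrix.cons_val] at hd
    have h1 : d 1 = 0 := by omega
    rw [← tri_eta d, h1]
    exact hl _ _
  rw [coeff_subst (hasSubst_graphFamily hφ0 v c), finsum_eq_single _ (duo a m)]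
  all_goals
    have key : ∀ d : Fin 2 →₀ ℕ, coeff (tri a 0 m)
        (d.prod fun s e => (![X v, X 2 + C c * φ] : Fin 2 → MvPowerSeries (Fin 3) ℂ) s ^ e) =
        coeff (tri a 0 m) (X v ^ d 0 * X 2 ^ d 1) := by
      intro d
      have h1 := prod_sub_prod_mem_weightIdeal (w := ![0, 1, 0]) (v := fun _ : Fin 2 => 0) (ε := 1)
        (u := (![X v, X 2 + C c * φ] : Fin 2 → MvPowerSeries (Fin 3) ℂ)) (u' := ![X v, X 2])
        (fun _ => mem_weightIdeal_zero) (fun i => by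
          fin_cases i
          · simp
          · simpa using C_mul_mem_weightIdeal c hφ) d
      rw [coeff_eq_of_sub_mem_weightIdeal h1 (by simp [weight_three, weight_two]), prod_two]
      rfl
  · rw [key]
    rcases hv with rfl | rfl
    · have := X_pow_three (R := ℂ) a 0 m
      rw [pow_zero, mul_one] at this
      simp [this]
    · have := X_pow_three (R := ℂ) 0 a m
      rw [pow_zero, one_mul] at this
      rw [duo_zero, duo_one, this, coeff_monomial]
      by_cases h : a = 0
      · simp [h]
      · rw [if_neg (fun h' => h (tri_inj.1 h').1)]; simp [h]
  · intro d hd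
    rw [key]
    suffices h : coeff (tri a 0 m) (X v ^ d 0 * X 2 ^ d 1 : MvPowerSeries (Fin 3) ℂ) = 0 by
      rw [h, smul_zero]
    rcases hv with rfl | rfl
    · have := X_pow_three (R := ℂ) (d 0) 0 (d 1)
      rw [pow_zero, mul_one] at this
      rw [this, coeff_monomial, if_neg]
      rw [tri_inj]
      rintro ⟨rfl, -, rfl⟩
      exact hd (duo_eta d).symm
    · have := X_pow_three (R := ℂ) 0 (d 0) (d 1)
      rw [pow_zero, one_mul] at this
      rw [this, coeff_monomial, if_neg]
      rw [tri_inj]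
      rintro ⟨rfl, h0, rfl⟩
      apply hd
      rw [h0, duo_eta]

/-- The coefficients of `(G(z, s + iφ) - \bar G(χ, s - iφ)) / 2i` along `χ = 0`. -/
theorem coeff_imag_zero (hl : ∀ a m, coeff₃ φ a 0 m = 0) (G : MvPowerSeries (Fin 2) ℂ) (a m : ℕ) :
    coeff (tri a 0 m) (C (1 / (2 * Complex.I)) * (onGraph φ G - onGraphConj φ (conjSeries G))) =
      1 / (2 * Complex.I) * (coeff (duo a m) G -
        if a = 0 then starRingEnd ℂ (coeff (duo 0 m) G) else 0) := by
  rw [coeff_C_mul, map_sub, onGraph, onGraphConj, coeff_subst_graphFamily_zero hl _ _ (Or.inl rfl),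
    coeff_subst_graphFamily_zero hl _ _ (Or.inr rfl)]
  by_cases h : a = 0 <;> simp [h, coeff_conjSeries]

theorem constantCoeff_graphImage (hφ : constantCoeff φ = 0) (hF : constantCoeff F = 0)
    (hG : constantCoeff G = 0) (i : Fin 3) :
    constantCoeff ((![onGraph φ F, onGraphConj φ (conjSeries F),
      C (1 / 2) * (onGraph φ G + onGraphConj φ (conjSeries G))] :
        Fin 3 → MvPowerSeries (Fin 3) ℂ) i) = 0 := by
  fin_cases i
  · exact constantCoeff_onGraph hφ hF
  · exact constantCoeff_onGraphConj hφ (constantCoeff_conjSeries hF)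
  · simp [constantCoeff_onGraph hφ hG, constantCoeff_onGraphConj hφ (constantCoeff_conjSeries hG)]

theorem IsNormalGraph.vanishesBelow (h : IsNormalGraph φ) : VanishesBelow φ 0 0 0 where
  left := h.left
  right := h.right
  low := by
    rintro ⟨y1, y2⟩ ⟨h1, h2, h3⟩
    exfalso; apply h3
    simp only [Prod.mk.injEq]
    simp only at h1 h2
    omega
  order := by intro b hb; omega

theorem IsNormalGraph.constantCoeff (h : IsNormalGraph φ) : MvPowerSeries.constantCoeff φ = 0 :=
  h.vanishesBelow.constantCoeff

theorem IsNormalGraph.mem_weightIdeal (h : IsNormalGraph φ) {w : Fin 3 → ℕ} {N : ℕ}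
    (H : ∀ a b m, coeff₃ φ a b m ≠ 0 → 1 ≤ a → 1 ≤ b → N ≤ a * w 0 + b * w 1 + m * w 2) :
    φ ∈ weightIdeal w N := by
  intro d hd
  by_contra hc
  rw [← tri_eta d] at hc
  obtain ⟨h1, h2, -⟩ := h.vanishesBelow.support hc
  have := H (d 0) (d 1) (d 2) hc h1 h2
  rw [weight_three] at hd
  omega

namespace IsGraphMap

/-- `G(z, 0) = 0`. -/
theorem coeff_snd_zero (hφ : IsNormalGraph φ) (hψ : IsNormalGraph ψ) (hF : constantCoeff F = 0)
    (hG : constantCoeff G = 0) (h : IsGraphMap φ ψ F G) (a : ℕ) : coeff (duo a 0) G = 0 := by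
  rcases Nat.eq_zero_or_pos a with rfl | ha
  · exact coeff_duo_zero hG
  have h1 := coeff_imag_zero hφ.left G a 0
  have hY := constantCoeff_graphImage hφ.constantCoeff hF hG
  -- At χ = s = 0 the second argument F̄ vanishes and ψ is divisible by it, so the right-hand side
  -- drops out and only the coefficients of G(z, 0) remain.
  have hmem : subst ![onGraph φ F, onGraphConj φ (conjSeries F),
      C (1 / 2) * (onGraph φ G + onGraphConj φ (conjSeries G))] ψ ∈ weightIdeal ![0, 1, 1] 1 := by
    refine subst_mem_weightIdeal (v := ![0, 1, 0]) (hasSubst_of_constantCoeff_zero hY)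
      (fun i => ?_) (hψ.mem_weightIdeal fun a b m _ ha hb => ?_)
    · fin_cases i
      · exact mem_weightIdeal_zero
      · refine onGraphConj_mem hφ.constantCoeff
          (hφ.mem_weightIdeal fun a b m _ ha hb => ?_) (conjSeries_mem fun d hd => ?_)
        · simp; omega
        · replace hd : d 0 * 1 + d 1 * 1 < 1 := by rwa [weight_two] at hd
          rw [← duo_eta d, show d 0 = 0 by omega, show d 1 = 0 by omega]
          exact coeff_duo_zero hF
      · exact mem_weightIdeal_zero
    · simp; omega
  rw [h, coeff_eq_zero_of_mem_weightIdeal hmem (by simp [weight_three]), if_neg (by omega)] at h1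
  simpa using h1

/-- `G_w(0)` is real. -/
theorem conj_coeff_snd (hφ : IsNormalGraph φ) (hψ : IsNormalGraph ψ) (hF : constantCoeff F = 0)
    (hG : constantCoeff G = 0) (h : IsGraphMap φ ψ F G) :
    starRingEnd ℂ (coeff (duo 0 1) G) = coeff (duo 0 1) G := by
  have h1 := coeff_imag_zero hφ.left G 0 1
  have hY := constantCoeff_graphImage hφ.constantCoeff hF hG
  have hmφ : φ ∈ weightIdeal ![1, 1, 1] ((![1, 1, 1] : Fin 3 → ℕ) 2) :=
    hφ.mem_weightIdeal fun a b m _ ha hb => by simp; omega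
  have hone : ∀ f : MvPowerSeries (Fin 2) ℂ, constantCoeff f = 0 → f ∈ weightIdeal ![1, 1] 1 := by
    intro f hf d hd
    simp only [weight_two, Matrix.cons_val] at hd
    rw [← duo_eta d, show d 0 = 0 by omega, show d 1 = 0 by omega]
    exact coeff_duo_zero hf
  -- Each term of ψ contains both F and F̄, so the right-hand side has order at least two and does
  -- not meet the coefficient of s.
  have hmem : subst ![onGraph φ F, onGraphConj φ (conjSeries F),
      C (1 / 2) * (onGraph φ G + onGraphConj φ (conjSeries G))] ψ ∈ weightIdeal ![1, 1, 1] 2 := by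
    refine subst_mem_weightIdeal (v := ![1, 1, 1]) (hasSubst_of_constantCoeff_zero hY)
      (fun i => ?_) (hψ.mem_weightIdeal fun a b m _ ha hb => ?_)
    · fin_cases i
      · exact onGraph_mem hφ.constantCoeff hmφ (hone F hF)
      · exact onGraphConj_mem hφ.constantCoeff hmφ (hone _ (constantCoeff_conjSeries hF))
      · exact C_mul_mem_weightIdeal _ (add_mem (onGraph_mem hφ.constantCoeff hmφ (hone G hG))
          (onGraphConj_mem hφ.constantCoeff hmφ (hone _ (constantCoeff_conjSeries hG))))
    · simp; omega
  rw [h, coeff_eq_zero_of_mem_weightIdeal hmem (by simp [weight_three]), if_pos rfl] at h1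
  have h2 : coeff (duo 0 1) G - starRingEnd ℂ (coeff (duo 0 1) G) = 0 := by
    simpa using h1
  exact (sub_eq_zero.1 h2).symm

/-- If `F(0, w)` vanishes to order `r`, then `G(z, w) - \bar G(0, w)` vanishes to order `r + 1`. -/
theorem coeff_snd_of_le (hφ : IsNormalGraph φ) (hψ : IsNormalGraph ψ) (hF : constantCoeff F = 0)
    (hG : constantCoeff G = 0) (h : IsGraphMap φ ψ F G) (hψ1 : ∀ a, coeff₃ ψ a 1 0 = 0) {r : ℕ}
    (hr : 1 ≤ r) (hFr : ∀ m < r, coeff (duo 0 m) F = 0) {a m : ℕ} (hm : m ≤ r) :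
    coeff (duo a m) G = if a = 0 then starRingEnd ℂ (coeff (duo 0 m) G) else 0 := by
  have h1 := coeff_imag_zero hφ.left G a m
  have hY := constantCoeff_graphImage hφ.constantCoeff hF hG
  have hmφ : φ ∈ weightIdeal ![0, r, 1] ((![0, r, 1] : Fin 3 → ℕ) 2) :=
    hφ.mem_weightIdeal fun a b m _ ha hb => by
      have : 1 * 1 ≤ b * r := Nat.mul_le_mul hb hr
      simp; omega
  have hG1 : ∀ v : ℕ, G ∈ weightIdeal ![v, 1] 1 := by
    intro v d hd
    simp only [weight_two, Matrix.cons_val] at hd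
    rw [← duo_eta d, show d 1 = 0 by omega]
    exact h.coeff_snd_zero hφ hψ hF hG _
  -- With weights r for χ and 1 for s, the second argument has weight at least r and, as G(z, 0) =
  -- 0, the third at least 1. Terms of ψ quadratic in the second argument weigh at least 2r, and
  -- those linear in it contain the third argument by `hψ1`; all exceed r.
  have hmem : subst ![onGraph φ F, onGraphConj φ (conjSeries F),
      C (1 / 2) * (onGraph φ G + onGraphConj φ (conjSeries G))] ψ ∈
        weightIdeal ![0, r, 1] (r + 1) := by
    refine subst_mem_weightIdeal (v := ![0, r, 1]) (hasSubst_of_constantCoeff_zero hY)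
      (fun i => ?_) (hψ.mem_weightIdeal fun a b m hc ha hb => ?_)
    · fin_cases i
      · exact mem_weightIdeal_zero
      · refine onGraphConj_mem hφ.constantCoeff hmφ (conjSeries_mem fun d hd => ?_)
        simp only [weight_two, Matrix.cons_val] at hd
        rcases Nat.eq_zero_or_pos (d 0) with h0 | h0
        · rw [← duo_eta d, h0]
          exact hFr _ (by rw [h0] at hd; simpa using hd)
        · have : 1 * r ≤ d 0 * r := Nat.mul_le_mul_right _ h0
          simp at hd
          omega
      · exact C_mul_mem_weightIdeal _ (add_mem (onGraph_mem hφ.constantCoeff hmφ (hG1 _))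
          (onGraphConj_mem hφ.constantCoeff hmφ (conjSeries_mem (hG1 _))))
    · simp only [Matrix.cons_val]
      rcases Nat.eq_or_lt_of_le hb with hb' | hb'
      · have hm : m ≠ 0 := by
          rintro rfl
          exact hc (by rw [← hb']; exact hψ1 a)
        rw [← hb']; omega
      · have : 2 * r ≤ b * r := Nat.mul_le_mul_right _ hb'
        omega
  rw [h, coeff_eq_zero_of_mem_weightIdeal hmem (by simp [weight_three]; omega)] at h1
  have h2 : coeff (duo a m) G - (if a = 0 then starRingEnd ℂ (coeff (duo 0 m) G) else 0) = 0 := by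
    have h3 : (1 / (2 * Complex.I)) ≠ 0 := by simp
    exact (mul_eq_zero.1 h1.symm).resolve_left h3
  exact sub_eq_zero.1 h2

end IsGraphMap

end

/-! ### Comparing coefficients in the equation of a map between graphs -/

section

variable {φ ψ : MvPowerSeries (Fin 3) ℂ} {F G : MvPowerSeries (Fin 2) ℂ} {α n μ : ℕ}

/-- With c the coefficient of w^(j+1) in g, the arguments s + iφ and s − iφ contribute i(j + 1)c and
−i(j + 1)c̄ times φ. Dividing the difference by 2i leaves the real part of c. -/
theorem coeff_imag_of_le (hφ : VanishesBelow φ α n μ) (hα : 1 ≤ α) {j x b : ℕ} (hx1 : 1 ≤ x)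
    (hx : x ≤ α) (hb : 1 ≤ b) {g : MvPowerSeries (Fin 2) ℂ}
    (hg : ∀ a m, m ≤ j → coeff (duo a m) g = 0)
    (hside : ∀ a, 1 ≤ a → a ≤ b → coeff₃ φ α (b - a) μ * coeff (duo a (j + 1)) g = 0) :
    coeff (tri x b (μ + j)) (C (1 / (2 * Complex.I)) *
        (onGraph φ g - onGraphConj φ (conjSeries g))) =
      if x = α then (j + 1) * (coeff (duo 0 (j + 1)) g).re * coeff₃ φ α b μ else 0 := by
  have h1 := coeff_subst_graphFamily hφ hα Complex.I (j := j) (b := b) hx (v := 0) hg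
    (Or.inl ⟨rfl, hb⟩)
  have h2 := coeff_subst_graphFamily hφ hα (-Complex.I) (j := j) (b := b) hx (v := 1)
    (g := conjSeries g) (fun a m hm => by rw [coeff_conjSeries, hg a m hm, map_zero])
    (Or.inr ⟨rfl, hx1, fun a ha hab => by
      rcases mul_eq_zero.1 (hside a ha hab) with h | h
      · rw [h, zero_mul]
      · rw [coeff_conjSeries, h, map_zero, mul_zero]⟩)
  rw [coeff_C_mul, map_sub, onGraph, onGraphConj, h1, h2, coeff_conjSeries]
  split_ifs
  · have h3 : (((coeff (duo 0 (j + 1)) g).re : ℝ) : ℂ) =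
        (coeff (duo 0 (j + 1)) g + starRingEnd ℂ (coeff (duo 0 (j + 1)) g)) / 2 :=
      Complex.re_eq_add_conj _
    rw [h3]
    field_simp
    ring
  · simp

theorem pow_sub_pow_mem_weightIdeal {R σ : Type*} [CommRing R] {w : σ → ℕ} {a : ℕ}
    {f g : MvPowerSeries σ R} (hf : f ∈ weightIdeal w a) (hg : g ∈ weightIdeal w (a + 1)) (n : ℕ) :
    (f + g) ^ n - f ^ n ∈ weightIdeal w (n * a + 1) := by
  have h := prod_sub_prod_mem_weightIdeal (τ := Unit) (v := fun _ => a) (ε := 1)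
    (u := fun _ => f + g) (u' := fun _ => f) (fun _ => hf) (fun _ => by simpa using hg)
    (Finsupp.single () n)
  simpa [Finsupp.weight_single] using h

/-- The master identity: one coefficient of the equation of a map `(F, G)` between two graphs whose
linear part is `(γ z, δ w)` up to terms of large weight. -/
theorem IsGraphMap.coeff_eq (h : IsGraphMap φ ψ F G) (hφ : VanishesBelow φ α n μ)
    (hψ : VanishesBelow ψ α n μ) (hα : 1 ≤ α) (hF : constantCoeff F = 0)
    (hG : constantCoeff G = 0) {γ : ℂ} {δ : ℝ} {g : MvPowerSeries (Fin 2) ℂ}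
    (hg : G = C (δ : ℂ) * (X 0 ^ 0 * X 1 ^ 1) + g) {f : MvPowerSeries (Fin 2) ℂ}
    (hf : F = C γ * (X 0 ^ 1 * X 1 ^ 0) + f) {K p ε j x b : ℕ} (hK : 2 * n ≤ K) (hp : 1 ≤ p)
    (hf1 : f ∈ weightIdeal ![K, α * K + 1] (K + ε)) (hf2 : f ∈ weightIdeal ![2, α * K + 1] (2 + ε))
    (hg1 : g ∈ weightIdeal ![K, α * K + 1] (α * K + 1 + ε))
    (hg2 : g ∈ weightIdeal ![2, α * K + 1] (α * K + 1 + ε)) (hFp : F ∈ weightIdeal ![p, 1] p)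
    (hgj : ∀ a m, m ≤ j → coeff (duo a m) g = 0)
    (hside : ∀ a, 1 ≤ a → a ≤ b → coeff₃ φ α (b - a) μ * coeff (duo a (j + 1)) g = 0)
    (hx1 : 1 ≤ x) (hx : x ≤ α) (hb : 1 ≤ b)
    (he1 : x * K + b * 2 + (μ + j) * (α * K + 1) ≤ α * K + n * 2 + μ * (α * K + 1) + ε)
    (he2 : x * p + (μ + j) < α * p + p + μ) :
    δ * coeff₃ φ x b (μ + j) +
        (if x = α then (j + 1) * (coeff (duo 0 (j + 1)) g).re * coeff₃ φ α b μ else 0) =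
      γ ^ x * starRingEnd ℂ γ ^ b * δ ^ (μ + j) * coeff₃ ψ x b (μ + j) +
        coeff₃ ψ α n μ * coeff (tri x b (μ + j))
          ((C γ * X 0 + onGraph φ f) ^ α * (C (starRingEnd ℂ γ) * X 1 +
              onGraphConj φ (conjSeries f)) ^ n *
            (C (δ : ℂ) * X 2 + C (1 / 2) * (onGraph φ g + onGraphConj φ (conjSeries g))) ^ μ -
          (C γ * X 0) ^ α * (C (starRingEnd ℂ γ) * X 1) ^ n * (C (δ : ℂ) * X 2) ^ μ) := by
  have hφ0 := hφ.constantCoeff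
  have hY := constantCoeff_graphImage hφ0 hF hG
  have e0 : onGraph φ F = C γ * X 0 + onGraph φ f := by
    rw [hf, onGraph_add_monomial hφ0]; simp
  have e1 : onGraphConj φ (conjSeries F) =
      C (starRingEnd ℂ γ) * X 1 + onGraphConj φ (conjSeries f) := by
    rw [hf, conjSeries_add_monomial, onGraphConj_add_monomial hφ0]; simp
  have e2 : onGraph φ G = C (δ : ℂ) * (X 2 + C Complex.I * φ) + onGraph φ g := by
    rw [hg, onGraph_add_monomial hφ0]; simp
  have e3 : onGraphConj φ (conjSeries G) =
      C (δ : ℂ) * (X 2 + C (-Complex.I) * φ) + onGraphConj φ (conjSeries g) := by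
    rw [hg, conjSeries_add_monomial, onGraphConj_add_monomial hφ0]; simp
  have hC : (C (1 / 2) * (C 2 * (C (δ : ℂ) * X 2)) : MvPowerSeries (Fin 3) ℂ) =
      C (δ : ℂ) * X 2 := by
    rw [← mul_assoc, ← map_mul]; norm_num
  -- On the graph w + w̄ = 2s and w − w̄ = 2iφ. The linear term δw of G thus contributes δs to the
  -- third argument and δφ to the left-hand side.
  have e4 : C (1 / 2) * (onGraph φ G + onGraphConj φ (conjSeries G)) =
      C (δ : ℂ) * X 2 + C (1 / 2) * (onGraph φ g + onGraphConj φ (conjSeries g)) := by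
    rw [e2, e3, ← hC, map_neg, map_ofNat]; ring
  have hCI : (C (1 / (2 * Complex.I)) * (C (2 * Complex.I) * (C (δ : ℂ) * φ)) :
      MvPowerSeries (Fin 3) ℂ) = C (δ : ℂ) * φ := by
    rw [← mul_assoc, ← map_mul, one_div_mul_cancel (by simp), map_one, one_mul]
  have e5 : C (1 / (2 * Complex.I)) * (onGraph φ G - onGraphConj φ (conjSeries G)) =
      C (δ : ℂ) * φ +
        C (1 / (2 * Complex.I)) * (onGraph φ g - onGraphConj φ (conjSeries g)) := by
    rw [e2, e3, ← hCI, map_neg, map_mul (C (σ := Fin 3) (R := ℂ)) 2, map_ofNat]; ring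
  have hw : φ ∈ weightIdeal ![K, 2, α * K + 1] (α * K + 1) :=
    weightIdeal_anti (Nat.le_succ _) hφ.mem_weightIdeal_main
  have hG1 : ∀ v : ℕ, G ∈ weightIdeal ![v, 1] 1 := by
    intro v d hd
    simp only [weight_two, Matrix.cons_val] at hd
    rw [hg, X_pow_two, map_add, coeff_C_mul, coeff_monomial, if_neg, mul_zero, zero_add,
      ← duo_eta d]
    · exact hgj _ _ (by omega)
    · rw [← duo_eta d, duo_inj]; omega
  have hφp := hφ.mem_weightIdeal_first hp
  have key := coeff_subst_perturb (x := x) (b := b) (y := μ + j) (ε := ε) hψ hK hp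
    (u := ![γ, starRingEnd ℂ γ, (δ : ℂ)]) hY ?_ ?_ ?_ ?_ ?_ he1 he2
  · have hE := congrArg (coeff (tri x b (μ + j))) h
    rw [e5, map_add, coeff_C_mul, coeff_imag_of_le hφ hα hx1 hx hb hgj hside, key] at hE
    simp only [Matrix.cons_val, smul_eq_C_mul, e0, e1, e4] at hE
    exact hE
  · simp only [Matrix.cons_val, smul_eq_C_mul, e0, add_sub_cancel_left]
    exact onGraph_mem hφ0 hw hf1
  · simp only [Matrix.cons_val, smul_eq_C_mul, e1, add_sub_cancel_left]
    exact onGraphConj_mem hφ0 hw (conjSeries_mem hf2)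
  · simp only [Matrix.cons_val, smul_eq_C_mul, e4, add_sub_cancel_left]
    exact C_mul_mem_weightIdeal _ (add_mem (onGraph_mem hφ0 hw hg1)
      (onGraphConj_mem hφ0 hw (conjSeries_mem hg2)))
  · simp only [Matrix.cons_val]
    exact onGraph_mem hφ0 hφp hFp
  · simp only [Matrix.cons_val]
    exact C_mul_mem_weightIdeal _ (add_mem (onGraph_mem hφ0 hφp (hG1 _))
      (onGraphConj_mem hφ0 hφp (conjSeries_mem (hG1 _))))

theorem mem_weightIdeal_two {f : MvPowerSeries (Fin 2) ℂ} {a b N : ℕ}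
    (H : ∀ i m, coeff (duo i m) f ≠ 0 → N ≤ i * a + m * b) : f ∈ weightIdeal ![a, b] N := by
  intro d hd
  by_contra hc
  rw [← duo_eta d] at hc
  have := H _ _ hc
  simp only [weight_two, Matrix.cons_val] at hd
  omega

theorem coeff_sub_monomial_two (F : MvPowerSeries (Fin 2) ℂ) (c : ℂ) (a m i k : ℕ) :
    coeff (duo i k) (F - C c * (X 0 ^ a * X 1 ^ m)) =
      coeff (duo i k) F - if i = a ∧ k = m then c else 0 := by
  rw [map_sub, coeff_C_mul, X_pow_two, coeff_monomial]
  by_cases h : i = a ∧ k = m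
  · rw [if_pos h, if_pos (duo_inj.2 h), mul_one]
  · rw [if_neg h, if_neg (fun h' => h (duo_inj.1 h')), mul_zero]

/-- The lowest coefficients of two graphs which are related by a map with linear part
`(γ z + b w, δ w)`. -/
theorem IsGraphMap.coeff_lowest (h : IsGraphMap φ ψ F G) (hφ : VanishesBelow φ α n μ)
    (hψ : VanishesBelow ψ α n μ) (hα : 1 ≤ α) (hn : 1 ≤ n) (hF : constantCoeff F = 0)
    (hG : constantCoeff G = 0) (hGz : ∀ a, coeff (duo a 0) G = 0) {γ : ℂ} {δ : ℝ}
    (hγ : coeff (duo 1 0) F = γ) (hδ : coeff (duo 0 1) G = δ) :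
    δ * coeff₃ φ α n μ = γ ^ α * starRingEnd ℂ γ ^ n * δ ^ μ * coeff₃ ψ α n μ := by
  set f := F - C γ * (X 0 ^ 1 * X 1 ^ 0) with hf
  set g := G - C (δ : ℂ) * (X 0 ^ 0 * X 1 ^ 1) with hg
  -- In these weights w is heavier than z and χ, so a term b w in F counts as a perturbation and ε =
  -- 1 suffices.
  set K := 2 * n with hK
  set L := α * K + 1 with hL
  have hKL : K + 1 ≤ L := by
    have := Nat.mul_le_mul_right K hα
    omega
  have hfs : ∀ i m, coeff (duo i m) f ≠ 0 → 2 ≤ i ∨ 1 ≤ m := by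
    intro i m hc
    by_contra hcon
    apply hc
    obtain rfl : m = 0 := by omega
    rw [hf, coeff_sub_monomial_two]
    obtain rfl | rfl : i = 0 ∨ i = 1 := by omega
    · simp [coeff_duo_zero hF]
    · simp [hγ]
  have hgs : ∀ i m, coeff (duo i m) g ≠ 0 → 1 ≤ m ∧ (1 ≤ i ∨ 2 ≤ m) := by
    intro i m hc
    by_contra hcon
    apply hc
    rw [hg, coeff_sub_monomial_two]
    obtain rfl | ⟨rfl, rfl⟩ : m = 0 ∨ (i = 0 ∧ m = 1) := by omega
    · simp [hGz]
    · simp [hδ]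
  have hf1 : f ∈ weightIdeal ![K, L] (K + 1) := mem_weightIdeal_two fun i m hc => by
    rcases hfs i m hc with h | h
    · have := Nat.mul_le_mul_right K h; omega
    · have := Nat.mul_le_mul_right L h; omega
  have hf2 : f ∈ weightIdeal ![2, L] (2 + 1) := mem_weightIdeal_two fun i m hc => by
    rcases hfs i m hc with h | h
    · omega
    · have := Nat.mul_le_mul_right L h; omega
  have hgv : ∀ v, 1 ≤ v → g ∈ weightIdeal ![v, L] (L + 1) := fun v hv =>
    mem_weightIdeal_two fun i m hc => by
      obtain ⟨h1, h | h⟩ := hgs i m hc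
      · have := Nat.mul_le_mul h hv
        have := Nat.mul_le_mul_right L h1; omega
      · have := Nat.mul_le_mul_right L h; omega
  have hFp : F ∈ weightIdeal ![1, 1] 1 := mem_weightIdeal_two fun i m hc => by
    by_contra hcon
    obtain ⟨rfl, rfl⟩ : i = 0 ∧ m = 0 := by omega
    exact hc (coeff_duo_zero hF)
  have key := h.coeff_eq hφ hψ hα hF hG (γ := γ) (δ := δ) (g := g) (by rw [hg]; ring)
    (f := f) (by rw [hf]; ring) (K := K) (p := 1) (ε := 1) (j := 0) (x := α) (b := n) le_rfl le_rfl
    hf1 hf2 (hgv K (by omega)) (hgv 2 (by omega)) hFp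
    (fun a m hm => by
      by_contra hc
      have := hgs a m hc; omega)
    (fun a ha hab => by rw [hφ.order _ (by omega), zero_mul]) hα le_rfl hn
    (by rw [add_zero]; omega) (by omega)
  have hzero : coeff (duo 0 (0 + 1)) g = 0 := by
    by_contra hc
    have := hgs _ _ hc; omega
  have hw : φ ∈ weightIdeal ![K, 2, L] ((![K, 2, L] : Fin 3 → ℕ) 2) :=
    weightIdeal_anti (Nat.le_succ _) hφ.mem_weightIdeal_main
  have hD := prod_sub_prod_mem_weightIdeal (w := ![K, 2, L]) (v := ![K, 2, L]) (ε := 1)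
    (u := ![C γ * X 0 + onGraph φ f, C (starRingEnd ℂ γ) * X 1 + onGraphConj φ (conjSeries f),
      C (δ : ℂ) * X 2 + C (1 / 2) * (onGraph φ g + onGraphConj φ (conjSeries g))])
    (u' := ![C γ * X 0, C (starRingEnd ℂ γ) * X 1, C (δ : ℂ) * X 2])
    (by
      rw [Fin.forall_fin_succ, Fin.forall_fin_succ, Fin.forall_fin_succ]
      refine ⟨C_mul_mem_weightIdeal _ (X_mem_weightIdeal 0),
        C_mul_mem_weightIdeal _ (X_mem_weightIdeal 1),
        C_mul_mem_weightIdeal _ (X_mem_weightIdeal 2), fun i => i.elim0⟩)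
    (by
      rw [Fin.forall_fin_succ, Fin.forall_fin_succ, Fin.forall_fin_succ]
      refine ⟨?_, ?_, ?_, fun i => i.elim0⟩
      · change C γ * X 0 + onGraph φ f - C γ * X 0 ∈ _
        rw [add_sub_cancel_left]
        exact onGraph_mem hφ.constantCoeff hw hf1
      · change C (starRingEnd ℂ γ) * X 1 + onGraphConj φ (conjSeries f) -
          C (starRingEnd ℂ γ) * X 1 ∈ _
        rw [add_sub_cancel_left]
        exact onGraphConj_mem hφ.constantCoeff hw (conjSeries_mem hf2)
      · change C (δ : ℂ) * X 2 + C (1 / 2) * (onGraph φ g + onGraphConj φ (conjSeries g)) -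
          C (δ : ℂ) * X 2 ∈ _
        rw [add_sub_cancel_left]
        exact C_mul_mem_weightIdeal _ (add_mem (onGraph_mem hφ.constantCoeff hw (hgv K (by omega)))
          (onGraphConj_mem hφ.constantCoeff hw (conjSeries_mem (hgv 2 (by omega))))))
    (tri α n μ)
  rw [prod_three, prod_three] at hD
  have hz := coeff_eq_zero_of_mem_weightIdeal hD (d := tri α n μ) (by omega)
  simp only [Matrix.cons_val, tri_zero, tri_one, tri_two] at hz
  rw [hzero, add_zero, hz] at key
  simpa using key

end

/-! ### Maps tangent to the identity -/

section

variable {φ : MvPowerSeries (Fin 3) ℂ} {F G : MvPowerSeries (Fin 2) ℂ} {α n μ : ℕ}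

/-- The differences p i − y i are of higher weight, so up to the weight considered the product may
be replaced by its differential at (z, χ, s) in the direction y. -/
theorem coeff_linear_part {K L ε : ℕ} (hε : 1 ≤ ε) {p y : Fin 3 → MvPowerSeries (Fin 3) ℂ}
    (hy : ∀ i, y i ∈ weightIdeal ![K, 2, L] ((![K, 2, L] : Fin 3 → ℕ) i + ε))
    (hr : ∀ i, p i - y i ∈ weightIdeal ![K, 2, L] ((![K, 2, L] : Fin 3 → ℕ) i + ε + 1))
    {e : Fin 3 →₀ ℕ} (he : Finsupp.weight ![K, 2, L] e < α * K + n * 2 + μ * L + ε + 1) :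
    coeff e ((X 0 + p 0) ^ α * (X 1 + p 1) ^ n * (X 2 + p 2) ^ μ -
        X 0 ^ α * X 1 ^ n * X 2 ^ μ : MvPowerSeries (Fin 3) ℂ) =
      α * coeff e (X 0 ^ (α - 1) * y 0 * X 1 ^ n * X 2 ^ μ : MvPowerSeries (Fin 3) ℂ) +
        n * coeff e (X 0 ^ α * (X 1 ^ (n - 1) * y 1) * X 2 ^ μ : MvPowerSeries (Fin 3) ℂ) +
        μ * coeff e (X 0 ^ α * X 1 ^ n * (X 2 ^ (μ - 1) * y 2) : MvPowerSeries (Fin 3) ℂ) := by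
  have h := mul_pow_sub_mem_weightIdeal hε (w := ![K, 2, L])
    (x := (X : Fin 3 → MvPowerSeries (Fin 3) ℂ)) (y := y) (r := fun i => p i - y i)
    (a := ![K, 2, L]) (fun i => X_mem_weightIdeal i) hy hr α n μ
  simp only [add_sub_cancel] at h
  rw [coeff_eq_of_sub_mem_weightIdeal h he, map_add, map_add]
  simp only [← map_natCast (C (σ := Fin 3) (R := ℂ)), coeff_C_mul]

/-- `F = z + O(w^j)` and `G = w + O(w^(j+1))`. -/
def AgreesWithId (F G : MvPowerSeries (Fin 2) ℂ) (j : ℕ) : Prop :=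
  (∀ a m, m < j → coeff (duo a m) (F - C 1 * (X 0 ^ 1 * X 1 ^ 0)) = 0) ∧
    ∀ a m, m ≤ j → coeff (duo a m) (G - C ((1 : ℝ) : ℂ) * (X 0 ^ 0 * X 1 ^ 1)) = 0

theorem X_zero_sub_mem {K L c : ℕ} {f : MvPowerSeries (Fin 2) ℂ}
    (h : ∀ i m, coeff (duo i m) (f - C 1 * (X 0 ^ 1 * X 1 ^ 0)) ≠ 0 → c ≤ i * K + m * L)
    (hK : c ≤ K) : f ∈ weightIdeal ![K, L] c := by
  have h1 : f - C 1 * (X 0 ^ 1 * X 1 ^ 0) ∈ weightIdeal ![K, L] c := mem_weightIdeal_two h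
  have h2 := add_mem h1 (Ideal.mul_mem_left _ (C 1 * X 1 ^ 0 : MvPowerSeries (Fin 2) ℂ)
    (weightIdeal_anti hK (X_mem_weightIdeal (R := ℂ) (w := ![K, L]) 0)))
  convert h2 using 1
  ring

/-- Replacing s + iφ by s in the leading monomial costs at least one unit of weight, because φ is
strictly heavier than s. -/
theorem onGraph_sub_mem (hφ : VanishesBelow φ α n μ) {K N : ℕ} {f : MvPowerSeries (Fin 2) ℂ}
    {c : ℂ} {a m : ℕ}
    (hf : f - C c * (X 0 ^ a * X 1 ^ m) ∈ weightIdeal ![K, α * K + 1] N)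
    (hN : c ≠ 0 → N ≤ a * K + m * (α * K + 1) + 1) :
    onGraph φ f - C c * (X 0 ^ a * X 2 ^ m) ∈ weightIdeal ![K, 2, α * K + 1] N := by
  have h0 := hφ.constantCoeff
  have e : onGraph φ f - C c * (X 0 ^ a * X 2 ^ m) =
      C c * (X 0 ^ a * ((X 2 + C Complex.I * φ) ^ m - X 2 ^ m)) +
        onGraph φ (f - C c * (X 0 ^ a * X 1 ^ m)) := by
    conv_lhs => rw [← add_sub_cancel (C c * (X 0 ^ a * X 1 ^ m)) f, onGraph_add_monomial h0]
    ring
  rw [e]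
  refine add_mem ?_ (onGraph_mem h0 (weightIdeal_anti (Nat.le_succ _) hφ.mem_weightIdeal_main) hf)
  by_cases hc : c = 0
  · simp [hc]
  · have hpow : (X 2 + C Complex.I * φ) ^ m - X 2 ^ m ∈
        weightIdeal ![K, 2, α * K + 1] (m * (α * K + 1) + 1) :=
      pow_sub_pow_mem_weightIdeal (X_mem_weightIdeal 2)
        (C_mul_mem_weightIdeal _ hφ.mem_weightIdeal_main) m
    have hX : (X 0 ^ a : MvPowerSeries (Fin 3) ℂ) ∈ weightIdeal ![K, 2, α * K + 1] (a * K) :=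
      pow_mem_weightIdeal (X_mem_weightIdeal 0) a
    have hprod := mul_mem_weightIdeal hX hpow
    exact C_mul_mem_weightIdeal _ (weightIdeal_anti (by have := hN hc; omega) hprod)

theorem onGraphConj_sub_mem (hφ : VanishesBelow φ α n μ) {K N : ℕ} {f : MvPowerSeries (Fin 2) ℂ}
    {c : ℂ} {a m : ℕ}
    (hf : f - C c * (X 0 ^ a * X 1 ^ m) ∈ weightIdeal ![2, α * K + 1] N)
    (hN : c ≠ 0 → N ≤ a * 2 + m * (α * K + 1) + 1) :
    onGraphConj φ (conjSeries f) - C (starRingEnd ℂ c) * (X 1 ^ a * X 2 ^ m) ∈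
      weightIdeal ![K, 2, α * K + 1] N := by
  have h0 := hφ.constantCoeff
  have e : onGraphConj φ (conjSeries f) - C (starRingEnd ℂ c) * (X 1 ^ a * X 2 ^ m) =
      C (starRingEnd ℂ c) * (X 1 ^ a * ((X 2 + C (-Complex.I) * φ) ^ m - X 2 ^ m)) +
        onGraphConj φ (conjSeries (f - C c * (X 0 ^ a * X 1 ^ m))) := by
    conv_lhs => rw [← add_sub_cancel (C c * (X 0 ^ a * X 1 ^ m)) f, conjSeries_add_monomial,
      onGraphConj_add_monomial h0]
    ring
  rw [e]
  refine add_mem ?_ (onGraphConj_mem h0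
    (weightIdeal_anti (Nat.le_succ _) hφ.mem_weightIdeal_main) (conjSeries_mem hf))
  by_cases hc : c = 0
  · simp [hc]
  · have hpow : (X 2 + C (-Complex.I) * φ) ^ m - X 2 ^ m ∈
        weightIdeal ![K, 2, α * K + 1] (m * (α * K + 1) + 1) :=
      pow_sub_pow_mem_weightIdeal (X_mem_weightIdeal 2)
        (C_mul_mem_weightIdeal _ hφ.mem_weightIdeal_main) m
    have hX : (X 1 ^ a : MvPowerSeries (Fin 3) ℂ) ∈ weightIdeal ![K, 2, α * K + 1] (a * 2) :=
      pow_mem_weightIdeal (X_mem_weightIdeal 1) a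
    have hprod := mul_mem_weightIdeal hX hpow
    exact C_mul_mem_weightIdeal _ (weightIdeal_anti (by have := hN hc; omega) hprod)

namespace IsGraphMap

/-- A map tangent to the identity to order `j` has no term `w^j` in its first component. -/
theorem coeff_fst_pure (h : IsGraphMap φ φ F G) (hφ : VanishesBelow φ α n μ) (hα : 2 ≤ α)
    (hn : 1 ≤ n) (hc : coeff₃ φ α n μ ≠ 0) (hF : constantCoeff F = 0) (hG : constantCoeff G = 0)
    {j : ℕ} (hj : 1 ≤ j) (hid : AgreesWithId F G j) : coeff (duo 0 j) F = 0 := by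
  obtain ⟨hid1, hid2⟩ := hid
  set f := F - C 1 * (X 0 ^ 1 * X 1 ^ 0) with hf
  set g := G - C ((1 : ℝ) : ℂ) * (X 0 ^ 0 * X 1 ^ 1) with hg
  set K := 2 * n + 1 with hK
  set L := α * K + 1 with hL
  have hKL : 2 * K + 1 ≤ L := by
    have := Nat.mul_le_mul_right K hα
    omega
  have hjL : L ≤ j * L := Nat.le_mul_of_pos_left _ hj
  -- A term w^j in F weighs jL in place of the weight K of z; ε is this gain.
  obtain ⟨ε, hε⟩ : ∃ ε, j * L = K + ε := ⟨j * L - K, by omega⟩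
  have hmL : ∀ {m k : ℕ}, k ≤ m → k * L ≤ m * L := fun h => Nat.mul_le_mul_right L h
  have hf1 : f ∈ weightIdeal ![K, L] (K + ε) := mem_weightIdeal_two fun i m hc => by
    by_contra hcon
    refine hc (hid1 i m ?_)
    by_contra hm
    have := hmL (not_lt.1 hm); omega
  have hf2 : f ∈ weightIdeal ![2, L] (2 + ε) := mem_weightIdeal_two fun i m hc => by
    by_contra hcon
    refine hc (hid1 i m ?_)
    by_contra hm
    have := hmL (not_lt.1 hm); omega
  have hgv : ∀ v, g ∈ weightIdeal ![v, L] (L + ε + 1) := fun v =>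
    mem_weightIdeal_two fun i m hc => by
      by_contra hcon
      refine hc (hid2 i m ?_)
      by_contra hm
      have := hmL (Nat.succ_le_of_lt (not_le.1 hm))
      rw [Nat.succ_mul] at this; omega
  have hFp : F ∈ weightIdeal ![j, 1] j := X_zero_sub_mem (fun i m hc => by
      by_contra hcon
      refine hc (hid1 i m ?_)
      omega) le_rfl
  -- Replacing one factor z of z^α χ^n s^μ by w^j produces z^(α−1) χ^n s^(μ+j). This exponent must
  -- still contain z, whence α ≥ 2; since it contains fewer than α factors z, the second component
  -- contributes nothing on the left.
  have key := h.coeff_eq hφ hφ (by omega) hF hG (γ := 1) (δ := 1) (g := g) (by rw [hg]; ring)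
    (f := f) (by rw [hf]; ring) (K := K) (p := j) (ε := ε) (j := j) (x := α - 1) (b := n)
    (by omega) hj hf1 hf2 (weightIdeal_anti (Nat.le_succ _) (hgv K))
    (weightIdeal_anti (Nat.le_succ _) (hgv 2)) hFp hid2
    (fun a ha hab => by rw [hφ.order _ (by omega), zero_mul]) (by omega) (by omega) hn
    (by
      obtain ⟨α', rfl⟩ : ∃ α', α = α' + 1 := ⟨α - 1, by omega⟩
      rw [← hL, Nat.add_sub_cancel, add_mul μ, hε, Nat.succ_mul]; omega)
    (by
      obtain ⟨α', rfl⟩ : ∃ α', α = α' + 1 := ⟨α - 1, by omega⟩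
      rw [Nat.add_sub_cancel, Nat.succ_mul]; omega)
  rw [if_neg (by omega)] at key
  have hF0 : coeff (duo 0 j) F = coeff (duo 0 j) f := by
    rw [hf, coeff_sub_monomial_two]; simp
  set c := coeff (duo 0 j) f with hcdef
  have hfc : f - C c * (X 0 ^ 0 * X 1 ^ j) ∈ weightIdeal ![K, L] (K + ε + 1) :=
    mem_weightIdeal_two fun i m hc => by
      rw [coeff_sub_monomial_two] at hc
      by_contra hcon
      have hm : m ≤ j := by
        by_contra hm
        have := hmL (Nat.succ_le_of_lt (not_le.1 hm))
        rw [Nat.succ_mul] at this; omega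
      rcases Nat.eq_or_lt_of_le hm with rfl | hm
      · have hi : i = 0 := by
          by_contra hi
          have := Nat.mul_le_mul_right K (Nat.one_le_iff_ne_zero.2 hi)
          omega
        subst hi
        simp [hcdef] at hc
      · rw [if_neg (by omega), sub_zero] at hc
        exact hc (hid1 _ _ hm)
  have hy0 : C c * (X 0 ^ 0 * X 2 ^ j) ∈ weightIdeal (R := ℂ) ![K, 2, L] (K + ε) := by
    refine C_mul_mem_weightIdeal _ (Ideal.mul_mem_left _ _ ?_)
    exact weightIdeal_anti (le_of_eq hε.symm) (pow_mem_weightIdeal (X_mem_weightIdeal 2) j)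
  have hw : φ ∈ weightIdeal ![K, 2, L] ((![K, 2, L] : Fin 3 → ℕ) 2) :=
    weightIdeal_anti (Nat.le_succ _) hφ.mem_weightIdeal_main
  have hlin := coeff_linear_part (α := α) (n := n) (μ := μ) (K := K) (L := L) (ε := ε) (by omega)
    (p := ![onGraph φ f, onGraphConj φ (conjSeries f),
      C (1 / 2) * (onGraph φ g + onGraphConj φ (conjSeries g))])
    (y := ![C c * (X 0 ^ 0 * X 2 ^ j), 0, 0])
    (by
      rw [Fin.forall_fin_succ, Fin.forall_fin_succ, Fin.forall_fin_succ]
      exact ⟨hy0, zero_mem _, zero_mem _, fun i => i.elim0⟩)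
    (by
      rw [Fin.forall_fin_succ, Fin.forall_fin_succ, Fin.forall_fin_succ]
      refine ⟨onGraph_sub_mem hφ hfc (fun _ => ?_), ?_, ?_, fun i => i.elim0⟩
      · change K + ε + 1 ≤ 0 * K + j * (α * K + 1) + 1
        rw [← hL]; omega
      · change onGraphConj φ (conjSeries f) - 0 ∈ _
        rw [sub_zero]
        refine onGraphConj_mem hφ.constantCoeff hw (conjSeries_mem ?_)
        exact mem_weightIdeal_two fun i m hc => by
          by_contra hcon
          refine hc (hid1 i m ?_)
          by_contra hm
          have := hmL (not_lt.1 hm)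
          have h2 : (![K, 2, L] : Fin 3 → ℕ) (Fin.succ 0) = 2 := rfl
          have h3 : (![K, 2, L] : Fin 3 → ℕ) 2 = L := rfl
          rw [h2, h3] at hcon
          omega
      · change C (1 / 2) * (onGraph φ g + onGraphConj φ (conjSeries g)) - 0 ∈ _
        rw [sub_zero]
        exact C_mul_mem_weightIdeal _ (add_mem (onGraph_mem hφ.constantCoeff hw (hgv K))
          (onGraphConj_mem hφ.constantCoeff hw (conjSeries_mem (hgv 2)))))
    (e := tri (α - 1) n (μ + j)) (by
      obtain ⟨α', rfl⟩ : ∃ α', α = α' + 1 := ⟨α - 1, by omega⟩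
      rw [weight_three]
      simp only [Matrix.cons_val, tri_zero, tri_one, tri_two]
      rw [Nat.add_sub_cancel, add_mul μ, hε, Nat.succ_mul]; omega)
  have hmon : coeff (tri (α - 1) n (μ + j)) (X 0 ^ (α - 1) * (C c * (X 0 ^ 0 * X 2 ^ j)) * X 1 ^ n *
      X 2 ^ μ : MvPowerSeries (Fin 3) ℂ) = c := by
    have : (X 0 ^ (α - 1) * (C c * (X 0 ^ 0 * X 2 ^ j)) * X 1 ^ n * X 2 ^ μ :
        MvPowerSeries (Fin 3) ℂ) = C c * (X 0 ^ (α - 1) * X 1 ^ n * X 2 ^ (μ + j)) := by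
      rw [pow_add]; ring
    rw [this, X_pow_three, coeff_C_mul, coeff_monomial_same, mul_one]
  simp only [Matrix.cons_val, hmon, mul_zero, zero_mul, map_zero, add_zero] at hlin
  simp only [map_one, one_mul, Complex.ofReal_one, one_pow] at key
  rw [hlin] at key
  have h2 : coeff₃ φ α n μ * (α * c) = 0 := by linear_combination -key
  rw [hF0]
  have hα0 : (α : ℂ) ≠ 0 := by exact_mod_cast (by omega : α ≠ 0)
  simpa [hc, hα0] using h2

/-- The first-order condition at level `j`, at the coefficient `z^α χ^(n+q) s^(μ+j)`. -/
theorem coeff_resonance (h : IsGraphMap φ φ F G) (hφ : VanishesBelow φ α n μ) (hα : 1 ≤ α)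
    (hn : 1 ≤ n) (hF : constantCoeff F = 0) (hG : constantCoeff G = 0) {j q K ε : ℕ}
    (hK : 2 * n ≤ K) {f g : MvPowerSeries (Fin 2) ℂ} (hf : f = F - C 1 * (X 0 ^ 1 * X 1 ^ 0))
    (hg : g = G - C ((1 : ℝ) : ℂ) * (X 0 ^ 0 * X 1 ^ 1)) {x0 x1 : ℂ} {x2 : ℝ}
    (hε : ε = j * (α * K + 1) + 2 * q) (hε1 : 1 ≤ ε)
    (hf1 : f - C x0 * (X 0 ^ 1 * X 1 ^ j) ∈ weightIdeal ![K, α * K + 1] (K + ε + 1))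
    (hf2 : f - C x1 * (X 0 ^ (q + 1) * X 1 ^ j) ∈ weightIdeal ![2, α * K + 1] (2 + ε + 1))
    (hg1 : g - C (x2 : ℂ) * (X 0 ^ 0 * X 1 ^ (j + 1)) ∈
      weightIdeal ![K, α * K + 1] (α * K + 1 + ε + 1))
    (hg2 : g - C (x2 : ℂ) * (X 0 ^ 0 * X 1 ^ (j + 1)) ∈
      weightIdeal ![2, α * K + 1] (α * K + 1 + ε + 1))
    (hx : (x0 = 0 ∧ x2 = 0) ∨ q = 0) (hFp : F ∈ weightIdeal ![j + 1, 1] (j + 1))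
    (hgj : ∀ a m, m ≤ j → coeff (duo a m) g = 0)
    (hside : ∀ a, 1 ≤ a → a ≤ n + q → coeff₃ φ α (n + q - a) μ * coeff (duo a (j + 1)) g = 0) :
    (j + 1) * x2 * coeff₃ φ α n μ =
      coeff₃ φ α n μ * (α * x0 + n * starRingEnd ℂ x1 + μ * x2) := by
  have hφ0 := hφ.constantCoeff
  -- ε is the gain of χ^(q+1) s^j over χ. For q = 0 it is also the gain of z s^j over z and of
  -- s^(j+1) over s, so all three arguments contribute; for q ≥ 1 the alternative `hx` leaves only
  -- the conjugate one.
  set L := α * K + 1 with hL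
  have hw : φ ∈ weightIdeal ![K, 2, L] ((![K, 2, L] : Fin 3 → ℕ) 2) :=
    weightIdeal_anti (Nat.le_succ _) hφ.mem_weightIdeal_main
  have hf0 : C x0 * (X 0 ^ 1 * X 1 ^ j) ∈ weightIdeal (R := ℂ) ![K, L] (K + ε) := by
    rcases hx with ⟨rfl, -⟩ | rfl
    · simp
    · refine C_mul_mem_weightIdeal _ (weightIdeal_anti ?_ (mul_mem_weightIdeal
        (pow_mem_weightIdeal (X_mem_weightIdeal 0) 1) (pow_mem_weightIdeal (X_mem_weightIdeal 1) j)))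
      simp [hε]
  have hf1' : C x1 * (X 0 ^ (q + 1) * X 1 ^ j) ∈ weightIdeal (R := ℂ) ![2, L] (2 + ε) := by
    refine C_mul_mem_weightIdeal _ (weightIdeal_anti ?_ (mul_mem_weightIdeal
      (pow_mem_weightIdeal (X_mem_weightIdeal 0) (q + 1))
      (pow_mem_weightIdeal (X_mem_weightIdeal 1) j)))
    simp only [Matrix.cons_val, hε]
    omega
  have hg0 : ∀ v, C (x2 : ℂ) * (X 0 ^ 0 * X 1 ^ (j + 1)) ∈ weightIdeal (R := ℂ) ![v, L] (L + ε) := by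
    intro v
    rcases hx with ⟨-, rfl⟩ | rfl
    · simp
    · refine C_mul_mem_weightIdeal _ (Ideal.mul_mem_left _ _ (weightIdeal_anti ?_
        (pow_mem_weightIdeal (X_mem_weightIdeal 1) (j + 1))))
      simp only [Matrix.cons_val, hε, add_mul]
      omega
  have hadd : ∀ {w : Fin 2 → ℕ} {N : ℕ} {a b : MvPowerSeries (Fin 2) ℂ},
      a - b ∈ weightIdeal w (N + 1) → b ∈ weightIdeal w N → a ∈ weightIdeal w N := by
    intro w N a b h1 h2
    have := add_mem (weightIdeal_anti (Nat.le_succ _) h1) h2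
    rwa [sub_add_cancel] at this
  have hgx : coeff (duo 0 (j + 1)) g = x2 := by
    have := coeff_eq_of_sub_mem_weightIdeal hg1 (d := duo 0 (j + 1)) (by
      simp only [weight_two, Matrix.cons_val, duo_zero, duo_one, add_mul]; omega)
    rw [this, X_pow_two, coeff_C_mul, coeff_monomial_same, mul_one]
  -- Here the exponent contains z^α, so the second weight bound reads j < p. This is why p = j + 1
  -- is used and why F must already be free of w^j.
  have key := h.coeff_eq hφ hφ hα hF hG (γ := 1) (δ := 1) (g := g) (by rw [hg]; ring)
    (f := f) (by rw [hf]; ring) (K := K) (p := j + 1) (ε := ε) (j := j) (x := α) (b := n + q)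
    hK (by omega) (hadd hf1 hf0) (hadd hf2 hf1') (hadd hg1 (hg0 K)) (hadd hg2 (hg0 2)) hFp hgj hside
    hα le_rfl (by omega)
    (by rw [← hL, add_mul μ, hε]; omega) (by omega)
  rw [if_pos rfl, hgx] at key
  have hy0 : C x0 * (X 0 ^ 1 * X 2 ^ j) ∈ weightIdeal (R := ℂ) ![K, 2, L] (K + ε) := by
    rcases hx with ⟨rfl, -⟩ | rfl
    · simp
    · refine C_mul_mem_weightIdeal _ (weightIdeal_anti ?_ (mul_mem_weightIdeal
        (pow_mem_weightIdeal (X_mem_weightIdeal 0) 1) (pow_mem_weightIdeal (X_mem_weightIdeal 2) j)))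
      simp [hε]
  have hy1 : C (starRingEnd ℂ x1) * (X 1 ^ (q + 1) * X 2 ^ j) ∈
      weightIdeal (R := ℂ) ![K, 2, L] (2 + ε) := by
    refine C_mul_mem_weightIdeal _ (weightIdeal_anti ?_ (mul_mem_weightIdeal
      (pow_mem_weightIdeal (X_mem_weightIdeal 1) (q + 1))
      (pow_mem_weightIdeal (X_mem_weightIdeal 2) j)))
    simp only [Matrix.cons_val, hε]
    omega
  have hy2 : C (x2 : ℂ) * X 2 ^ (j + 1) ∈ weightIdeal (R := ℂ) ![K, 2, L] (L + ε) := by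
    rcases hx with ⟨-, rfl⟩ | rfl
    · simp
    · refine C_mul_mem_weightIdeal _ (weightIdeal_anti ?_
        (pow_mem_weightIdeal (X_mem_weightIdeal 2) (j + 1)))
      simp only [Matrix.cons_val, hε, add_mul]
      omega
  have hsum : C (1 / 2) * (onGraph φ g + onGraphConj φ (conjSeries g)) - C (x2 : ℂ) * X 2 ^ (j + 1) =
      C (1 / 2) * ((onGraph φ g - C (x2 : ℂ) * (X 0 ^ 0 * X 2 ^ (j + 1))) +
        (onGraphConj φ (conjSeries g) -
          C (starRingEnd ℂ (x2 : ℂ)) * (X 1 ^ 0 * X 2 ^ (j + 1)))) := by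
    have h2 : (C (1 / 2) * (C 2 * (C (x2 : ℂ) * X 2 ^ (j + 1))) : MvPowerSeries (Fin 3) ℂ) =
        C (x2 : ℂ) * X 2 ^ (j + 1) := by
      rw [← mul_assoc, ← map_mul]; norm_num
    rw [Complex.conj_ofReal]
    nth_rewrite 1 [← h2]
    rw [map_ofNat]; ring
  have hlin := coeff_linear_part (α := α) (n := n) (μ := μ) (K := K) (L := L) (ε := ε) hε1
    (p := ![onGraph φ f, onGraphConj φ (conjSeries f),
      C (1 / 2) * (onGraph φ g + onGraphConj φ (conjSeries g))])
    (y := ![C x0 * (X 0 ^ 1 * X 2 ^ j), C (starRingEnd ℂ x1) * (X 1 ^ (q + 1) * X 2 ^ j),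
      C (x2 : ℂ) * X 2 ^ (j + 1)])
    (by
      rw [Fin.forall_fin_succ, Fin.forall_fin_succ, Fin.forall_fin_succ]
      exact ⟨hy0, hy1, hy2, fun i => i.elim0⟩)
    (by
      rw [Fin.forall_fin_succ, Fin.forall_fin_succ, Fin.forall_fin_succ]
      refine ⟨onGraph_sub_mem hφ hf1 (fun hc => ?_), onGraphConj_sub_mem hφ hf2 (fun hc => ?_), ?_,
        fun i => i.elim0⟩
      · obtain rfl : q = 0 := hx.resolve_left (fun h => hc h.1)
        change K + ε + 1 ≤ 1 * K + j * (α * K + 1) + 1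
        rw [← hL]; omega
      · change 2 + ε + 1 ≤ (q + 1) * 2 + j * (α * K + 1) + 1
        rw [← hL]; omega
      · change C (1 / 2) * (onGraph φ g + onGraphConj φ (conjSeries g)) -
          C (x2 : ℂ) * X 2 ^ (j + 1) ∈ _
        rw [hsum]
        have hb : (x2 : ℂ) ≠ 0 → ∀ v, L + ε + 1 ≤ 0 * v + (j + 1) * (α * K + 1) + 1 := by
          intro hc v
          obtain rfl : q = 0 := hx.resolve_left (fun h => hc (by rw [h.2]; rfl))
          rw [← hL, add_mul]; omega
        exact C_mul_mem_weightIdeal _ (add_mem (onGraph_sub_mem hφ hg1 fun hc => hb hc K)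
          (onGraphConj_sub_mem hφ hg2 fun hc => hb hc 2)))
    (e := tri α (n + q) (μ + j)) (by
      rw [weight_three]
      simp only [Matrix.cons_val, tri_zero, tri_one, tri_two]
      rw [add_mul μ, hε]; omega)
  have m0 : (α : ℂ) * coeff (tri α (n + q) (μ + j)) (X 0 ^ (α - 1) * (C x0 * (X 0 ^ 1 * X 2 ^ j)) *
      X 1 ^ n * X 2 ^ μ : MvPowerSeries (Fin 3) ℂ) = α * x0 := by
    rcases hx with ⟨rfl, -⟩ | rfl
    · simp
    have : (X 0 ^ (α - 1) * (C x0 * (X 0 ^ 1 * X 2 ^ j)) * X 1 ^ n * X 2 ^ μ :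
        MvPowerSeries (Fin 3) ℂ) = C x0 * (X 0 ^ (α - 1 + 1) * X 1 ^ n * X 2 ^ (μ + j)) := by
      rw [pow_add _ μ, pow_add]; ring
    rw [this, X_pow_three, coeff_C_mul, Nat.sub_add_cancel hα, add_zero, coeff_monomial_same,
      mul_one]
  have m1 : coeff (tri α (n + q) (μ + j)) (X 0 ^ α * (X 1 ^ (n - 1) *
      (C (starRingEnd ℂ x1) * (X 1 ^ (q + 1) * X 2 ^ j))) * X 2 ^ μ : MvPowerSeries (Fin 3) ℂ) =
      starRingEnd ℂ x1 := by
    have : (X 0 ^ α * (X 1 ^ (n - 1) * (C (starRingEnd ℂ x1) * (X 1 ^ (q + 1) * X 2 ^ j))) *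
        X 2 ^ μ : MvPowerSeries (Fin 3) ℂ) =
        C (starRingEnd ℂ x1) * (X 0 ^ α * X 1 ^ (n - 1 + (q + 1)) * X 2 ^ (μ + j)) := by
      rw [pow_add _ μ, pow_add _ (n - 1)]; ring
    rw [this, X_pow_three, coeff_C_mul, show n - 1 + (q + 1) = n + q by omega, coeff_monomial_same,
      mul_one]
  have m2 : (μ : ℂ) * coeff (tri α (n + q) (μ + j)) (X 0 ^ α * X 1 ^ n * (X 2 ^ (μ - 1) *
      (C (x2 : ℂ) * X 2 ^ (j + 1))) : MvPowerSeries (Fin 3) ℂ) = μ * x2 := by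
    rcases hx with ⟨-, rfl⟩ | rfl
    · simp
    rcases Nat.eq_zero_or_pos μ with rfl | hμ
    · simp
    have : (X 0 ^ α * X 1 ^ n * (X 2 ^ (μ - 1) * (C (x2 : ℂ) * X 2 ^ (j + 1))) :
        MvPowerSeries (Fin 3) ℂ) =
        C (x2 : ℂ) * (X 0 ^ α * X 1 ^ n * X 2 ^ (μ - 1 + (j + 1))) := by
      rw [pow_add _ (μ - 1)]; ring
    rw [this, X_pow_three, coeff_C_mul, show μ - 1 + (j + 1) = μ + j by omega, add_zero,
      coeff_monomial_same, mul_one]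
  simp only [Matrix.cons_val, m0, m1, m2] at hlin
  simp only [map_one, one_mul, Complex.ofReal_one, one_pow] at key
  rw [hlin] at key
  -- As γ = δ = 1, the coefficient of φ at z^α χ^(n+q) s^(μ+j) occurs on both sides with factor one
  -- and cancels.
  rw [add_right_inj] at key
  rcases hx with ⟨-, rfl⟩ | rfl
  · rw [← key]; simp
  · rw [← key, add_zero, Complex.ofReal_re]

end IsGraphMap

end

/-! ### Invariant triples -/

/-- `t = (α, n, μ)`, where `(α, μ)` is an invariant pair of `φ` and `n` is the order of vanishing
of `φ_{α,μ}`. -/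
def IsInvariantTriple (φ : MvPowerSeries (Fin 3) ℂ) (t : ℕ × ℕ × ℕ) : Prop :=
  IsInvariantPair φ (t.1, t.2.2) ∧ IsLeast {n | coeff₃ φ t.1 n t.2.2 ≠ 0} t.2.1

namespace IsInvariantTriple

variable {φ : MvPowerSeries (Fin 3) ℂ} {t t' : ℕ × ℕ × ℕ}

theorem coeff_ne_zero (ht : IsInvariantTriple φ t) : coeff₃ φ t.1 t.2.1 t.2.2 ≠ 0 := ht.2.1

theorem vanishesBelow (ht : IsInvariantTriple φ t) (hφ : IsNormalGraph φ) :
    VanishesBelow φ t.1 t.2.1 t.2.2 where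
  left := hφ.left
  right := hφ.right
  low := ht.1.2
  order b hb := by
    by_contra h
    exact absurd (ht.2.2 h) (not_le.2 hb)

theorem one_le_fst (ht : IsInvariantTriple φ t) (hφ : IsNormalGraph φ) : 1 ≤ t.1 := by
  by_contra h
  apply ht.coeff_ne_zero
  rw [show t.1 = 0 by omega]
  exact hφ.right _ _

theorem one_le_snd (ht : IsInvariantTriple φ t) (hφ : IsNormalGraph φ) : 1 ≤ t.2.1 := by
  by_contra h
  apply ht.coeff_ne_zero
  rw [show t.2.1 = 0 by omega]
  exact hφ.left _ _

/-- By reality the coefficient at (n, α, μ) is nonzero as well. For n < α the pair (n, μ) would lie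
strictly below (α, μ). -/
theorem fst_le_snd (ht : IsInvariantTriple φ t) (hφ : IsNormalGraph φ) : t.1 ≤ t.2.1 := by
  by_contra h
  apply ht.coeff_ne_zero
  have h1 := ht.1.2 (t.2.1, t.2.2) ⟨by simp; omega, le_rfl, fun he => absurd (congrArg Prod.fst he) (by simp only; omega)⟩ t.1
  rw [hφ.real t.2.1 t.1 t.2.2, h1, map_zero]

theorem pairLT_or_eq_of_le {x y : ℕ × ℕ} (h1 : x.1 + x.2 ≤ y.1 + y.2) (h2 : x.2 ≤ y.2) :
    PairLT x y ∨ x = y := by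
  by_cases h : x = y
  · exact Or.inr h
  · exact Or.inl ⟨h1, h2, h⟩

/-- Invariant pairs are minimal for ⪯, hence form an antichain, and the pair determines the order of
vanishing. -/
theorem eq_of_le (ht : IsInvariantTriple φ t) (ht' : IsInvariantTriple φ t')
    (h1 : t.1 + t.2.2 ≤ t'.1 + t'.2.2) (h2 : t.2.2 ≤ t'.2.2) : t = t' := by
  rcases pairLT_or_eq_of_le (x := (t.1, t.2.2)) (y := (t'.1, t'.2.2)) h1 h2 with h | h
  · exact absurd (ht'.1.2 _ h t.2.1) ht.coeff_ne_zero
  · obtain ⟨a, n, m⟩ := t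
    obtain ⟨a', n', m'⟩ := t'
    simp only [Prod.mk.injEq] at h
    obtain ⟨rfl, rfl⟩ := h
    obtain rfl : n = n' := ht.2.unique ht'.2
    rfl

/-- Pairs with the same μ are always comparable. -/
theorem snd_ne (ht : IsInvariantTriple φ t) (ht' : IsInvariantTriple φ t') (h : t ≠ t') :
    t.2.2 ≠ t'.2.2 := by
  intro he
  rcases le_total t.1 t'.1 with hle | hle
  · exact h (ht.eq_of_le ht' (by omega) he.le)
  · exact h (ht'.eq_of_le ht (by omega) he.ge).symm

/-- The triple with the smaller μ must have the larger α + μ, and the other α is at least one. It is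
the triple to which `IsGraphMap.coeff_fst_pure` is applied. -/
theorem exists_two_le (hφ : IsNormalGraph φ) (ht : IsInvariantTriple φ t)
    (ht' : IsInvariantTriple φ t') (h : t ≠ t') :
    ∃ s, IsInvariantTriple φ s ∧ 2 ≤ s.1 := by
  have hne := ht.snd_ne ht' h
  have h1 := ht.one_le_fst hφ
  have h1' := ht'.one_le_fst hφ
  rcases Nat.lt_or_gt_of_ne hne with hlt | hlt
  · refine ⟨t, ht, ?_⟩
    by_contra hcon
    exact h (ht.eq_of_le ht' (by omega) hlt.le)
  · refine ⟨t', ht', ?_⟩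
    by_contra hcon
    exact h (ht'.eq_of_le ht (by omega) hlt.le).symm

/-- The pair (1, 0) lies below or equals every pair with α ≥ 1, and two distinct invariant pairs
cannot both equal it; so φ_{1,0} = 0, and reality exchanges z and χ. This supplies the hypothesis on
ψ in `IsGraphMap.coeff_snd_of_le`. -/
theorem coeff_one_zero (hφ : IsNormalGraph φ) (ht : IsInvariantTriple φ t)
    (ht' : IsInvariantTriple φ t') (h : t ≠ t') (a : ℕ) : coeff₃ φ a 1 0 = 0 := by
  have h1 := ht.one_le_fst hφ
  have h1' := ht'.one_le_fst hφ
  have key : coeff₃ φ 1 a 0 = 0 := by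
    rcases pairLT_or_eq_of_le (x := (1, 0)) (y := (t.1, t.2.2)) (by simp; omega) (by simp) with hl | hl
    · exact ht.1.2 _ hl a
    rcases pairLT_or_eq_of_le (x := (1, 0)) (y := (t'.1, t'.2.2)) (by simp; omega) (by simp)
      with hl' | hl'
    · exact ht'.1.2 _ hl' a
    · simp only [Prod.mk.injEq] at hl hl'
      exact absurd (hl.2.symm.trans hl'.2) (ht.snd_ne ht' h)
  rw [hφ.real, key, map_zero]

end IsInvariantTriple

/-! ### Determination by the resonant coefficient -/

section

variable {φ : MvPowerSeries (Fin 3) ℂ} {F G : MvPowerSeries (Fin 2) ℂ} {t t' : ℕ × ℕ × ℕ} {j : ℕ}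

namespace AgreesWithId

theorem fst_mem (hid : AgreesWithId F G j) (h0 : coeff (duo 0 j) F = 0) :
    F ∈ weightIdeal ![j + 1, 1] (j + 1) :=
  X_zero_sub_mem (fun i m hc => by
    by_contra hcon
    have hij : i = 0 := by
      by_contra hi
      have := Nat.mul_le_mul_right (j + 1) (Nat.one_le_iff_ne_zero.2 hi)
      omega
    subst hij
    rcases Nat.lt_or_ge m j with hm | hm
    · exact hc (hid.1 0 m hm)
    · obtain rfl : m = j := by omega
      rw [coeff_sub_monomial_two, h0] at hc
      simp at hc) le_rfl

theorem coeff_fst (hid : AgreesWithId F G j) {a m : ℕ} (hm : m < j) :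
    coeff (duo a m) F = if a = 1 ∧ m = 0 then 1 else 0 := by
  have := hid.1 a m hm
  rw [coeff_sub_monomial_two, sub_eq_zero] at this
  exact this

theorem coeff_snd (hid : AgreesWithId F G j) {a m : ℕ} (hm : m ≤ j) :
    coeff (duo a m) G = if a = 0 ∧ m = 1 then 1 else 0 := by
  have := hid.2 a m hm
  rw [coeff_sub_monomial_two, sub_eq_zero] at this
  simpa using this

theorem of_coeff (h1 : ∀ a m, m < j → coeff (duo a m) F = if a = 1 ∧ m = 0 then 1 else 0)
    (h2 : ∀ a m, m ≤ j → coeff (duo a m) G = if a = 0 ∧ m = 1 then 1 else 0) :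
    AgreesWithId F G j :=
  ⟨fun a m hm => by rw [coeff_sub_monomial_two, h1 a m hm, sub_self],
    fun a m hm => by rw [coeff_sub_monomial_two, h2 a m hm]; simp⟩

end AgreesWithId

namespace IsGraphMap

theorem agreesWithId_zero (h : IsGraphMap φ φ F G) (hφ : IsNormalGraph φ)
    (hF : constantCoeff F = 0) (hG : constantCoeff G = 0) : AgreesWithId F G 0 :=
  AgreesWithId.of_coeff (fun a m hm => absurd hm (Nat.not_lt_zero _)) fun a m hm => by
    obtain rfl : m = 0 := by omega
    simpa using h.coeff_snd_zero hφ hφ hF hG a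

/-- Induction on the power of z. The coefficient of z^(q+2) w^j in F appears through F̄ at z^α
χ^(n+q+1) s^(μ+j), alone and with the nonzero factor n. -/
theorem agreesWithId_succ_of_coeff (h : IsGraphMap φ φ F G) (hφ : IsNormalGraph φ)
    (ht : IsInvariantTriple φ t) (hα : 2 ≤ t.1) (hF : constantCoeff F = 0)
    (hG : constantCoeff G = 0) (hid : AgreesWithId F G j) (h0 : coeff (duo 0 j) F = 0)
    (h1 : coeff (duo 1 j) F = if j = 0 then 1 else 0)
    (hg : ∀ a, coeff (duo a (j + 1)) G = if a = 0 ∧ j = 0 then 1 else 0) :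
    AgreesWithId F G (j + 1) := by
  obtain ⟨α, n, μ⟩ := t
  simp only at hα
  have hn := ht.one_le_snd hφ
  set f := F - C 1 * (X 0 ^ 1 * X 1 ^ 0) with hf
  set g := G - C ((1 : ℝ) : ℂ) * (X 0 ^ 0 * X 1 ^ 1) with hgdef
  have hf0 : coeff (duo 0 j) f = 0 := by rw [hf, coeff_sub_monomial_two, h0]; simp
  have hf1 : coeff (duo 1 j) f = 0 := by rw [hf, coeff_sub_monomial_two, h1]; simp
  have hg1 : ∀ a m, m ≤ j + 1 → coeff (duo a m) g = 0 := by
    intro a m hm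
    rcases Nat.lt_or_ge m (j + 1) with hm' | hm'
    · exact hid.2 a m (by omega)
    · obtain rfl : m = j + 1 := by omega
      rw [hgdef, coeff_sub_monomial_two, hg]
      simp
  have main : ∀ q, coeff (duo q j) f = 0 := by
    intro q
    induction q using Nat.strong_induction_on with
    | _ q ih =>
    obtain rfl | rfl | ⟨q, rfl⟩ : q = 0 ∨ q = 1 ∨ ∃ r, q = r + 2 :=
      match q with
      | 0 => Or.inl rfl
      | 1 => Or.inr (Or.inl rfl)
      | r + 2 => Or.inr (Or.inr ⟨r, rfl⟩)
    · exact hf0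
    · exact hf1
    -- K depends on q so that, on the unconjugated side, z^(q+2) w^j is heavier than K + ε: two
    -- factors z weigh 2K ≥ K + 2(q + 1) + 1.
    set K := 2 * n + 2 * (q + 1) + 1 with hK
    set L := α * K + 1 with hL
    have hKL : 2 * K + 1 ≤ L := by
      have := Nat.mul_le_mul_right K hα
      omega
    have hlow : ∀ i m, coeff (duo i m) f ≠ 0 → j + 1 ≤ m ∨ (m = j ∧ q + 2 ≤ i) := by
      intro i m hc
      by_contra hcon
      apply hc
      rcases Nat.lt_or_ge m j with hm | hm
      · exact hid.1 i m hm
      · obtain rfl : m = j := by omega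
        exact ih i (by omega)
    have hmL : ∀ m, j + 1 ≤ m → j * L + L ≤ m * L := fun m hm => by
      have := Nat.mul_le_mul_right L hm
      rwa [Nat.succ_mul] at this
    have key := h.coeff_resonance (ht.vanishesBelow hφ) (by simp; omega) hn hF hG (j := j) (q := q + 1)
      (K := K) (ε := j * L + 2 * (q + 1)) (by simp; omega) (f := f) hf (g := g) hgdef (x0 := 0)
      (x1 := coeff (duo (q + 2) j) f) (x2 := 0) rfl (by omega)
      (by
        refine mem_weightIdeal_two fun i m hc => ?_
        rw [map_zero, zero_mul, sub_zero] at hc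
        change K + (j * L + 2 * (q + 1)) + 1 ≤ i * K + m * L
        rcases hlow i m hc with hm | ⟨rfl, hi⟩
        · have := hmL m hm; omega
        · have := Nat.mul_le_mul_right K (show 2 ≤ i by omega); omega)
      (by
        refine mem_weightIdeal_two fun i m hc => ?_
        rw [coeff_sub_monomial_two] at hc
        change 2 + (j * L + 2 * (q + 1)) + 1 ≤ i * 2 + m * L
        by_cases him : i = q + 1 + 1 ∧ m = j
        · exact absurd (by rw [if_pos him, him.1, him.2, sub_self]) hc
        · rw [if_neg him, sub_zero] at hc
          rcases hlow i m hc with hm | ⟨rfl, hi⟩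
          · have := hmL m hm; omega
          · have : q + 3 ≤ i := by
              rcases Nat.eq_or_lt_of_le hi with h | h
              · exact absurd ⟨h.symm, rfl⟩ him
              · omega
            omega)
      (by
        refine mem_weightIdeal_two fun i m hc => ?_
        rw [Complex.ofReal_zero, map_zero, zero_mul, sub_zero] at hc
        change L + (j * L + 2 * (q + 1)) + 1 ≤ i * K + m * L
        have hm : j + 2 ≤ m := by
          by_contra hcon
          exact hc (hg1 i m (by omega))
        have := Nat.mul_le_mul_right L hm
        rw [add_mul] at this; omega)
      (by
        refine mem_weightIdeal_two fun i m hc => ?_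
        rw [Complex.ofReal_zero, map_zero, zero_mul, sub_zero] at hc
        change L + (j * L + 2 * (q + 1)) + 1 ≤ i * 2 + m * L
        have hm : j + 2 ≤ m := by
          by_contra hcon
          exact hc (hg1 i m (by omega))
        have := Nat.mul_le_mul_right L hm
        rw [add_mul] at this; omega)
      (Or.inl ⟨rfl, rfl⟩) (hid.fst_mem h0) (fun a m hm => hg1 a m (by omega))
      (fun a ha hab => by rw [hg1 a (j + 1) le_rfl, mul_zero])
    have hn0 : (n : ℂ) ≠ 0 := by
      have : n ≠ 0 := by simp at hn; omega
      exact_mod_cast this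
    have hc := ht.coeff_ne_zero
    simp only at hc
    simpa [hc, hn0] using key
  refine ⟨fun a m hm => ?_, hg1⟩
  rcases Nat.lt_or_ge m j with hm' | hm'
  · exact hid.1 a m hm'
  · obtain rfl : m = j := by omega
    exact main a

/-- The resonance condition for every invariant triple. -/
theorem resonance (h : IsGraphMap φ φ F G) (hφ : IsNormalGraph φ)
    (ht : IsInvariantTriple φ t) (hF : constantCoeff F = 0)
    (hG : constantCoeff G = 0) (hj : 1 ≤ j) (hid : AgreesWithId F G j)
    (h0 : coeff (duo 0 j) F = 0) {c : ℝ}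
    (hg : ∀ a, coeff (duo a (j + 1)) G = if a = 0 then (c : ℂ) else 0) :
    (j + 1) * c = t.1 * coeff (duo 1 j) F + t.2.1 * starRingEnd ℂ (coeff (duo 1 j) F) +
      t.2.2 * c := by
  obtain ⟨α, n, μ⟩ := t
  have hn := ht.one_le_snd hφ
  have hα := ht.one_le_fst hφ
  simp only at hn hα ⊢
  set f := F - C 1 * (X 0 ^ 1 * X 1 ^ 0) with hf
  set g := G - C ((1 : ℝ) : ℂ) * (X 0 ^ 0 * X 1 ^ 1) with hgdef
  have hj0 : j ≠ 0 := by omega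
  have hf0 : coeff (duo 0 j) f = 0 := by rw [hf, coeff_sub_monomial_two, h0]; simp
  have hf1 : coeff (duo 1 j) f = coeff (duo 1 j) F := by
    rw [hf, coeff_sub_monomial_two]; simp [hj0]
  have hg1 : ∀ a m, m ≤ j → coeff (duo a m) g = 0 := hid.2
  have hg2 : ∀ a, coeff (duo a (j + 1)) g = if a = 0 then (c : ℂ) else 0 := by
    intro a
    rw [hgdef, coeff_sub_monomial_two, hg]; simp [hj0]
  set K := 2 * n with hK
  set L := α * K + 1 with hL
  have hKL : K + 1 ≤ L := by
    have := Nat.mul_le_mul_right K hα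
    omega
  have hlow : ∀ i m, coeff (duo i m) f ≠ 0 → j + 1 ≤ m ∨ (m = j ∧ 1 ≤ i) := by
    intro i m hc
    by_contra hcon
    apply hc
    rcases Nat.lt_or_ge m j with hm | hm
    · exact hid.1 i m hm
    · obtain ⟨rfl, rfl⟩ : m = j ∧ i = 0 := by omega
      exact hf0
  have hmL : ∀ m, j + 1 ≤ m → j * L + L ≤ m * L := fun m hm => by
    have := Nat.mul_le_mul_right L hm
    rwa [Nat.succ_mul] at this
  have hjL : L ≤ j * L := Nat.le_mul_of_pos_left _ hj
  have hlow2 : ∀ i m, coeff (duo i m) (f - C (coeff (duo 1 j) F) * (X 0 ^ (0 + 1) * X 1 ^ j)) ≠ 0 →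
      j + 1 ≤ m ∨ (m = j ∧ 2 ≤ i) := by
    intro i m hc
    rw [coeff_sub_monomial_two] at hc
    by_cases him : i = 0 + 1 ∧ m = j
    · exact absurd (by rw [if_pos him, him.1, him.2, zero_add, hf1, sub_self]) hc
    · rw [if_neg him, sub_zero] at hc
      rcases hlow i m hc with hm | ⟨rfl, hi⟩
      · exact Or.inl hm
      · refine Or.inr ⟨rfl, ?_⟩
        rcases Nat.eq_or_lt_of_le hi with h | h
        · exact absurd ⟨h.symm, rfl⟩ him
        · omega
  have hgv : ∀ v, g - C (c : ℂ) * (X 0 ^ 0 * X 1 ^ (j + 1)) ∈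
      weightIdeal ![v, α * K + 1] (α * K + 1 + j * L + 1) := fun v => by
    refine mem_weightIdeal_two fun i m hc => ?_
    rw [coeff_sub_monomial_two] at hc
    rw [← hL]
    have hm : j + 2 ≤ m := by
      by_contra hcon
      apply hc
      rcases Nat.lt_or_ge m (j + 1) with hm | hm
      · rw [hg1 i m (by omega), if_neg (by omega), sub_zero]
      · obtain rfl : m = j + 1 := by omega
        rw [hg2]; simp
    have := Nat.mul_le_mul_right L hm
    rw [add_mul] at this; omega
  -- For q = 0 the same coefficient of z w^j enters through F and, conjugated, through F̄.
  have key := h.coeff_resonance (ht.vanishesBelow hφ) hα hn hF hG (j := j) (q := 0)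
      (K := K) (ε := j * L) le_rfl (f := f) hf (g := g) hgdef (x0 := coeff (duo 1 j) F)
      (x1 := coeff (duo 1 j) F) (x2 := c) rfl (by omega)
      (by
        refine mem_weightIdeal_two fun i m hc => ?_
        change K + j * L + 1 ≤ i * K + m * L
        rcases hlow2 i m hc with hm | ⟨rfl, hi⟩
        · have := hmL m hm; omega
        · have := Nat.mul_le_mul_right K hi; omega)
      (by
        refine mem_weightIdeal_two fun i m hc => ?_
        change 2 + j * L + 1 ≤ i * 2 + m * L
        rcases hlow2 i m hc with hm | ⟨rfl, hi⟩
        · have := hmL m hm; omega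
        · omega)
      (hgv K) (hgv 2) (Or.inr rfl) (hid.fst_mem h0) hg1
      (fun a ha hab => by rw [hg2, if_neg (by omega), mul_zero])
  have hc := ht.coeff_ne_zero
  simp only at hc
  have h2 : coeff₃ φ α n μ * ((j + 1) * c) = coeff₃ φ α n μ *
      (α * coeff (duo 1 j) F + n * starRingEnd ℂ (coeff (duo 1 j) F) + μ * c) := by
    rw [← key]; ring
  exact mul_left_cancel₀ hc h2

/-- The coefficients of order `j + 1` in the second component, and the ones of order `j` in the
first, vanish if the coefficient of `w^(j+1)` does. -/
theorem agreesWithId_succ (h : IsGraphMap φ φ F G) (hφ : IsNormalGraph φ)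
    (ht : IsInvariantTriple φ t) (hne : t.1 ≠ t.2.1) (ht' : IsInvariantTriple φ t') (htt : t ≠ t')
    (hF : constantCoeff F = 0) (hG : constantCoeff G = 0) (hid : AgreesWithId F G j)
    (hj0 : j = 0 → coeff (duo 1 0) F = 1)
    (hc : coeff (duo 0 (j + 1)) G = if j = 0 then 1 else 0) : AgreesWithId F G (j + 1) := by
  obtain ⟨s, hs, hs2⟩ := IsInvariantTriple.exists_two_le hφ ht ht' htt
  have h0 : coeff (duo 0 j) F = 0 := by
    rcases Nat.eq_zero_or_pos j with rfl | hj
    · exact coeff_duo_zero hF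
    · exact h.coeff_fst_pure (hs.vanishesBelow hφ) hs2 (hs.one_le_snd hφ) hs.coeff_ne_zero hF hG hj
        hid
  have hg : ∀ a, coeff (duo a (j + 1)) G = if a = 0 ∧ j = 0 then 1 else 0 := by
    intro a
    -- F(0, w) vanishes to order j + 1 by now, so G(z, w) agrees with Ḡ(0, w) up to and including
    -- w^(j+1).
    have h3 := h.coeff_snd_of_le hφ hφ hF hG (IsInvariantTriple.coeff_one_zero hφ ht ht' htt)
      (r := j + 1) (by omega) (fun m hm => by
        rcases Nat.lt_or_ge m j with hm' | hm'
        · rw [hid.coeff_fst hm', if_neg (by omega)]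
        · rw [show m = j by omega, h0]) (a := a) (m := j + 1) le_rfl
    by_cases ha : a = 0
    · subst ha; rw [hc]; simp
    · rw [h3, if_neg ha, if_neg (by tauto)]
  refine h.agreesWithId_succ_of_coeff hφ hs hs2 hF hG hid h0 ?_ hg
  rcases Nat.eq_zero_or_pos j with rfl | hj
  · simpa using hj0 rfl
  · have hj' : j ≠ 0 := by omega
    rw [if_neg hj']
    have h4 := h.resonance hφ ht hF hG hj hid h0 (c := 0) (fun a => by rw [hg]; simp [hj'])
    set x := coeff (duo 1 j) F
    -- With c = 0 the resonance relation is αx = −n x̄. Comparing moduli, α ≠ n forces x = 0.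
    have h5 : (t.1 : ℂ) * x = -(t.2.1 * starRingEnd ℂ x) := by
      simp only [Complex.ofReal_zero, mul_zero, add_zero] at h4
      linear_combination -h4
    have h6 := congrArg norm h5
    rw [norm_neg, norm_mul, norm_mul, Complex.norm_natCast, Complex.norm_natCast,
      RCLike.norm_conj] at h6
    by_contra hx
    have h7 : (t.1 : ℝ) = t.2.1 := mul_right_cancel₀ (norm_ne_zero_iff.2 hx) h6
    exact hne (by exact_mod_cast h7)

/-- Away from the resonance, a map tangent to the identity is so to one order more. -/
theorem coeff_snd_eq_zero_of_ratio (h : IsGraphMap φ φ F G) (hφ : IsNormalGraph φ)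
    (ht : IsInvariantTriple φ t) (hne : t.1 ≠ t.2.1) (ht' : IsInvariantTriple φ t') (htt : t ≠ t')
    (hF : constantCoeff F = 0) (hG : constantCoeff G = 0) (hj : 1 ≤ j) (hid : AgreesWithId F G j)
    (hr : t.1 + t.2.1 = t'.1 + t'.2.1 ∨ tripleRatio t t' ≠ ((j + 1 : ℕ) : ℚ)) :
    coeff (duo 0 (j + 1)) G = 0 := by
  obtain ⟨s, hs, hs2⟩ := IsInvariantTriple.exists_two_le hφ ht ht' htt
  have h0 : coeff (duo 0 j) F = 0 :=
    h.coeff_fst_pure (hs.vanishesBelow hφ) hs2 (hs.one_le_snd hφ) hs.coeff_ne_zero hF hG hj hid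
  have h3 : ∀ a, coeff (duo a (j + 1)) G =
      if a = 0 then starRingEnd ℂ (coeff (duo 0 (j + 1)) G) else 0 := fun a =>
    h.coeff_snd_of_le hφ hφ hF hG (IsInvariantTriple.coeff_one_zero hφ ht ht' htt)
      (r := j + 1) (by omega) (fun m hm => by
        rcases Nat.lt_or_ge m j with hm' | hm'
        · rw [hid.coeff_fst hm', if_neg (by omega)]
        · rw [show m = j by omega, h0]) (a := a) (m := j + 1) le_rfl
  have hreal := h3 0
  rw [if_pos rfl] at hreal
  obtain ⟨c, hc⟩ := Complex.conj_eq_iff_real.1 hreal.symm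
  have hg : ∀ a, coeff (duo a (j + 1)) G = if a = 0 then (c : ℂ) else 0 := fun a => by
    rw [h3 a, ← hreal, hc]
  have e1 := h.resonance hφ ht hF hG hj hid h0 hg
  have e2 := h.resonance hφ ht' hF hG hj hid h0 hg
  set x := coeff (duo 1 j) F
  -- As c is real, the imaginary part of the relation is (α − n) Im x = 0; this is where α ≠ n makes
  -- x real.
  have him : ((t.1 : ℝ) - t.2.1) * x.im = 0 := by
    have := congrArg Complex.im e1
    simp [← Nat.cast_succ, -Nat.cast_add] at this
    linarith
  have hx : x.im = 0 := by
    refine (mul_eq_zero.1 him).resolve_left fun h => hne ?_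
    exact_mod_cast sub_eq_zero.1 h
  have r1 := congrArg Complex.re e1
  have r2 := congrArg Complex.re e2
  simp [hx] at r1 r2
  rw [hc, Complex.ofReal_eq_zero]
  by_contra hc0
  have k1 : ((j : ℝ) + 1 - t.2.2) * c = (t.1 + t.2.1) * x.re := by linarith
  have k2 : ((j : ℝ) + 1 - t'.2.2) * c = (t'.1 + t'.2.1) * x.re := by linarith
  -- Eliminating x between the two triples. For equal sums α + n this says μ = μ', which is
  -- impossible; otherwise it says that the fraction is j + 1.
  have k3 : ((j : ℝ) + 1 - t.2.2) * (t'.1 + t'.2.1) = ((j : ℝ) + 1 - t'.2.2) * (t.1 + t.2.1) := by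
    apply mul_right_cancel₀ hc0
    linear_combination (t'.1 + t'.2.1 : ℝ) * k1 - (t.1 + t.2.1 : ℝ) * k2
  by_cases hs : t.1 + t.2.1 = t'.1 + t'.2.1
  · have hs' : (t.1 : ℝ) + t.2.1 = t'.1 + t'.2.1 := by exact_mod_cast hs
    have hpos : (0 : ℝ) < t.1 + t.2.1 := by
      have := ht.one_le_fst hφ
      have : 0 < t.1 + t.2.1 := by omega
      exact_mod_cast this
    rw [← hs'] at k3
    have := mul_right_cancel₀ hpos.ne' k3
    refine ht.snd_ne ht' htt ?_
    have h8 : (t.2.2 : ℝ) = t'.2.2 := by linarith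
    exact_mod_cast h8
  · refine hr.resolve_left hs ?_
    have k4 : ((j : ℚ) + 1 - t.2.2) * (t'.1 + t'.2.1) = ((j : ℚ) + 1 - t'.2.2) * (t.1 + t.2.1) := by
      exact_mod_cast k3
    have hd : ((t'.1 : ℚ) + t'.2.1) - (t.1 + t.2.1) ≠ 0 := by
      intro h9
      apply hs
      have : (t.1 : ℚ) + t.2.1 = t'.1 + t'.2.1 := by linarith
      exact_mod_cast this
    rw [tripleRatio, div_eq_iff hd]
    push_cast
    linarith

theorem eq_X_of_forall (hid : ∀ j, AgreesWithId F G j) : F = X 0 ∧ G = X 1 := by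
  constructor
  · ext d
    rw [← duo_eta d, (hid (d 1 + 1)).coeff_fst (Nat.lt_succ_self _),
      show (X 0 : MvPowerSeries (Fin 2) ℂ) = X 0 ^ 1 * X 1 ^ 0 by ring, X_pow_two, coeff_monomial]
    simp only [duo_inj]
  · ext d
    rw [← duo_eta d, (hid (d 1)).coeff_snd le_rfl,
      show (X 1 : MvPowerSeries (Fin 2) ℂ) = X 0 ^ 0 * X 1 ^ 1 by ring, X_pow_two, coeff_monomial]
    simp only [duo_inj]

end IsGraphMap

end

/-! ### Graph equations and divisibility -/

section

variable {τ : Type*} {φ ψ : MvPowerSeries (Fin 3) ℂ}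

/-- The value of `Im w - ψ(z, z̄, Re w)` at a family of power series. -/
def graphDefect (ψ : MvPowerSeries (Fin 3) ℂ) (Y : Fin 2 ⊕ Fin 2 → MvPowerSeries τ ℂ) :
    MvPowerSeries τ ℂ :=
  C (1 / (2 * Complex.I)) * (Y (Sum.inl 1) - Y (Sum.inr 1)) -
    subst ![Y (Sum.inl 0), Y (Sum.inr 0), C (1 / 2) * (Y (Sum.inl 1) + Y (Sum.inr 1))] ψ

theorem subst_C_mul {σ τ : Type*} {a : σ → MvPowerSeries τ ℂ} (ha : HasSubst a) (c : ℂ)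
    (f : MvPowerSeries σ ℂ) : subst a (C c * f) = C c * subst a f := by
  rw [← smul_eq_C_mul, subst_smul ha, smul_eq_C_mul]

theorem subst_graphSeries {Y : Fin 2 ⊕ Fin 2 → MvPowerSeries τ ℂ}
    (hY : ∀ i, constantCoeff (Y i) = 0) : subst Y (graphSeries ψ) = graphDefect ψ Y := by
  have hs := hasSubst_of_constantCoeff_zero hY
  have hb : HasSubst (![X (Sum.inl 0), X (Sum.inr 0), C (1 / 2) * (X (Sum.inl 1) + X (Sum.inr 1))] :
      Fin 3 → MvPowerSeries (Fin 2 ⊕ Fin 2) ℂ) :=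
    hasSubst_of_constantCoeff_zero fun i => by fin_cases i <;> simp
  rw [graphSeries, graphDefect, subst_sub hs, subst_C_mul hs, subst_sub hs, subst_X hs, subst_X hs,
    subst_comp_subst_apply hb hs]
  congr 2
  funext i
  fin_cases i
  · exact subst_X hs _
  · exact subst_X hs _
  · change subst Y (C (1 / 2) * (X (Sum.inl 1) + X (Sum.inr 1))) = C (1 / 2) * _
    rw [subst_C_mul hs, subst_add hs, subst_X hs, subst_X hs]

/-- The parametrization `(z, s, χ) ↦ (z, s + iφ, χ, s - iφ)` of the complexified graph. -/
def graphParam (φ : MvPowerSeries (Fin 3) ℂ) : Fin 2 ⊕ Fin 2 → MvPowerSeries (Fin 3) ℂ :=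
  Sum.elim ![X 0, X 2 + C Complex.I * φ] ![X 1, X 2 + C (-Complex.I) * φ]

theorem constantCoeff_graphParam (hφ : constantCoeff φ = 0) (i : Fin 2 ⊕ Fin 2) :
    constantCoeff (graphParam φ i) = 0 := by
  rcases i with i | i
  · exact constantCoeff_graphFamily hφ 0 _ i
  · exact constantCoeff_graphFamily hφ 1 _ i

theorem subst_rename {σ υ τ : Type*} [Finite υ] {e : σ → υ} [Filter.TendstoCofinite e]
    {Y : υ → MvPowerSeries τ ℂ}
    (hY : HasSubst Y) (f : MvPowerSeries σ ℂ) :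
    subst Y (rename e f) = subst (fun i => Y (e i)) f := by
  rw [rename_eq_subst, subst_comp_subst_apply (HasSubst.X_comp _) hY]
  congr 1
  funext i
  exact subst_X hY _

theorem subst_graphParam_complexify (hφ : constantCoeff φ = 0) (H : FormalBihol)
    (i : Fin 2 ⊕ Fin 2) :
    subst (graphParam φ) (H.complexify i) =
      Sum.elim (fun j => onGraph φ (H.toFun j)) (fun j => onGraphConj φ (conjSeries (H.toFun j)))
        i := by
  have hs := hasSubst_of_constantCoeff_zero (constantCoeff_graphParam hφ)
  rcases i with i | i
  · rw [FormalBihol.complexify_inl, subst_rename hs]; rfl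
  · rw [FormalBihol.complexify_inr, subst_rename hs]; rfl

theorem isGraphMap_iff_graphDefect (H : FormalBihol) (hφ : constantCoeff φ = 0) :
    IsGraphMap φ ψ (H.toFun 0) (H.toFun 1) ↔
      graphDefect ψ (fun i => subst (graphParam φ) (H.complexify i)) = 0 := by
  simp only [subst_graphParam_complexify hφ]
  rw [graphDefect, sub_eq_zero]
  rfl

theorem graphDefect_graphParam : graphDefect φ (graphParam φ) = 0 := by
  have h1 : C (1 / (2 * Complex.I)) * (graphParam φ (Sum.inl 1) - graphParam φ (Sum.inr 1)) = φ := by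
    change C (1 / (2 * Complex.I)) * ((X 2 + C Complex.I * φ) - (X 2 + C (-Complex.I) * φ)) = φ
    have : C (1 / (2 * Complex.I)) * ((X 2 + C Complex.I * φ) - (X 2 + C (-Complex.I) * φ)) =
        C (1 / (2 * Complex.I) * (2 * Complex.I)) * φ := by
      simp only [map_mul, map_neg, map_ofNat]; ring
    rw [this, one_div_mul_cancel (by simp), map_one, one_mul]
  have h2 : (![graphParam φ (Sum.inl 0), graphParam φ (Sum.inr 0),
      C (1 / 2) * (graphParam φ (Sum.inl 1) + graphParam φ (Sum.inr 1))] :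
      Fin 3 → MvPowerSeries (Fin 3) ℂ) = X := by
    funext i
    fin_cases i
    · rfl
    · rfl
    · change C (1 / 2) * ((X 2 + C Complex.I * φ) + (X 2 + C (-Complex.I) * φ)) = X 2
      have : C (1 / 2) * ((X 2 + C Complex.I * φ) + (X 2 + C (-Complex.I) * φ)) =
          C (1 / 2 * 2) * (X 2 : MvPowerSeries (Fin 3) ℂ) := by
        simp only [map_mul, map_neg, map_ofNat]; ring
      rw [this]; norm_num
  rw [graphDefect, h1, h2, subst_self, id, sub_self]

/-! ### Straightening the graph; series vanishing on it. -/

/-- The map `(z, s, χ, y) ↦ (z, s + i(y + φ), χ, s - i(y + φ))` which straightens the graph. -/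
def straighten (φ : MvPowerSeries (Fin 3) ℂ) :
    Fin 2 ⊕ Fin 2 → MvPowerSeries (Fin 2 ⊕ Fin 2) ℂ :=
  Sum.elim
    ![X (Sum.inl 0), X (Sum.inl 1) + C Complex.I *
      (X (Sum.inr 1) + subst ![X (Sum.inl 0), X (Sum.inr 0), X (Sum.inl 1)] φ)]
    ![X (Sum.inr 0), X (Sum.inl 1) + C (-Complex.I) *
      (X (Sum.inr 1) + subst ![X (Sum.inl 0), X (Sum.inr 0), X (Sum.inl 1)] φ)]

/-- The inverse of `straighten`. -/
def unstraighten (φ : MvPowerSeries (Fin 3) ℂ) :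
    Fin 2 ⊕ Fin 2 → MvPowerSeries (Fin 2 ⊕ Fin 2) ℂ :=
  Sum.elim ![X (Sum.inl 0), C (1 / 2) * (X (Sum.inl 1) + X (Sum.inr 1))]
    ![X (Sum.inr 0), graphSeries φ]

theorem hasSubst_three {σ : Type*} (i j k : σ) :
    HasSubst (![X i, X j, X k] : Fin 3 → MvPowerSeries σ ℂ) :=
  hasSubst_of_constantCoeff_zero fun l => by fin_cases l <;> simp

theorem hasSubst_straighten (hφ : constantCoeff φ = 0) : HasSubst (straighten φ) := by
  have h0 : constantCoeff (subst (![X (Sum.inl 0), X (Sum.inr 0), X (Sum.inl 1)] :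
      Fin 3 → MvPowerSeries (Fin 2 ⊕ Fin 2) ℂ) φ) = 0 :=
    constantCoeff_subst_eq_zero (hasSubst_three _ _ _) (fun l => by fin_cases l <;> simp) hφ
  refine hasSubst_of_constantCoeff_zero fun i => ?_
  rcases i with i | i <;> fin_cases i <;> simp [straighten, h0]

theorem constantCoeff_graphSeries (hφ : constantCoeff φ = 0) :
    constantCoeff (graphSeries φ) = 0 := by
  have hb : ∀ i, constantCoeff ((![X (Sum.inl 0), X (Sum.inr 0),
      C (1 / 2) * (X (Sum.inl 1) + X (Sum.inr 1))] :
      Fin 3 → MvPowerSeries (Fin 2 ⊕ Fin 2) ℂ) i) = 0 := fun i => by fin_cases i <;> simp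
  rw [graphSeries, map_sub, constantCoeff_subst_eq_zero (hasSubst_of_constantCoeff_zero hb) hb hφ]
  simp

theorem hasSubst_unstraighten (hφ : constantCoeff φ = 0) : HasSubst (unstraighten φ) := by
  refine hasSubst_of_constantCoeff_zero fun i => ?_
  rcases i with i | i <;> fin_cases i <;> simp [unstraighten, constantCoeff_graphSeries hφ]

theorem subst_unstraighten_straighten (hφ : constantCoeff φ = 0) (i : Fin 2 ⊕ Fin 2) :
    subst (unstraighten φ) (straighten φ i) = X i := by
  have hs := hasSubst_unstraighten hφ
  have h1 : subst (unstraighten φ)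
      (subst (![X (Sum.inl 0), X (Sum.inr 0), X (Sum.inl 1)] :
        Fin 3 → MvPowerSeries (Fin 2 ⊕ Fin 2) ℂ) φ) =
      subst ![X (Sum.inl 0), X (Sum.inr 0), C (1 / 2) * (X (Sum.inl 1) + X (Sum.inr 1))] φ := by
    rw [subst_comp_subst_apply (hasSubst_three _ _ _) hs]
    congr 1
    funext i
    fin_cases i <;> exact subst_X hs _
  have h2 : ∀ c, subst (unstraighten φ) (X (Sum.inl 1) + C c *
      (X (Sum.inr 1) + subst ![X (Sum.inl 0), X (Sum.inr 0), X (Sum.inl 1)] φ)) =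
      C (1 / 2) * (X (Sum.inl 1) + X (Sum.inr 1)) +
        C (c * (1 / (2 * Complex.I))) * (X (Sum.inl 1) - X (Sum.inr 1)) := by
    intro c
    rw [subst_add hs, subst_C_mul hs, subst_add hs, subst_X hs, subst_X hs, h1]
    change C (1 / 2) * (X (Sum.inl 1) + X (Sum.inr 1)) + C c * (graphSeries φ + _) = _
    rw [graphSeries, sub_add_cancel, map_mul, mul_assoc]
  have h3 : (C (1 / 2) + C (1 / 2) : MvPowerSeries (Fin 2 ⊕ Fin 2) ℂ) = 1 := by
    rw [← map_add]; norm_num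
  rcases i with i | i
  · fin_cases i
    · exact subst_X hs _
    · refine (h2 Complex.I).trans ?_
      rw [show Complex.I * (1 / (2 * Complex.I)) = 1 / 2 by field_simp]
      change _ = X (Sum.inl 1)
      linear_combination X (Sum.inl 1) * h3
  · fin_cases i
    · exact subst_X hs _
    · refine (h2 (-Complex.I)).trans ?_
      rw [show -Complex.I * (1 / (2 * Complex.I)) = -(1 / 2) by field_simp, map_neg]
      change _ = X (Sum.inr 1)
      linear_combination X (Sum.inr 1) * h3

theorem coeff_subst_update_zero {σ : Type*} [Fintype σ] [DecidableEq σ] (s : σ) (f : MvPowerSeries σ ℂ)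
    {m : σ →₀ ℕ} (hm : m s = 0) :
    coeff m (subst (fun i => if i = s then 0 else X i : σ → MvPowerSeries σ ℂ) f) = coeff m f := by
  have hs : HasSubst (fun i => if i = s then 0 else X i : σ → MvPowerSeries σ ℂ) :=
    hasSubst_of_constantCoeff_zero fun i => by split_ifs <;> simp
  rw [coeff_subst hs, finsum_eq_single _ m]
  · have : (m.prod fun i e => (if i = s then 0 else X i : MvPowerSeries σ ℂ) ^ e) =
        m.prod fun i e => X i ^ e :=
      Finsupp.prod_congr fun i hi => by
        rw [if_neg]
        rintro rfl
        exact (Finsupp.mem_support_iff.1 hi) hm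
    rw [this, ← monomial_one_eq, coeff_monomial_same, smul_eq_mul, mul_one]
  · intro d hd
    by_cases h : d s = 0
    · have : (d.prod fun i e => (if i = s then 0 else X i : MvPowerSeries σ ℂ) ^ e) =
          d.prod fun i e => X i ^ e :=
        Finsupp.prod_congr fun i hi => by
          rw [if_neg]
          rintro rfl
          exact (Finsupp.mem_support_iff.1 hi) h
      rw [this, ← monomial_one_eq, coeff_monomial, if_neg hd.symm, smul_zero]
    · have : (d.prod fun i e => (if i = s then 0 else X i : MvPowerSeries σ ℂ) ^ e) = 0 := by
        rw [Finsupp.prod, Finset.prod_eq_zero (Finsupp.mem_support_iff.2 h)]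
        rw [if_pos rfl, zero_pow h]
      rw [this, map_zero, smul_zero]

/-- A series which vanishes on the graph is a multiple of the defining series. -/
theorem graphSeries_dvd (hφ : constantCoeff φ = 0) {f : MvPowerSeries (Fin 2 ⊕ Fin 2) ℂ}
    (hf : subst (graphParam φ) f = 0) : graphSeries φ ∣ f := by
  have hE := hasSubst_straighten hφ
  have hU := hasSubst_unstraighten hφ
  set back : Fin 3 → MvPowerSeries (Fin 2 ⊕ Fin 2) ℂ :=
    ![X (Sum.inl 0), X (Sum.inr 0), X (Sum.inl 1)] with hback
  have hb : HasSubst back := hasSubst_three _ _ _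
  set κ : Fin 2 ⊕ Fin 2 → MvPowerSeries (Fin 2 ⊕ Fin 2) ℂ :=
    fun i => if i = Sum.inr 1 then 0 else X i with hκdef
  have hκ : HasSubst κ := hasSubst_of_constantCoeff_zero fun i => by
    simp only [hκdef]; split_ifs <;> simp
  have hG : HasSubst (graphParam φ) := hasSubst_of_constantCoeff_zero (constantCoeff_graphParam hφ)
  have hκX : ∀ i, i ≠ Sum.inr 1 → κ i = X i := fun i hi => if_neg hi
  have hκ1 : κ (Sum.inr 1) = 0 := if_pos rfl
  have hκφ : subst κ (subst back φ) = subst back φ := by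
    rw [subst_comp_subst_apply hb hκ]
    congr 1
    funext i
    fin_cases i <;> exact (subst_X hκ _).trans (hκX _ (by simp))
  have hbX : ∀ (v : Fin 3) c, subst back (X v + C c * φ) = back v + C c * subst back φ := by
    intro v c
    rw [subst_add hb, subst_X hb, subst_C_mul hb]
  -- In the straightened coordinates, setting y = 0 amounts to restricting to the graph, up to
  -- renaming the variables.
  have h1 : subst κ (subst (straighten φ) f) = subst back (subst (graphParam φ) f) := by
    rw [subst_comp_subst_apply hE hκ, subst_comp_subst_apply hG hb]
    congr 1
    funext i
    have h2 : ∀ c, subst κ (X (Sum.inl 1) + C c * (X (Sum.inr 1) + subst back φ)) =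
        X (Sum.inl 1) + C c * subst back φ := by
      intro c
      rw [subst_add hκ, subst_C_mul hκ, subst_add hκ, subst_X hκ, subst_X hκ, hκ1, zero_add, hκφ,
        hκX _ (by simp)]
    rcases i with i | i <;> fin_cases i
    · exact (subst_X hκ _).trans ((hκX _ (by simp)).trans (subst_X hb 0).symm)
    · exact (h2 _).trans (hbX 2 _).symm
    · exact (subst_X hκ _).trans ((hκX _ (by simp)).trans (subst_X hb 1).symm)
    · exact (h2 _).trans (hbX 2 _).symm
  rw [hf, ← coe_substAlgHom hb, map_zero] at h1
  -- Vanishing at y = 0 is divisibility by y, and `unstraighten` carries y to the defining series.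
  have h3 : X (Sum.inr 1) ∣ subst (straighten φ) f := by
    rw [X_dvd_iff]
    intro m hm
    rw [← coeff_subst_update_zero (Sum.inr 1) _ hm, ← hκdef, h1, map_zero]
  obtain ⟨q, hq⟩ := h3
  refine ⟨subst (unstraighten φ) q, ?_⟩
  have h4 : subst (unstraighten φ) (subst (straighten φ) f) = f := by
    rw [subst_comp_subst_apply hE hU]
    simp only [subst_unstraighten_straighten hφ]
    rw [show (fun s => X s : Fin 2 ⊕ Fin 2 → MvPowerSeries (Fin 2 ⊕ Fin 2) ℂ) = X from rfl,
      subst_self, id]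
  rw [← h4, hq, subst_mul hU, subst_X hU]
  rfl

/-- The series that vanish on the parametrized graph are exactly the multiples of the defining
series. The identity with an unknown factor thereby becomes a single equation. -/
theorem isGraphMap_iff_dvd (H : FormalBihol) (hφ : constantCoeff φ = 0) :
    IsGraphMap φ ψ (H.toFun 0) (H.toFun 1) ↔
      ∃ a, subst H.complexify (graphSeries ψ) = a * graphSeries φ := by
  have hG : HasSubst (graphParam φ) := hasSubst_of_constantCoeff_zero (constantCoeff_graphParam hφ)
  have hY : ∀ i, constantCoeff (subst (graphParam φ) (H.complexify i)) = 0 := fun i =>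
    constantCoeff_subst_eq_zero hG (constantCoeff_graphParam hφ) (H.constantCoeff_complexify i)
  rw [isGraphMap_iff_graphDefect H hφ, ← subst_graphSeries hY,
    ← subst_comp_subst_apply H.hasSubst_complexify hG]
  constructor
  · intro h
    obtain ⟨a, ha⟩ := graphSeries_dvd hφ h
    exact ⟨a, by rw [ha, mul_comm]⟩
  · rintro ⟨a, ha⟩
    rw [ha, subst_mul hG, subst_graphSeries (constantCoeff_graphParam hφ),
      graphDefect_graphParam, mul_zero]

end

/-! ### Automorphisms in normal coordinates -/

namespace FormalHypersurface

variable {M : FormalHypersurface} {Φ Φ' H : FormalBihol} {φ φ' : MvPowerSeries (Fin 3) ℂ}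

theorem subst_unit_mul_cancel (K : FormalBihol) (u : (MvPowerSeries (Fin 2 ⊕ Fin 2) ℂ)ˣ) :
    subst K.complexify (↑u⁻¹ : MvPowerSeries (Fin 2 ⊕ Fin 2) ℂ) *
      subst K.complexify (u : MvPowerSeries (Fin 2 ⊕ Fin 2) ℂ) = 1 := by
  rw [← subst_mul K.hasSubst_complexify, Units.inv_mul, ← coe_substAlgHom K.hasSubst_complexify,
    map_one]

/-- The units relating ρ to the two graph series, and their pullbacks, can be absorbed into the
factor a. -/
theorem mem_aut_iff_exists (h : M.IsNormalCoord Φ φ) (h' : M.IsNormalCoord Φ' φ') :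
    H ∈ M.Aut ↔ ∃ a, subst (Φ' * H * Φ⁻¹).complexify (graphSeries φ') = a * graphSeries φ := by
  obtain ⟨-, u, hu⟩ := h
  obtain ⟨-, u', hu'⟩ := h'
  have e1 : subst Φ⁻¹.complexify (subst H.complexify M.rho) =
      subst (H * Φ⁻¹).complexify (u' : MvPowerSeries (Fin 2 ⊕ Fin 2) ℂ) *
        subst (Φ' * H * Φ⁻¹).complexify (graphSeries φ') := by
    rw [← FormalBihol.subst_complexify, hu', subst_mul (H * Φ⁻¹).hasSubst_complexify,
      ← FormalBihol.subst_complexify, mul_assoc]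
  have e2 : subst Φ⁻¹.complexify M.rho = subst Φ⁻¹.complexify
      (u : MvPowerSeries (Fin 2 ⊕ Fin 2) ℂ) * graphSeries φ := by
    rw [hu, subst_mul Φ⁻¹.hasSubst_complexify, ← FormalBihol.subst_complexify, mul_inv_cancel,
      FormalBihol.complexify_one, subst_self, id]
  constructor
  · rintro ⟨a, ha⟩
    refine ⟨subst (H * Φ⁻¹).complexify (↑u'⁻¹ : MvPowerSeries (Fin 2 ⊕ Fin 2) ℂ) *
      (subst Φ⁻¹.complexify a * subst Φ⁻¹.complexify (u : MvPowerSeries (Fin 2 ⊕ Fin 2) ℂ)), ?_⟩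
    rw [ha, subst_mul Φ⁻¹.hasSubst_complexify, e2] at e1
    linear_combination -subst (H * Φ⁻¹).complexify (↑u'⁻¹ : MvPowerSeries (Fin 2 ⊕ Fin 2) ℂ) * e1 -
      subst (Φ' * H * Φ⁻¹).complexify (graphSeries φ') * subst_unit_mul_cancel (H * Φ⁻¹) u'
  · rintro ⟨a, ha⟩
    set b := subst (H * Φ⁻¹).complexify (u' : MvPowerSeries (Fin 2 ⊕ Fin 2) ℂ) * a *
      subst Φ⁻¹.complexify (↑u⁻¹ : MvPowerSeries (Fin 2 ⊕ Fin 2) ℂ) with hb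
    have e3 : subst Φ⁻¹.complexify (subst H.complexify M.rho) =
        b * subst Φ⁻¹.complexify M.rho := by
      rw [e1, ha, e2, hb]
      linear_combination -(subst (H * Φ⁻¹).complexify (u' : MvPowerSeries (Fin 2 ⊕ Fin 2) ℂ) * a *
        graphSeries φ) * subst_unit_mul_cancel Φ⁻¹ u
    have e4 := congrArg (subst Φ.complexify) e3
    rw [← FormalBihol.subst_complexify, inv_mul_cancel, FormalBihol.complexify_one, subst_self, id,
      subst_mul Φ.hasSubst_complexify, ← FormalBihol.subst_complexify, inv_mul_cancel,
      FormalBihol.complexify_one, subst_self, id] at e4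
    exact ⟨_, e4⟩

/-- Source and target may carry different normal coordinates, so that H = 1 yields the transition
maps. -/
theorem mem_aut_iff (h : M.IsNormalCoord Φ φ) (h' : M.IsNormalCoord Φ' φ') :
    H ∈ M.Aut ↔ IsGraphMap φ φ' ((Φ' * H * Φ⁻¹).toFun 0) ((Φ' * H * Φ⁻¹).toFun 1) := by
  rw [mem_aut_iff_exists h h', isGraphMap_iff_dvd _ h.1.constantCoeff]

theorem isGraphMap_transition (h : M.IsNormalCoord Φ φ) (h' : M.IsNormalCoord Φ' φ') :
    IsGraphMap φ φ' ((Φ' * Φ⁻¹).toFun 0) ((Φ' * Φ⁻¹).toFun 1) := by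
  have := (mem_aut_iff h h').1 M.Aut.one_mem
  rwa [mul_one] at this

end FormalHypersurface

/-! ### The linear part of a map between graphs -/

theorem single_zero_one : (Finsupp.single 0 1 : Fin 2 →₀ ℕ) = duo 1 0 := by
  ext i; fin_cases i <;> simp [duo]

theorem single_one_one : (Finsupp.single 1 1 : Fin 2 →₀ ℕ) = duo 0 1 := by
  ext i; fin_cases i <;> simp [duo]

namespace FormalBihol

theorem jacobian_mul (H K : FormalBihol) : (H * K).jacobian = H.jacobian * K.jacobian :=
  jacobian_subst H.constantCoeff_eq_zero K.constantCoeff_eq_zero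

theorem jacobian_one : (1 : FormalBihol).jacobian = 1 := jacobian_X

theorem jacobian_apply_zero (H : FormalBihol) (i : Fin 2) :
    H.jacobian i 0 = coeff (duo 1 0) (H.toFun i) := by
  rw [← single_zero_one]; rfl

theorem jacobian_apply_one (H : FormalBihol) (i : Fin 2) :
    H.jacobian i 1 = coeff (duo 0 1) (H.toFun i) := by
  rw [← single_one_one]; rfl

/-- `H` maps the graph of `φ` into the graph of `ψ`. -/
def MapsGraph (H : FormalBihol) (φ ψ : MvPowerSeries (Fin 3) ℂ) : Prop :=
  IsGraphMap φ ψ (H.toFun 0) (H.toFun 1)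

namespace MapsGraph

variable {H K : FormalBihol} {φ ψ : MvPowerSeries (Fin 3) ℂ}

theorem jacobian_one_zero (h : H.MapsGraph φ ψ) (hφ : IsNormalGraph φ) (hψ : IsNormalGraph ψ) :
    H.jacobian 1 0 = 0 := by
  rw [jacobian_apply_zero]
  exact h.coeff_snd_zero hφ hψ (H.constantCoeff_eq_zero 0) (H.constantCoeff_eq_zero 1) 1

theorem det_eq (h : H.MapsGraph φ ψ) (hφ : IsNormalGraph φ) (hψ : IsNormalGraph ψ) :
    H.jacobian.det = H.jacobian 0 0 * H.jacobian 1 1 := by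
  rw [Matrix.det_fin_two, h.jacobian_one_zero hφ hψ, mul_zero, sub_zero]

theorem jacobian_zero_zero_ne (h : H.MapsGraph φ ψ) (hφ : IsNormalGraph φ) (hψ : IsNormalGraph ψ) :
    H.jacobian 0 0 ≠ 0 :=
  left_ne_zero_of_mul ((h.det_eq hφ hψ).symm.trans_ne H.det_ne_zero)

theorem jacobian_one_one_ne (h : H.MapsGraph φ ψ) (hφ : IsNormalGraph φ) (hψ : IsNormalGraph ψ) :
    H.jacobian 1 1 ≠ 0 :=
  right_ne_zero_of_mul ((h.det_eq hφ hψ).symm.trans_ne H.det_ne_zero)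

theorem ofReal_re_jacobian (h : H.MapsGraph φ ψ) (hφ : IsNormalGraph φ) (hψ : IsNormalGraph ψ) :
    (((H.jacobian 1 1).re : ℝ) : ℂ) = H.jacobian 1 1 := by
  rw [← Complex.conj_eq_iff_re, jacobian_apply_one]
  exact h.conj_coeff_snd hφ hψ (H.constantCoeff_eq_zero 0) (H.constantCoeff_eq_zero 1)

theorem coeff_lowest {α n μ : ℕ} (h : H.MapsGraph φ ψ) (hφ : IsNormalGraph φ)
    (hψ : IsNormalGraph ψ) (h1 : VanishesBelow φ α n μ) (h2 : VanishesBelow ψ α n μ) (hα : 1 ≤ α)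
    (hn : 1 ≤ n) :
    H.jacobian 1 1 * coeff₃ φ α n μ = H.jacobian 0 0 ^ α * starRingEnd ℂ (H.jacobian 0 0) ^ n *
      H.jacobian 1 1 ^ μ * coeff₃ ψ α n μ := by
  have := IsGraphMap.coeff_lowest h h1 h2 hα hn (H.constantCoeff_eq_zero 0)
    (H.constantCoeff_eq_zero 1) (fun a => h.coeff_snd_zero hφ hψ (H.constantCoeff_eq_zero 0)
      (H.constantCoeff_eq_zero 1) a) (γ := H.jacobian 0 0) (δ := (H.jacobian 1 1).re)
    (H.jacobian_apply_zero 0).symm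
    (by rw [h.ofReal_re_jacobian hφ hψ]; exact (H.jacobian_apply_one 1).symm)
  rwa [h.ofReal_re_jacobian hφ hψ] at this

theorem jacobian_zero_zero_mul (k : K.MapsGraph φ φ) (hφ : IsNormalGraph φ) :
    (H * K).jacobian 0 0 = H.jacobian 0 0 * K.jacobian 0 0 := by
  rw [jacobian_mul, Matrix.mul_apply, Fin.sum_univ_two, k.jacobian_one_zero hφ hφ, mul_zero,
    add_zero]

theorem jacobian_one_one_mul (h : H.MapsGraph φ φ) (hφ : IsNormalGraph φ) :
    (H * K).jacobian 1 1 = H.jacobian 1 1 * K.jacobian 1 1 := by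
  rw [jacobian_mul, Matrix.mul_apply, Fin.sum_univ_two, h.jacobian_one_zero hφ hφ, zero_mul,
    zero_add]

/-- The diagonal of the linear part does not change under conjugation with a map between graphs. -/
theorem jacobian_conj {P : FormalBihol} (h : H.MapsGraph φ φ) (hP : P.MapsGraph φ ψ)
    (hφ : IsNormalGraph φ) (hψ : IsNormalGraph ψ) :
    (P * H * P⁻¹).jacobian 0 0 = H.jacobian 0 0 ∧ (P * H * P⁻¹).jacobian 1 1 = H.jacobian 1 1 := by
  have e : (P * H * P⁻¹).jacobian * P.jacobian = P.jacobian * H.jacobian := by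
    rw [← jacobian_mul, inv_mul_cancel_right, jacobian_mul]
  have p0 := hP.jacobian_one_zero hφ hψ
  have h0 := h.jacobian_one_zero hφ hφ
  have e10 := congrFun (congrFun e 1) 0
  have e00 := congrFun (congrFun e 0) 0
  have e11 := congrFun (congrFun e 1) 1
  simp only [Matrix.mul_apply, Fin.sum_univ_two, p0, h0, mul_zero, zero_mul, add_zero,
    zero_add] at e10 e00 e11
  -- The conjugate is again upper triangular, because P and H are.
  have z := (mul_eq_zero.1 e10).resolve_right (hP.jacobian_zero_zero_ne hφ hψ)
  rw [z, zero_mul, zero_add] at e11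
  constructor
  · exact mul_right_cancel₀ (hP.jacobian_zero_zero_ne hφ hψ) (e00.trans (mul_comm _ _))
  · exact mul_right_cancel₀ (hP.jacobian_one_one_ne hφ hψ) (e11.trans (mul_comm _ _))

/-- Invariant triples are preserved by maps between graphs. -/
theorem isInvariantTriple {t : ℕ × ℕ × ℕ} (h : H.MapsGraph φ ψ) (hφ : IsNormalGraph φ)
    (hψ : IsNormalGraph ψ) (ht : IsInvariantTriple φ t) : IsInvariantTriple ψ t := by
  obtain ⟨α, n, μ⟩ := t
  have trans : ∀ {x y z : ℕ × ℕ}, PairLT x y → PairLT y z → PairLT x z := by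
    rintro ⟨a, b⟩ ⟨c, d⟩ ⟨e, f⟩ ⟨h1, h2, h3⟩ ⟨h4, h5, h6⟩
    refine ⟨h1.trans h4, h2.trans h5, ?_⟩
    simp only [ne_eq, Prod.mk.injEq] at *
    omega
  -- β + 2ν, the sum of β + ν and ν, increases strictly along ≺. The outer induction thus follows ≺
  -- and the inner one the powers of χ; at each step `coeff_lowest` relates the coefficients of φ
  -- and ψ by nonzero factors.
  have key : ∀ N b β ν, β + 2 * ν = N →
      (PairLT (β, ν) (α, μ) ∨ (β, ν) = (α, μ) ∧ b < n) → coeff₃ ψ β b ν = 0 := by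
    intro N
    induction N using Nat.strong_induction_on with
    | _ N ihN =>
    intro b
    induction b using Nat.strong_induction_on with
    | _ b ihb =>
    intro β ν hN hP
    rcases Nat.eq_zero_or_pos β with rfl | hβ
    · exact hψ.right _ _
    rcases Nat.eq_zero_or_pos b with rfl | hb
    · exact hψ.left _ _
    have hlt : ∀ y : ℕ × ℕ, PairLT y (β, ν) → PairLT y (α, μ) := by
      intro y hy
      rcases hP with h | ⟨h, -⟩
      · exact trans hy h
      · rwa [h] at hy
    have hzero : ∀ b' ≤ b, coeff₃ φ β b' ν = 0 := by
      intro b' hb'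
      rcases hP with h | ⟨h, hbn⟩
      · exact ht.1.2 _ h b'
      · obtain ⟨rfl, rfl⟩ := Prod.mk.inj h
        exact (ht.vanishesBelow hφ).order b' (show b' < n by omega)
    have v1 : VanishesBelow φ β b ν :=
      ⟨hφ.left, hφ.right, fun y hy c => ht.1.2 y (hlt y hy) c, fun b' hb' => hzero b' hb'.le⟩
    have v2 : VanishesBelow ψ β b ν := by
      refine ⟨hψ.left, hψ.right, fun y hy c => ?_, fun b' hb' => ihb b' hb' β ν hN ?_⟩
      · refine ihN (y.1 + 2 * y.2) ?_ c y.1 y.2 rfl (Or.inl (hlt y hy))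
        obtain ⟨h1, h2, h3⟩ := hy
        obtain ⟨y1, y2⟩ := y
        simp only [ne_eq, Prod.mk.injEq] at h1 h2 h3 ⊢
        omega
      · exact hP.imp_right fun h => ⟨h.1, by omega⟩
    have e := h.coeff_lowest hφ hψ v1 v2 hβ hb
    rw [hzero b le_rfl, mul_zero] at e
    have g0 := h.jacobian_zero_zero_ne hφ hψ
    have d0 := h.jacobian_one_one_ne hφ hψ
    have g1 : starRingEnd ℂ (H.jacobian 0 0) ≠ 0 := by simpa using g0
    exact (mul_eq_zero.1 e.symm).resolve_left
      (mul_ne_zero (mul_ne_zero (pow_ne_zero _ g0) (pow_ne_zero _ g1)) (pow_ne_zero _ d0))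
  have v2 : VanishesBelow ψ α n μ :=
    ⟨hψ.left, hψ.right, fun y hy c => key _ c y.1 y.2 rfl (Or.inl hy),
      fun b hb => key _ b α μ rfl (Or.inr ⟨rfl, hb⟩)⟩
  have hne : coeff₃ ψ α n μ ≠ 0 := by
    intro h0
    have e := h.coeff_lowest hφ hψ (ht.vanishesBelow hφ) v2 (ht.one_le_fst hφ) (ht.one_le_snd hφ)
    rw [h0, mul_zero] at e
    exact (mul_eq_zero.1 e).elim (h.jacobian_one_one_ne hφ hψ) ht.coeff_ne_zero
  refine ⟨⟨⟨n, hne⟩, v2.low⟩, hne, fun b hb => ?_⟩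
  by_contra hcon
  exact hb (v2.order b (not_le.1 hcon))

end MapsGraph

end FormalBihol

/-- Transition maps are maps between graphs, so membership in `Lambda` may be tested in any given
normal coordinates. -/
theorem FormalHypersurface.IsNormalCoord.isInvariantTriple {M : FormalHypersurface}
    {Φ : FormalBihol} {φ : MvPowerSeries (Fin 3) ℂ} (h : M.IsNormalCoord Φ φ) {t : ℕ × ℕ × ℕ} :
    t ∈ M.Lambda ↔ IsInvariantTriple φ t := by
  constructor
  · rintro ⟨Φ', φ', h', ht⟩
    exact FormalBihol.MapsGraph.isInvariantTriple (M.isGraphMap_transition h' h) h'.1 h.1 ht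
  · exact fun ht => ⟨Φ, φ, h, ht⟩

/-! ### Unit parts of complex numbers -/

/-- The unit complex number `z / |z|`, or `1` if `z = 0`. -/
def unitPart (z : ℂ) : Circle := Circle.exp z.arg

theorem coe_unitPart {z : ℂ} (h : z ≠ 0) : (unitPart z : ℂ) = z / ‖z‖ := by
  rw [unitPart, Circle.coe_exp, eq_div_iff (by simpa using h), mul_comm]
  exact Complex.norm_mul_exp_arg_mul_I z

theorem unitPart_one : unitPart 1 = 1 := by
  apply Circle.ext
  rw [coe_unitPart one_ne_zero]; simp

theorem unitPart_mul {z w : ℂ} (hz : z ≠ 0) (hw : w ≠ 0) :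
    unitPart (z * w) = unitPart z * unitPart w := by
  apply Circle.ext
  rw [Circle.coe_mul, coe_unitPart hz, coe_unitPart hw, coe_unitPart (mul_ne_zero hz hw), norm_mul,
    Complex.ofReal_mul, div_mul_div_comm]

theorem unitPart_pow {z : ℂ} (hz : z ≠ 0) (n : ℕ) : unitPart (z ^ n) = unitPart z ^ n := by
  induction n with
  | zero => rw [pow_zero, pow_zero, unitPart_one]
  | succ n ih => rw [pow_succ, unitPart_mul (pow_ne_zero _ hz) hz, ih, pow_succ]

theorem unitPart_conj {z : ℂ} (hz : z ≠ 0) : unitPart (starRingEnd ℂ z) = (unitPart z)⁻¹ := by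
  have hz' : starRingEnd ℂ z ≠ 0 := by simpa using hz
  rw [eq_inv_iff_mul_eq_one, ← unitPart_mul hz' hz]
  apply Circle.ext
  rw [coe_unitPart (mul_ne_zero hz' hz), ← Complex.normSq_eq_conj_mul_self]
  simp [Complex.normSq_eq_norm_sq, hz]

theorem unitPart_of_norm_eq_one {z : ℂ} (hz : ‖z‖ = 1) : (unitPart z : ℂ) = z := by
  have : z ≠ 0 := by rintro rfl; simp at hz
  rw [coe_unitPart this, hz]; simp

theorem eq_norm_of_unitPart_eq_one {z : ℂ} (hz : z ≠ 0) (h : unitPart z = 1) : z = ‖z‖ := by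
  have h1 := coe_unitPart hz
  rw [h, Circle.coe_one, eq_div_iff (by simpa using hz), one_mul] at h1
  exact h1.symm

theorem unitPart_of_real {z : ℂ} (hz : z ≠ 0) (h : ((z.re : ℝ) : ℂ) = z) :
    unitPart z = 1 ∨ unitPart z = -1 := by
  have h1 : unitPart z * unitPart z = 1 := by
    have h2 := unitPart_conj hz
    rw [Complex.conj_eq_iff_re.2 h] at h2
    nth_rewrite 1 [h2]
    exact inv_mul_cancel _
  have h3 : (unitPart z : ℂ) * unitPart z = 1 := by
    rw [← Circle.coe_mul, h1, Circle.coe_one]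
  rcases mul_self_eq_one_iff.1 h3 with h | h
  · exact Or.inl (Circle.ext h)
  · exact Or.inr (Circle.ext (by rw [h]; rfl))

/-! ### Finiteness of the torus subgroups -/

/-- For each of the two values of δ the equation for γ has the form γ^k = const, with at most k
solutions. -/
theorem finite_torusSubgroup {k : ℕ} (hk : 0 < k) (l : ℤ) :
    Finite (torusSubgroup k l) ∧ Nat.card (torusSubgroup k l) ≤ 2 * k := by
  classical
  set T : Finset (ℂ × ℂ) :=
    (Polynomial.nthRoots k (1 : ℂ)).toFinset.map (Function.Embedding.sectL ℂ (1 : ℂ)) ∪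
      (Polynomial.nthRoots k (((-1 : ℂ) ^ l)⁻¹)).toFinset.map
        (Function.Embedding.sectL ℂ (-1 : ℂ)) with hT
  have hcard : T.card ≤ 2 * k := by
    refine (Finset.card_union_le _ _).trans ?_
    rw [Finset.card_map, Finset.card_map]
    have h1 := (Multiset.toFinset_card_le (Polynomial.nthRoots k (1 : ℂ))).trans
      (Polynomial.card_nthRoots k 1)
    have h2 := (Multiset.toFinset_card_le (Polynomial.nthRoots k (((-1 : ℂ) ^ l)⁻¹))).trans
      (Polynomial.card_nthRoots k _)
    omega
  have hmem : ∀ x : torusSubgroup k l, ((x.1.1 : ℂ), (x.1.2 : ℂ)) ∈ T := by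
    rintro ⟨⟨u, s⟩, hs, hu⟩
    simp only at hs hu
    have hu' := congrArg (fun c : Circle => (c : ℂ)) hu
    simp only [Circle.coe_mul, Circle.coe_zpow, Circle.coe_one, zpow_natCast] at hu'
    rw [hT, Finset.mem_union]
    rcases hs with rfl | rfl
    · refine Or.inl (Finset.mem_map.2 ⟨u, ?_, by simp⟩)
      rw [Multiset.mem_toFinset, Polynomial.mem_nthRoots hk]
      simpa using hu'
    · refine Or.inr (Finset.mem_map.2 ⟨u, ?_, by simp⟩)
      rw [Multiset.mem_toFinset, Polynomial.mem_nthRoots hk]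
      have e : (((-1 : Circle) : Circle) : ℂ) = -1 := rfl
      rw [e] at hu'
      exact eq_inv_of_mul_eq_one_left hu'
  let f : torusSubgroup k l → T := fun x => ⟨_, hmem x⟩
  have hf : Function.Injective f := by
    rintro ⟨⟨u, s⟩, hx⟩ ⟨⟨u', s'⟩, hx'⟩ h
    have h1 := Prod.mk.inj (congrArg Subtype.val h)
    have h2 : u = u' := Circle.ext h1.1
    have h3 : s = s' := Circle.ext h1.2
    subst h2 h3
    rfl
  refine ⟨Finite.of_injective f hf, ?_⟩
  refine (Nat.card_le_card_of_injective f hf).trans ?_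
  rwa [Nat.card_eq_fintype_card, Fintype.card_coe]

/-! ### Maps of a graph to itself -/

namespace FormalBihol.MapsGraph

variable {H K : FormalBihol} {φ : MvPowerSeries (Fin 3) ℂ} {t t' : ℕ × ℕ × ℕ}

theorem jacobian_relation (h : H.MapsGraph φ φ) (hφ : IsNormalGraph φ)
    (ht : IsInvariantTriple φ t) :
    H.jacobian 1 1 = H.jacobian 0 0 ^ t.1 * starRingEnd ℂ (H.jacobian 0 0) ^ t.2.1 *
      H.jacobian 1 1 ^ t.2.2 :=
  mul_right_cancel₀ ht.coeff_ne_zero (h.coeff_lowest hφ hφ (ht.vanishesBelow hφ)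
    (ht.vanishesBelow hφ) (ht.one_le_fst hφ) (ht.one_le_snd hφ))

/-- These are the unit parts of δ = γ^α γ̄^n δ^μ: conjugation inverts the unit part of γ, and that
of δ is its own inverse. -/
theorem mem_torusSubgroup (h : H.MapsGraph φ φ) (hφ : IsNormalGraph φ)
    (ht : IsInvariantTriple φ t) :
    (unitPart (H.jacobian 0 0), unitPart (H.jacobian 1 1)) ∈
      torusSubgroup ((t.2.1 : ℤ) - t.1) ((t.2.2 : ℤ) - 1) := by
  have g0 := h.jacobian_zero_zero_ne hφ hφ
  have d0 := h.jacobian_one_one_ne hφ hφ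
  have g1 : starRingEnd ℂ (H.jacobian 0 0) ≠ 0 := by simpa using g0
  have e := congrArg unitPart (h.jacobian_relation hφ ht)
  rw [unitPart_mul (mul_ne_zero (pow_ne_zero _ g0) (pow_ne_zero _ g1)) (pow_ne_zero _ d0),
    unitPart_mul (pow_ne_zero _ g0) (pow_ne_zero _ g1), unitPart_pow g0, unitPart_pow g1,
    unitPart_pow d0, unitPart_conj g0] at e
  have hs := unitPart_of_real d0 (h.ofReal_re_jacobian hφ hφ)
  set u := unitPart (H.jacobian 0 0)
  set s := unitPart (H.jacobian 1 1)
  refine ⟨hs, ?_⟩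
  have hss : s * s = 1 := by rcases hs with h | h <;> rw [h] <;> simp
  simp only
  rw [zpow_sub, zpow_sub, zpow_natCast, zpow_natCast, zpow_natCast, zpow_one]
  have e2 : s⁻¹ = s := inv_eq_of_mul_eq_one_left hss
  have e3 : u ^ t.2.1 * s = u ^ t.1 * s ^ t.2.2 := by
    nth_rewrite 1 [e]
    rw [inv_pow]
    calc u ^ t.2.1 * (u ^ t.1 * (u ^ t.2.1)⁻¹ * s ^ t.2.2)
        = (u ^ t.2.1 * (u ^ t.2.1)⁻¹) * (u ^ t.1 * s ^ t.2.2) := by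
          simp only [mul_assoc, mul_left_comm]
      _ = _ := by rw [mul_inv_cancel, one_mul]
  have hsp : s ^ t.2.2 * s ^ t.2.2 = 1 := by rw [← mul_pow, hss, one_pow]
  rw [e2]
  calc u ^ t.2.1 * (u ^ t.1)⁻¹ * (s ^ t.2.2 * s) = (u ^ t.2.1 * s) * (u ^ t.1)⁻¹ * s ^ t.2.2 := by
        simp only [mul_assoc, mul_left_comm, mul_comm]
    _ = (u ^ t.1 * (u ^ t.1)⁻¹) * (s ^ t.2.2 * s ^ t.2.2) := by
        rw [e3]; simp only [mul_assoc, mul_left_comm]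
    _ = 1 := by rw [hsp, mul_inv_cancel, one_mul]

/-- The moduli in the same relation, complementing `mem_torusSubgroup`. -/
theorem log_relation (h : H.MapsGraph φ φ) (hφ : IsNormalGraph φ)
    (ht : IsInvariantTriple φ t) :
    ((t.1 : ℝ) + t.2.1) * Real.log ‖H.jacobian 0 0‖ =
      (1 - t.2.2) * Real.log ‖H.jacobian 1 1‖ := by
  have g0 := norm_ne_zero_iff.2 (h.jacobian_zero_zero_ne hφ hφ)
  have d0 := norm_ne_zero_iff.2 (h.jacobian_one_one_ne hφ hφ)
  have e := congrArg (fun z => Real.log ‖z‖) (h.jacobian_relation hφ ht)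
  simp only [norm_mul, norm_pow, RCLike.norm_conj] at e
  rw [Real.log_mul (mul_ne_zero (pow_ne_zero _ g0) (pow_ne_zero _ g0)) (pow_ne_zero _ d0),
    Real.log_mul (pow_ne_zero _ g0) (pow_ne_zero _ g0), Real.log_pow, Real.log_pow,
    Real.log_pow] at e
  linarith

theorem fst_add_snd_pos (hφ : IsNormalGraph φ) (ht : IsInvariantTriple φ t) :
    (0 : ℝ) < t.1 + t.2.1 := by
  have := ht.one_le_fst hφ
  have : 0 < t.1 + t.2.1 := by omega
  exact_mod_cast this

/-- Two triples give a homogeneous linear system for log|γ| and log|δ|. Its determinant vanishes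
only if the sums α + n differ and the fraction is 1, the resonance of order one. -/
theorem norm_eq_one (h : H.MapsGraph φ φ) (hφ : IsNormalGraph φ) (ht : IsInvariantTriple φ t)
    (ht' : IsInvariantTriple φ t') (htt : t ≠ t')
    (hr : t.1 + t.2.1 = t'.1 + t'.2.1 ∨ tripleRatio t t' ≠ 1) :
    ‖H.jacobian 0 0‖ = 1 ∧ ‖H.jacobian 1 1‖ = 1 := by
  have e1 := h.log_relation hφ ht
  have e2 := h.log_relation hφ ht'
  have hpos := fst_add_snd_pos hφ ht
  have g0 := norm_pos_iff.2 (h.jacobian_zero_zero_ne hφ hφ)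
  have d0 := norm_pos_iff.2 (h.jacobian_one_one_ne hφ hφ)
  set x := Real.log ‖H.jacobian 0 0‖
  set y := Real.log ‖H.jacobian 1 1‖
  have hy : y = 0 := by
    have e3 : (((t'.1 : ℝ) + t'.2.1) * (1 - t.2.2) - (t.1 + t.2.1) * (1 - t'.2.2)) * y = 0 := by
      linear_combination (t.1 + t.2.1 : ℝ) * e2 - (t'.1 + t'.2.1 : ℝ) * e1
    refine (mul_eq_zero.1 e3).resolve_left fun e4 => ?_
    by_cases hs : t.1 + t.2.1 = t'.1 + t'.2.1
    · have hs' : (t.1 : ℝ) + t.2.1 = t'.1 + t'.2.1 := by exact_mod_cast hs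
      rw [← hs', ← mul_sub] at e4
      have := (mul_eq_zero.1 e4).resolve_left hpos.ne'
      refine ht.snd_ne ht' htt ?_
      have h8 : (t.2.2 : ℝ) = t'.2.2 := by linarith
      exact_mod_cast h8
    · refine hr.resolve_left hs ?_
      have e5 : ((t'.1 : ℚ) + t'.2.1) * (1 - t.2.2) - (t.1 + t.2.1) * (1 - t'.2.2) = 0 := by
        exact_mod_cast e4
      have hd : ((t'.1 : ℚ) + t'.2.1) - (t.1 + t.2.1) ≠ 0 := by
        intro h9
        apply hs
        have : (t.1 : ℚ) + t.2.1 = t'.1 + t'.2.1 := by linarith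
        exact_mod_cast this
      rw [tripleRatio, div_eq_iff hd]
      linarith
  have hx : x = 0 := by
    rw [hy, mul_zero] at e1
    exact (mul_eq_zero.1 e1).resolve_left hpos.ne'
  exact ⟨Real.eq_one_of_pos_of_log_eq_zero g0 hx, Real.eq_one_of_pos_of_log_eq_zero d0 hy⟩

theorem agreesWithId (h : H.MapsGraph φ φ) (hφ : IsNormalGraph φ) (ht : IsInvariantTriple φ t)
    (hne : t.1 ≠ t.2.1) (hnt : ∃ t', IsInvariantTriple φ t' ∧ t ≠ t') (hγ : H.jacobian 0 0 = 1)
    (hδ : H.jacobian 1 1 = 1) {N : ℕ}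
    (hc : ∀ j, 1 ≤ j → j < N → coeff (duo 0 (j + 1)) (H.toFun 1) = 0 ∨
      ∃ t', IsInvariantTriple φ t' ∧ t ≠ t' ∧
        (t.1 + t.2.1 = t'.1 + t'.2.1 ∨ tripleRatio t t' ≠ ((j + 1 : ℕ) : ℚ))) :
    AgreesWithId (H.toFun 0) (H.toFun 1) N := by
  obtain ⟨t', ht', htt⟩ := hnt
  have hF := H.constantCoeff_eq_zero 0
  have hG := H.constantCoeff_eq_zero 1
  rw [jacobian_apply_zero] at hγ
  rw [jacobian_apply_one] at hδ
  induction N with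
  | zero => exact IsGraphMap.agreesWithId_zero h hφ hF hG
  | succ j ih =>
    have hid := ih fun i h1 h2 => hc i h1 (by omega)
    refine IsGraphMap.agreesWithId_succ h hφ ht hne ht' htt hF hG hid (fun _ => hγ) ?_
    rcases Nat.eq_zero_or_pos j with rfl | hj
    · simpa using hδ
    · rw [if_neg (by omega)]
      rcases hc j hj (Nat.lt_succ_self j) with h0 | ⟨s, hs, hts, hr⟩
      · exact h0
      · exact IsGraphMap.coeff_snd_eq_zero_of_ratio h hφ ht hne hs hts hF hG hj hid hr

theorem eq_one (h : H.MapsGraph φ φ) (hφ : IsNormalGraph φ) (ht : IsInvariantTriple φ t)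
    (hne : t.1 ≠ t.2.1) (hnt : ∃ t', IsInvariantTriple φ t' ∧ t ≠ t') (hγ : H.jacobian 0 0 = 1)
    (hδ : H.jacobian 1 1 = 1)
    (hc : ∀ j, 1 ≤ j → coeff (duo 0 (j + 1)) (H.toFun 1) = 0 ∨
      ∃ t', IsInvariantTriple φ t' ∧ t ≠ t' ∧
        (t.1 + t.2.1 = t'.1 + t'.2.1 ∨ tripleRatio t t' ≠ ((j + 1 : ℕ) : ℚ))) : H = 1 := by
  have := IsGraphMap.eq_X_of_forall fun N =>
    h.agreesWithId hφ ht hne hnt hγ hδ (N := N) fun j h1 _ => hc j h1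
  refine FormalBihol.ext (funext fun j => ?_)
  fin_cases j
  · exact this.1
  · exact this.2

end FormalBihol.MapsGraph

/-! ### The character of the automorphism group -/

namespace FormalHypersurface

open FormalBihol

variable {M : FormalHypersurface} {Φ : FormalBihol} {φ : MvPowerSeries (Fin 3) ℂ}

theorem IsNormalCoord.mapsGraph (h : M.IsNormalCoord Φ φ) {H : FormalBihol} (hH : H ∈ M.Aut) :
    (Φ * H * Φ⁻¹).MapsGraph φ φ := (mem_aut_iff h h).1 hH

theorem conj_mul_conj (Φ H K : FormalBihol) :
    Φ * (H * K) * Φ⁻¹ = (Φ * H * Φ⁻¹) * (Φ * K * Φ⁻¹) := by group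

/-- The unit parts of the diagonal of the linear part of an automorphism. -/
def IsNormalCoord.character (h : M.IsNormalCoord Φ φ) : M.Aut →* Circle × Circle where
  toFun H := (unitPart ((Φ * (H : FormalBihol) * Φ⁻¹).jacobian 0 0),
    unitPart ((Φ * (H : FormalBihol) * Φ⁻¹).jacobian 1 1))
  map_one' := by simp [jacobian_one, unitPart_one]
  map_mul' H K := by
    have a := h.mapsGraph H.2
    have b := h.mapsGraph K.2
    rw [Subgroup.coe_mul, conj_mul_conj, MapsGraph.jacobian_zero_zero_mul b h.1,
      MapsGraph.jacobian_one_one_mul a h.1,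
      unitPart_mul (a.jacobian_zero_zero_ne h.1 h.1) (b.jacobian_zero_zero_ne h.1 h.1),
      unitPart_mul (a.jacobian_one_one_ne h.1 h.1) (b.jacobian_one_one_ne h.1 h.1)]
    rfl

theorem IsNormalCoord.character_mem (h : M.IsNormalCoord Φ φ) (H : M.Aut) :
    h.character H ∈ M.N := by
  rw [N]
  simp only [Subgroup.mem_iInf]
  intro t ht
  exact (h.mapsGraph H.2).mem_torusSubgroup h.1 (h.isInvariantTriple.1 ht)

/-- The torus subgroup of the single triple with α < n already gives the bound. -/
theorem finite_N {α n μ : ℕ} (hmem : (α, n, μ) ∈ M.Lambda) (hlt : α < n) :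
    Finite M.N ∧ (Nat.card M.N : ℤ) ≤ 2 * ((n : ℤ) - α) := by
  have hle : M.N ≤ torusSubgroup ((n - α : ℕ) : ℤ) ((μ : ℤ) - 1) := by
    intro x hx
    rw [N] at hx
    simp only [Subgroup.mem_iInf] at hx
    have := hx _ hmem
    rwa [← Nat.cast_sub hlt.le] at this
  obtain ⟨h1, h2⟩ := finite_torusSubgroup (k := n - α) (by omega) ((μ : ℤ) - 1)
  have h3 := Subgroup.inclusion_injective hle
  refine ⟨Finite.of_injective _ h3, ?_⟩
  have h4 := (Nat.card_le_card_of_injective _ h3).trans h2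
  omega

/-- The fractions `tripleRatio t t'` are not all defined and equal to `k`. -/
def Nonresonant (M : FormalHypersurface) (t : ℕ × ℕ × ℕ) (k : ℕ) : Prop :=
  ∃ t' ∈ M.Lambda, t ≠ t' ∧ (t.1 + t.2.1 = t'.1 + t'.2.1 ∨ tripleRatio t t' ≠ (k : ℚ))

theorem IsNormalCoord.norm_jacobian (h : M.IsNormalCoord Φ φ) {t : ℕ × ℕ × ℕ} (ht : t ∈ M.Lambda)
    (hr : M.Nonresonant t 1) {H : FormalBihol} (hH : H ∈ M.Aut) :
    ‖(Φ * H * Φ⁻¹).jacobian 0 0‖ = 1 ∧ ‖(Φ * H * Φ⁻¹).jacobian 1 1‖ = 1 := by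
  obtain ⟨t', ht', htt, h1⟩ := hr
  exact (h.mapsGraph hH).norm_eq_one h.1 (h.isInvariantTriple.1 ht) (h.isInvariantTriple.1 ht') htt
    (by simpa using h1)

theorem IsNormalCoord.exists_ne (h : M.IsNormalCoord Φ φ) (hΛ : M.Lambda.Nontrivial)
    (t : ℕ × ℕ × ℕ) : ∃ t', IsInvariantTriple φ t' ∧ t ≠ t' := by
  obtain ⟨t', h1, h2⟩ := hΛ.exists_ne t
  exact ⟨t', h.isInvariantTriple.1 h1, h2.symm⟩

/-- An automorphism tangent to the identity is trivial if its resonant coefficients vanish. -/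
theorem IsNormalCoord.eq_one (h : M.IsNormalCoord Φ φ) (hΛ : M.Lambda.Nontrivial)
    {t : ℕ × ℕ × ℕ} (ht : t ∈ M.Lambda) (hne : t.1 ≠ t.2.1) {H : FormalBihol} (hH : H ∈ M.Aut)
    (hγ : (Φ * H * Φ⁻¹).jacobian 0 0 = 1) (hδ : (Φ * H * Φ⁻¹).jacobian 1 1 = 1)
    (hr : ∀ k, 2 ≤ k → coeff (duo 0 k) ((Φ * H * Φ⁻¹).toFun 1) = 0 ∨ M.Nonresonant t k) :
    H = 1 := by
  have h1 := (h.mapsGraph hH).eq_one h.1 (h.isInvariantTriple.1 ht) hne (h.exists_ne hΛ t) hγ hδ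
    (fun j hj => (hr (j + 1) (by omega)).imp_right fun ⟨t', ht', htt, hr'⟩ =>
      ⟨t', h.isInvariantTriple.1 ht', htt, hr'⟩)
  exact conj_eq_one_iff.1 h1

/-- Nonresonance in order one makes the diagonal unimodular, so that it coincides with its unit
parts; nonresonance in the orders k ≥ 2 makes an automorphism with diagonal (1, 1) trivial. -/
theorem IsNormalCoord.character_injective (h : M.IsNormalCoord Φ φ) (hΛ : M.Lambda.Nontrivial)
    {t : ℕ × ℕ × ℕ} (ht : t ∈ M.Lambda) (hne : t.1 ≠ t.2.1)
    (hr : ∀ k, 1 ≤ k → M.Nonresonant t k) : Function.Injective h.character := by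
  rw [injective_iff_map_eq_one]
  intro H hH
  obtain ⟨n1, n2⟩ := h.norm_jacobian ht (hr 1 le_rfl) H.2
  have h1 := congrArg Prod.fst hH
  have h2 := congrArg Prod.snd hH
  refine Subtype.ext (h.eq_one hΛ ht hne H.2 ?_ ?_ fun k hk => Or.inr (hr k (by omega)))
  · rw [← unitPart_of_norm_eq_one n1]
    exact congrArg (fun c : Circle => (c : ℂ)) h1
  · rw [← unitPart_of_norm_eq_one n2]
    exact congrArg (fun c : Circle => (c : ℂ)) h2

/-- Transition maps are triangular and preserve the diagonal, so a character defined in one system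
of normal coordinates serves for all. -/
theorem IsNormalCoord.character_apply (h : M.IsNormalCoord Φ φ) {t : ℕ × ℕ × ℕ}
    (ht : t ∈ M.Lambda) (hr : M.Nonresonant t 1) {Φ' : FormalBihol}
    {φ' : MvPowerSeries (Fin 3) ℂ} (h' : M.IsNormalCoord Φ' φ') (H : M.Aut) :
    ((h.character H).1 : ℂ) = (Φ' * (H : FormalBihol) * Φ'⁻¹).jacobian 0 0 ∧
      ((h.character H).2 : ℂ) = (Φ' * (H : FormalBihol) * Φ'⁻¹).jacobian 1 1 := by
  obtain ⟨n1, n2⟩ := h.norm_jacobian ht hr H.2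
  have e : Φ' * (H : FormalBihol) * Φ'⁻¹ =
      (Φ' * Φ⁻¹) * (Φ * (H : FormalBihol) * Φ⁻¹) * (Φ' * Φ⁻¹)⁻¹ := by group
  have hc := MapsGraph.jacobian_conj (h.mapsGraph H.2) (M.isGraphMap_transition h h') h.1 h'.1
  rw [e, hc.1, hc.2]
  exact ⟨unitPart_of_norm_eq_one n1, unitPart_of_norm_eq_one n2⟩

end FormalHypersurface

open scoped ContDiff

/-! ### Embedded submanifolds -/

section Submanifold

variable {E : Type*} [NormedAddCommGroup E] [NormedSpace ℝ E] [FiniteDimensional ℝ E]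

/-- The union of the other pieces is closed by finiteness and misses the given point, so a chart of
one piece can be shrunk to avoid them. -/
theorem IsEmbeddedSubmanifold.iUnion {ι : Type*} [Finite ι] {d : ℕ} {S : ι → Set E}
    (hS : ∀ i, IsEmbeddedSubmanifold d (S i)) (hc : ∀ i, IsClosed (S i))
    (hd : Pairwise fun i j => Disjoint (S i) (S j)) : IsEmbeddedSubmanifold d (⋃ i, S i) := by
  intro x hx
  obtain ⟨i, hi⟩ := Set.mem_iUnion.1 hx
  obtain ⟨e, V, hxe, he, he', hV, hVS⟩ := hS i x hi
  set U : Set E := (⋃ j : {j // j ≠ i}, S j)ᶜ with hU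
  have hUo : IsOpen U := (isClosed_iUnion_of_finite fun j : {j // j ≠ i} => hc j).isOpen_compl
  have hiU : ∀ y ∈ S i, y ∈ U := by
    intro y hy hy'
    obtain ⟨⟨j, hj⟩, hyj⟩ := Set.mem_iUnion.1 hy'
    exact Set.disjoint_left.1 (hd hj) hyj hy
  refine ⟨e.restrOpen U hUo, V, ⟨hxe, hiU x hi⟩, he.mono fun y hy => hy.1,
    he'.mono fun y hy => hy.1, hV, fun y hy => ?_⟩
  change _ ↔ e y ∈ V
  rw [← hVS y hy.1]
  constructor
  · intro h
    obtain ⟨j, hj⟩ := Set.mem_iUnion.1 h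
    by_cases hji : j = i
    · rwa [hji] at hj
    · exact absurd (Set.mem_iUnion.2 ⟨⟨j, hji⟩, hj⟩) hy.2
  · exact fun h => Set.mem_iUnion.2 ⟨i, h⟩

theorem isEmbeddedSubmanifold_affine (P : E) (V : Submodule ℝ E) :
    IsEmbeddedSubmanifold (Module.finrank ℝ V) {y | y - P ∈ V} := fun x _ =>
  ⟨(Homeomorph.subRight P).toOpenPartialHomeomorph, V, Set.mem_univ x,
    (contDiff_id.sub contDiff_const).contDiffOn, (contDiff_id.add contDiff_const).contDiffOn, rfl,
    fun _ _ => Iff.rfl⟩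

theorem isClosed_affine (P : E) (V : Submodule ℝ E) : IsClosed {y | y - P ∈ V} :=
  V.closed_of_finiteDimensional.preimage (continuous_id.sub continuous_const)

theorem exists_dual_pair {P Q : E} (h : LinearIndependent ℝ ![P, Q]) :
    ∃ l : E →L[ℝ] ℝ, l P = 0 ∧ l Q = 1 := by
  have hQ : Q ∉ Submodule.span ℝ {P} := by
    intro hQ
    obtain ⟨c, hc⟩ := Submodule.mem_span_singleton.1 hQ
    have := LinearIndependent.pair_iff.1 h c (-1) (by rw [hc]; simp)
    exact absurd this.2 (by norm_num)
  obtain ⟨f, hf, hle⟩ := Submodule.exists_le_ker_of_notMem hQ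
  refine ⟨LinearMap.toContinuousLinearMap ((f Q)⁻¹ • f), ?_, ?_⟩
  · have : f P = 0 := hle (Submodule.mem_span_singleton_self P)
    simp [this]
  · simp [hf]

/-! ### Power curves in a plane. -/

variable {P Q : E} {q : ℝ}

/-- The curve `x ↦ x ^ q P + x Q`, `x > 0`. -/
def powerCurve (q : ℝ) (P Q : E) : Set E := {y | ∃ x : ℝ, 0 < x ∧ x ^ q • P + x • Q = y}

/-- In the coordinates (u, x) of the plane of P and Q the curve is u x^(−q) = 1, x ≥ 0. As q < 0,
the power is continuous up to x = 0, and the equation excludes x = 0. -/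
theorem isClosed_powerCurve (hq : q < 0) (h : LinearIndependent ℝ ![P, Q]) :
    IsClosed (powerCurve q P Q) := by
  obtain ⟨l, lP, lQ⟩ := exists_dual_pair h
  obtain ⟨l', lQ', lP'⟩ := exists_dual_pair (LinearIndependent.pair_symm_iff.1 h)
  have e : powerCurve q P Q = {y | l' y • P + l y • Q = y} ∩ ({y | 0 ≤ l y} ∩
      {y | l' y * l y ^ (-q) = 1}) := by
    ext y
    constructor
    · rintro ⟨x, hx, rfl⟩
      refine ⟨?_, ?_, ?_⟩
      · simp [lP, lQ, lP', lQ']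
      · simp [lP, lQ, hx.le]
      · simp [lP, lQ, lP', lQ', ← Real.rpow_add hx]
    · rintro ⟨h1, h2, h3⟩
      simp only [Set.mem_ofPred_eq] at h1 h2 h3
      have hpos : 0 < l y := by
        refine lt_of_le_of_ne h2 fun h0 => ?_
        rw [← h0, Real.zero_rpow (by linarith), mul_zero] at h3
        exact zero_ne_one h3
      refine ⟨l y, hpos, ?_⟩
      have h4 : l y ^ q = l' y := by
        rw [Real.rpow_neg hpos.le] at h3
        have := Real.rpow_pos_of_pos hpos q
        field_simp at h3
        exact h3.symm
      rw [h4, h1]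
  rw [e]
  refine (isClosed_eq (by fun_prop) continuous_id).inter
    ((isClosed_le continuous_const l.continuous).inter (isClosed_eq ?_ continuous_const))
  exact l'.continuous.mul (l.continuous.rpow_const fun _ => Or.inr (by linarith))

/-- The shear y ↦ y − l(y)^q P preserves l, hence is invertible on l > 0, and it moves the curve
into the line spanned by Q. -/
theorem isEmbeddedSubmanifold_powerCurve (h : LinearIndependent ℝ ![P, Q]) :
    IsEmbeddedSubmanifold 1 (powerCurve q P Q) := by
  obtain ⟨l, lP, lQ⟩ := exists_dual_pair h
  have hQ : Q ≠ 0 := by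
    rintro rfl
    simp at lQ
  have hcd : ContDiffOn ℝ ∞ (fun y => l y ^ q • P) {y | 0 < l y} := by
    refine ContDiffOn.smul ?_ contDiffOn_const
    exact l.contDiff.contDiffOn.rpow_const_of_ne fun y hy => (ne_of_gt hy)
  have hl1 : ∀ y, l (y - l y ^ q • P) = l y := fun y => by simp [lP]
  have hl2 : ∀ y, l (y + l y ^ q • P) = l y := fun y => by simp [lP]
  let e : OpenPartialHomeomorph E E :=
    { toFun := fun y => y - l y ^ q • P
      invFun := fun y => y + l y ^ q • P
      source := {y | 0 < l y}
      target := {y | 0 < l y}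
      map_source' := fun y hy => by simpa only [Set.mem_ofPred_eq, hl1] using hy
      map_target' := fun y hy => by simpa only [Set.mem_ofPred_eq, hl2] using hy
      left_inv' := fun y _ => by simp only [hl1, sub_add_cancel]
      right_inv' := fun y _ => by simp only [hl2, add_sub_cancel_right]
      open_source := isOpen_lt continuous_const l.continuous
      open_target := isOpen_lt continuous_const l.continuous
      continuousOn_toFun := continuousOn_id.sub hcd.continuousOn
      continuousOn_invFun := continuousOn_id.add hcd.continuousOn }
  rintro _ ⟨x, hx, rfl⟩
  refine ⟨e, Submodule.span ℝ {Q}, ?_, contDiffOn_id.sub hcd, contDiffOn_id.add hcd,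
    finrank_span_singleton hQ, fun y hy => ?_⟩
  · change 0 < l (x ^ q • P + x • Q)
    simpa [lP, lQ] using hx
  · change _ ↔ y - l y ^ q • P ∈ _
    rw [Submodule.mem_span_singleton]
    constructor
    · rintro ⟨x, hx, rfl⟩
      exact ⟨x, by simp [lP, lQ]⟩
    · rintro ⟨c, hc⟩
      have h1 := congrArg l hc
      rw [hl1, map_smul, lQ, smul_eq_mul, mul_one] at h1
      refine ⟨c, by rw [h1]; exact hy, ?_⟩
      rw [hc, h1]
      exact add_sub_cancel _ _

end Submanifold

/-- A group of maps is a closed Lie subgroup of the jet group if finitely many cosets of a normal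
subgroup are closed submanifolds. -/
theorem isClosedLieSubgroup_of_ker {k d : ℕ} (Γ : Subgroup FormalBihol) {G : Type*} [Group G]
    (e : Γ →* G) [Finite e.range] (hinj : Set.InjOn (JetGroup.eval k) (Γ : Set FormalBihol))
    (h : ∀ H : Γ, IsClosed ((fun g : Γ => ((H * g : Γ) : FormalBihol).jetCoeffs k) '' e.ker) ∧
      IsEmbeddedSubmanifold d ((fun g : Γ => ((H * g : Γ) : FormalBihol).jetCoeffs k) '' e.ker)) :
    IsClosedLieSubgroup d (Γ.map (JetGroup.eval k)) := by
  -- One representative for each of the finitely many cosets of the kernel.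
  choose r hr using fun x : e.range => x.2
  set S : e.range → Set (JetSpace k) := fun x =>
    (fun g : Γ => ((r x * g : Γ) : FormalBihol).jetCoeffs k) '' e.ker with hS
  have hcover : JetGroup.coords '' ((Γ.map (JetGroup.eval k) : Subgroup (JetGroup k)) :
      Set (JetGroup k)) = ⋃ x, S x := by
    ext c
    constructor
    · rintro ⟨_, ⟨H, hH, rfl⟩, rfl⟩
      refine Set.mem_iUnion.2 ⟨⟨e ⟨H, hH⟩, ⟨_, rfl⟩⟩, (r ⟨e ⟨H, hH⟩, ⟨_, rfl⟩⟩)⁻¹ * ⟨H, hH⟩, ?_, ?_⟩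
      · rw [SetLike.mem_coe, MonoidHom.mem_ker, map_mul, map_inv, hr, inv_mul_cancel]
      · simp only [mul_inv_cancel_left]
        rfl
    · intro hc
      obtain ⟨x, g, -, rfl⟩ := Set.mem_iUnion.1 hc
      exact ⟨JetGroup.eval k (r x * g : Γ), ⟨_, (r x * g : Γ).2, rfl⟩, rfl⟩
  have hclosed : IsClosed (⋃ x, S x) := isClosed_iUnion_of_finite fun x => (h (r x)).1
  constructor
  · have hpre : ((Γ.map (JetGroup.eval k) : Subgroup (JetGroup k)) : Set (JetGroup k)) =
        JetGroup.coords ⁻¹' (⋃ x, S x) := by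
      rw [← hcover]
      exact (Set.preimage_image_eq (f := JetGroup.coords) _ Subtype.val_injective).symm
    rw [hpre]
    exact hclosed.preimage continuous_induced_dom
  · rw [hcover]
    refine IsEmbeddedSubmanifold.iUnion (fun x => (h (r x)).2) (fun x => (h (r x)).1) ?_
    intro x y hxy
    refine Set.disjoint_left.2 ?_
    rintro _ ⟨g, hg, rfl⟩ ⟨g', hg', he⟩
    refine hxy (Subtype.ext ?_)
    -- Equal jets mean equal maps by `hinj`, and these have one value under e; so jets of different
    -- cosets are disjoint.
    have h1 : (r x * g : Γ) = r y * g' :=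
      Subtype.ext (hinj (r x * g : Γ).2 (r y * g' : Γ).2 (Subtype.ext he.symm))
    have h2 := congrArg e h1
    rwa [map_mul, map_mul, hr, hr, MonoidHom.mem_ker.1 hg, MonoidHom.mem_ker.1 hg', mul_one,
      mul_one] at h2

/-! ### Exponential polynomials -/

/-- The function `t ↦ t ^ k e ^ (c t)`. -/
def expMonomial (k : ℕ) (c : ℝ) : ℝ → ℂ := fun t => (t : ℂ) ^ k * ((Real.exp (c * t) : ℝ) : ℂ)

theorem expMonomial_mul (k l : ℕ) (c d : ℝ) :
    expMonomial k c * expMonomial l d = expMonomial (k + l) (c + d) := by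
  funext t
  simp only [expMonomial, Pi.mul_apply]
  rw [add_mul, Real.exp_add, Complex.ofReal_mul, pow_add]
  ring

theorem expMonomial_zero_zero : expMonomial 0 0 = 1 := by
  funext t
  simp [expMonomial]

theorem expMonomial_add_one (k : ℕ) (c t : ℝ) : expMonomial k c (t + 1) =
    (Real.exp c : ℂ) * ∑ i ∈ Finset.range (k + 1), (k.choose i : ℂ) * expMonomial i c t := by
  simp only [expMonomial]
  rw [mul_add, mul_one, Real.exp_add, Complex.ofReal_mul, Complex.ofReal_add, Complex.ofReal_one,
    add_pow, Finset.sum_mul, Finset.mul_sum]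
  exact Finset.sum_congr rfl fun i _ => by rw [one_pow]; ring

/-- The algebra of functions `∑ p_c(t) e ^ (c t)` with polynomials `p_c` and real `c`. -/
def expPoly : Subalgebra ℂ (ℝ → ℂ) :=
  (Submodule.span ℂ (Set.range fun x : ℕ × ℝ => expMonomial x.1 x.2)).toSubalgebra
    (Submodule.subset_span ⟨(0, 0), expMonomial_zero_zero⟩) (by
      intro f g hf hg
      refine Submodule.span_induction₂ (p := fun f g _ _ => f * g ∈
        Submodule.span ℂ (Set.range fun x : ℕ × ℝ => expMonomial x.1 x.2)) ?_ ?_ ?_ ?_ ?_ ?_ ?_ hf hg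
      · rintro _ _ ⟨x, rfl⟩ ⟨y, rfl⟩
        exact Submodule.subset_span ⟨(x.1 + y.1, x.2 + y.2), (expMonomial_mul _ _ _ _).symm⟩
      · intro y _; rw [zero_mul]; exact zero_mem _
      · intro y _; rw [mul_zero]; exact zero_mem _
      · intro x y z _ _ _ h1 h2; rw [add_mul]; exact add_mem h1 h2
      · intro x y z _ _ _ h1 h2; rw [mul_add]; exact add_mem h1 h2
      · intro r x y _ _ h; rw [smul_mul_assoc]; exact Submodule.smul_mem _ _ h
      · intro r x y _ _ h; rw [mul_smul_comm]; exact Submodule.smul_mem _ _ h)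

namespace expPoly

theorem expMonomial_mem (k : ℕ) (c : ℝ) : expMonomial k c ∈ expPoly :=
  Submodule.subset_span ⟨(k, c), rfl⟩

theorem induction {p : (ℝ → ℂ) → Prop} (hm : ∀ k c, p (expMonomial k c)) (h0 : p 0)
    (ha : ∀ f g, p f → p g → p (f + g)) (hs : ∀ (a : ℂ) f, p f → p (a • f)) {f : ℝ → ℂ}
    (hf : f ∈ expPoly) : p f := by
  refine Submodule.span_induction (p := fun f _ => p f) ?_ h0 (fun f g _ _ => ha f g)
    (fun a f _ => hs a f) hf
  rintro _ ⟨x, rfl⟩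
  exact hm _ _

theorem conj_mem {f : ℝ → ℂ} (hf : f ∈ expPoly) : star f ∈ expPoly := by
  refine expPoly.induction (p := fun f => star f ∈ expPoly) (fun k c => ?_) ?_ ?_ ?_ hf
  · have : star (expMonomial k c) = expMonomial k c := by
      funext t
      change starRingEnd ℂ (expMonomial k c t) = _
      rw [expMonomial, map_mul, map_pow, Complex.conj_ofReal, Complex.conj_ofReal]
    rw [this]
    exact expMonomial_mem k c
  · rw [star_zero]; exact zero_mem _
  · intro f g hf hg; rw [star_add]; exact add_mem hf hg
  · intro a f hf; rw [star_smul]; exact expPoly.smul_mem hf _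

/-- Solutions of linear difference equations of order one. -/
theorem exists_shift_sub {l : ℝ} (hl : 0 < l) {g : ℝ → ℂ} (hg : g ∈ expPoly) :
    ∃ f ∈ expPoly, ∀ t, f (t + 1) - l * f t = g t := by
  have main : ∀ c k, ∃ f ∈ expPoly, ∀ t, f (t + 1) - l * f t = expMonomial k c t := by
    intro c k
    induction k using Nat.strong_induction_on with
    | _ k ih =>
    choose! F hF hFt using ih
    have hsum : ∀ a : ℕ → ℂ, ∑ i ∈ Finset.range k, a i • F i ∈ expPoly := fun a =>
      sum_mem fun i hi => expPoly.smul_mem (hF i (Finset.mem_range.1 hi)) _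
    have hsumt : ∀ (a : ℕ → ℂ) t, (∑ i ∈ Finset.range k, a i • F i) (t + 1) -
        l * (∑ i ∈ Finset.range k, a i • F i) t =
          ∑ i ∈ Finset.range k, a i * expMonomial i c t := by
      intro a t
      rw [Finset.sum_apply, Finset.sum_apply, Finset.mul_sum, ← Finset.sum_sub_distrib]
      refine Finset.sum_congr rfl fun i hi => ?_
      rw [← hFt i (Finset.mem_range.1 hi)]
      simp only [Pi.smul_apply, smul_eq_mul]
      ring
    -- The operator f(t + 1) − l f(t) maps t^k e^(ct) to (e^c − l) t^k e^(ct) plus terms of lower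
    -- degree, which induction removes. If e^c = l the leading factor vanishes, and t^(k+1) e^(ct)
    -- is used instead.
    by_cases hc : Real.exp c = l
    · have hk : ((k : ℂ) + 1) ≠ 0 := by exact_mod_cast Nat.succ_ne_zero k
      have hl0 : (l : ℂ) ≠ 0 := by exact_mod_cast hl.ne'
      refine ⟨((l : ℂ) * (k + 1))⁻¹ • expMonomial (k + 1) c -
        ∑ i ∈ Finset.range k, ((k + 1 : ℂ)⁻¹ * ((k + 1).choose i : ℂ)) • F i,
        sub_mem (expPoly.smul_mem (expMonomial_mem _ _) _) (hsum _), fun t => ?_⟩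
      have h1 := hsumt (fun i => (k + 1 : ℂ)⁻¹ * ((k + 1).choose i : ℂ)) t
      have h2 := expMonomial_add_one (k + 1) c t
      rw [Finset.sum_range_succ, Finset.sum_range_succ, Nat.choose_self, Nat.choose_succ_self_right,
        hc] at h2
      simp only [Pi.sub_apply, Pi.smul_apply, smul_eq_mul] at h1 ⊢
      simp only [mul_assoc, ← Finset.mul_sum] at h1
      push_cast at h2
      rw [h2]
      field_simp
      field_simp at h1
      linear_combination -h1
    · have hc' : ((Real.exp c : ℝ) : ℂ) - l ≠ 0 := by
        rw [sub_ne_zero]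
        exact_mod_cast hc
      refine ⟨((Real.exp c : ℂ) - l)⁻¹ • (expMonomial k c -
        ∑ i ∈ Finset.range k, ((Real.exp c : ℂ) * (k.choose i : ℂ)) • F i),
        expPoly.smul_mem (sub_mem (expMonomial_mem _ _) (hsum _)) _, fun t => ?_⟩
      have h1 := hsumt (fun i => (Real.exp c : ℂ) * (k.choose i : ℂ)) t
      have h2 := expMonomial_add_one k c t
      rw [Finset.sum_range_succ, Nat.choose_self] at h2
      simp only [Pi.sub_apply, Pi.smul_apply, smul_eq_mul] at h1 ⊢
      simp only [mul_assoc, ← Finset.mul_sum] at h1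
      rw [h2]
      field_simp
      rw [Nat.cast_one]
      linear_combination -h1
  refine expPoly.induction (p := fun g => ∃ f ∈ expPoly, ∀ t, f (t + 1) - l * f t = g t)
    (fun k c => main c k) ⟨0, zero_mem _, by simp⟩ ?_ ?_ hg
  · rintro g g' ⟨f, hf, h⟩ ⟨f', hf', h'⟩
    refine ⟨f + f', add_mem hf hf', fun t => ?_⟩
    simp only [Pi.add_apply, ← h, ← h']
    ring
  · rintro a g ⟨f, hf, h⟩
    refine ⟨a • f, expPoly.smul_mem hf _, fun t => ?_⟩
    simp only [Pi.smul_apply, smul_eq_mul, ← h]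
    ring

/-- A particular solution is corrected by a multiple of l^m to fit the initial value. Positivity of
l is needed to write l^m with the real exponent log l. -/
theorem exists_recurrence {l : ℝ} (hl : 0 < l) {g : ℝ → ℂ} (hg : g ∈ expPoly) {u : ℕ → ℂ}
    (hu : ∀ m : ℕ, u (m + 1) = l * u m + g m) : ∃ f ∈ expPoly, ∀ m : ℕ, f m = u m := by
  obtain ⟨f, hf, hft⟩ := exists_shift_sub hl hg
  refine ⟨f + (u 0 - f 0) • expMonomial 0 (Real.log l),
    add_mem hf (expPoly.smul_mem (expMonomial_mem _ _) _), fun m => ?_⟩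
  have he : ∀ m : ℕ, expMonomial 0 (Real.log l) m = (l : ℂ) ^ m := by
    intro m
    simp only [expMonomial, pow_zero, one_mul]
    rw [mul_comm, Real.exp_nat_mul, Real.exp_log hl, Complex.ofReal_pow]
  simp only [Pi.add_apply, Pi.smul_apply, smul_eq_mul, he]
  induction m with
  | zero => simp
  | succ m ih =>
    have := hft m
    rw [hu, ← ih]
    push_cast
    linear_combination this

/-! ### Uniqueness: generalized eigenvectors of the shift. -/

/-- The shift of sequences. -/
def shift : Module.End ℂ (ℕ → ℂ) where
  toFun u m := u (m + 1)
  map_add' _ _ := rfl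
  map_smul' _ _ := rfl

theorem mem_maxGenEigenspace_of_sub {V : Type*} [AddCommGroup V] [Module ℂ V] {T : Module.End ℂ V}
    {μ : ℂ} {v : V} (h : T v - μ • v ∈ T.maxGenEigenspace μ) : v ∈ T.maxGenEigenspace μ := by
  rw [Module.End.mem_maxGenEigenspace] at h ⊢
  obtain ⟨k, hk⟩ := h
  refine ⟨k + 1, ?_⟩
  rw [pow_succ, Module.End.mul_apply]
  simpa using hk

/-- The shift minus e^c lowers the degree in m. -/
theorem expMonomial_mem_maxGenEigenspace (k : ℕ) (c : ℝ) :
    (fun m : ℕ => expMonomial k c m) ∈ shift.maxGenEigenspace (Real.exp c : ℂ) := by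
  induction k using Nat.strong_induction_on with
  | _ k ih =>
  refine mem_maxGenEigenspace_of_sub ?_
  have e : shift (fun m : ℕ => expMonomial k c m) - (Real.exp c : ℂ) •
      (fun m : ℕ => expMonomial k c m) = ∑ i ∈ Finset.range k,
        ((Real.exp c : ℂ) * (k.choose i : ℂ)) • (fun m : ℕ => expMonomial i c m) := by
    funext m
    have h2 := expMonomial_add_one k c m
    rw [Finset.sum_range_succ, Nat.choose_self] at h2
    have h3 : shift (fun m : ℕ => expMonomial k c m) m = expMonomial k c (m + 1) := by
      change expMonomial k c ((m + 1 : ℕ) : ℝ) = _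
      push_cast; rfl
    simp only [Pi.sub_apply, Finset.sum_apply, Pi.smul_apply, smul_eq_mul, h3, h2, mul_assoc,
      ← Finset.mul_sum]
    push_cast
    ring
  rw [e]
  exact sum_mem fun i hi => Submodule.smul_mem _ _ (ih i (Finset.mem_range.1 hi))

open Polynomial in
theorem exists_eq_sum {f : ℝ → ℂ} (hf : f ∈ expPoly) : ∃ p : ℝ →₀ ℂ[X],
    ∀ t, f t = p.sum fun c q => q.eval (t : ℂ) * ((Real.exp (c * t) : ℝ) : ℂ) := by
  classical
  have hadd : ∀ (p q : ℝ →₀ ℂ[X]) (t : ℝ), ((p + q).sum fun c q => q.eval (t : ℂ) *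
      ((Real.exp (c * t) : ℝ) : ℂ)) = (p.sum fun c q => q.eval (t : ℂ) *
        ((Real.exp (c * t) : ℝ) : ℂ)) + q.sum fun c q => q.eval (t : ℂ) *
          ((Real.exp (c * t) : ℝ) : ℂ) := fun p q t =>
    Finsupp.sum_add_index' (by simp) (by intros; rw [eval_add, add_mul])
  refine expPoly.induction (p := fun f => ∃ p : ℝ →₀ ℂ[X],
    ∀ t, f t = p.sum fun c q => q.eval (t : ℂ) * ((Real.exp (c * t) : ℝ) : ℂ)) ?_ ⟨0, by simp⟩ ?_ ?_
    hf
  · intro k c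
    refine ⟨Finsupp.single c (Polynomial.X ^ k), fun t => ?_⟩
    rw [Finsupp.sum_single_index (by simp)]
    simp [expMonomial]
  · rintro f g ⟨p, hp⟩ ⟨q, hq⟩
    exact ⟨p + q, fun t => by rw [hadd, Pi.add_apply, hp, hq]⟩
  · rintro a f ⟨p, hp⟩
    refine ⟨a • p, fun t => ?_⟩
    rw [Finsupp.sum_smul_index' (by simp), Pi.smul_apply, hp, Finsupp.smul_sum]
    simp only [eval_smul, smul_eq_mul, mul_assoc]

open Polynomial in
theorem polynomial_mem_maxGenEigenspace (q : ℂ[X]) (c : ℝ) :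
    (fun m : ℕ => q.eval (m : ℂ) * ((Real.exp (c * m) : ℝ) : ℂ)) ∈
      shift.maxGenEigenspace (Real.exp c : ℂ) := by
  induction q using Polynomial.induction_on' with
  | add p q hp hq =>
    have := add_mem hp hq
    convert this using 1
    funext m
    simp [add_mul]
  | monomial k a =>
    have := Submodule.smul_mem _ a (expMonomial_mem_maxGenEigenspace k c)
    convert this using 1
    funext m
    simp [expMonomial, mul_assoc]

/-- An exponential polynomial which vanishes at the natural numbers vanishes. -/
theorem eq_zero_of_forall_nat {f : ℝ → ℂ} (hf : f ∈ expPoly) (h : ∀ m : ℕ, f m = 0) : f = 0 := by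
  obtain ⟨p, hp⟩ := exists_eq_sum hf
  have hinj : Function.Injective fun c : ℝ => (Real.exp c : ℂ) := fun c d hcd =>
    Real.exp_injective (Complex.ofReal_injective hcd)
  -- Real exponents c have distinct eigenvalues e^c, so the parts p_c(m) e^(cm) are independent and
  -- vanish separately. Complex exponents would not be separated by the natural numbers.
  have hind := shift.independent_maxGenEigenspace.comp hinj
  rw [iSupIndep_iff_finsetSum_eq_zero_imp_eq_zero] at hind
  have hz := hind p.support
    (fun c => fun m : ℕ => (p c).eval (m : ℂ) * ((Real.exp (c * m) : ℝ) : ℂ))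
    (fun c _ => polynomial_mem_maxGenEigenspace (p c) c) (by
      funext m
      have := hp m
      rw [h m] at this
      rw [Finset.sum_apply]
      exact this.symm)
  have hp0 : p = 0 := by
    ext1 c
    by_cases hc : c ∈ p.support
    · refine Polynomial.eq_zero_of_infinite_isRoot _ ((Set.infinite_range_of_injective
        (Nat.cast_injective (R := ℂ))).mono ?_)
      rintro _ ⟨m, rfl⟩
      have := congrFun (hz c hc) m
      exact (mul_eq_zero.1 this).resolve_right (by exact_mod_cast (Real.exp_pos _).ne')
    · exact Finsupp.notMem_support_iff.1 hc
  funext t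
  rw [hp, hp0]
  simp

theorem eq_of_forall_nat {f g : ℝ → ℂ} (hf : f ∈ expPoly) (hg : g ∈ expPoly)
    (h : ∀ m : ℕ, f m = g m) : f = g :=
  sub_eq_zero.1 (eq_zero_of_forall_nat (sub_mem hf hg) fun m => sub_eq_zero.2 (h m))

/-- Evaluation at a real number. -/
def eval (t : ℝ) : expPoly →+* ℂ := (Pi.evalRingHom (fun _ : ℝ => ℂ) t).comp expPoly.subtype

theorem eval_algebraMap (t : ℝ) (c : ℂ) : eval t (algebraMap ℂ expPoly c) = c := rfl

theorem ext_nat {x : expPoly} (h : ∀ m : ℕ, eval m x = 0) : x = 0 :=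
  Subtype.ext (eq_zero_of_forall_nat x.2 h)

/-- Complex conjugation of values. -/
def conj : expPoly →+* expPoly where
  toFun x := ⟨star x.1, conj_mem x.2⟩
  map_one' := Subtype.ext (star_one _)
  map_mul' x y := Subtype.ext (by simp)
  map_zero' := Subtype.ext (star_zero _)
  map_add' x y := Subtype.ext (by simp)

theorem eval_conj (t : ℝ) (x : expPoly) : eval t (conj x) = starRingEnd ℂ (eval t x) := rfl

end expPoly

/-! ### Iterates of a map -/

namespace FormalBihol

variable {K : FormalBihol}

theorem toFun_pow (K : FormalBihol) (m : ℕ) (i : Fin 2) :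
    (K ^ m).toFun i = (subst K.toFun)^[m] (X i) := by
  induction m with
  | zero => rfl
  | succ m ih =>
    rw [Function.iterate_succ_apply', ← ih, pow_succ, mul_toFun]

/-- With weights 2 and 3, a term w in the first component is heavier than z, and z² in the second is
heavier than w. The leading part of K is therefore the diagonal map (γz, δw). -/
theorem coeff_pow_mul_pow (h0 : K.jacobian 1 0 = 0) (a b : ℕ) (d : Fin 2 →₀ ℕ)
    (hd : d 0 * 2 + d 1 * 3 ≤ a * 2 + b * 3) :
    coeff d (K.toFun 0 ^ a * K.toFun 1 ^ b) =
      if d = duo a b then K.jacobian 0 0 ^ a * K.jacobian 1 1 ^ b else 0 := by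
  rw [jacobian_apply_zero] at h0
  set γ := K.jacobian 0 0 with hγ
  set δ := K.jacobian 1 1 with hδ
  have hγ' : coeff (duo 1 0) (K.toFun 0) = γ := (K.jacobian_apply_zero 0).symm
  have hδ' : coeff (duo 0 1) (K.toFun 1) = δ := (K.jacobian_apply_one 1).symm
  have hc0 := coeff_duo_zero (K.constantCoeff_eq_zero 0)
  have hc1 := coeff_duo_zero (K.constantCoeff_eq_zero 1)
  have e0 : K.toFun 0 - C γ * (X 0 ^ 1 * X 1 ^ 0) ∈ weightIdeal ![2, 3] (2 + 1) :=
    mem_weightIdeal_two fun i m hc => by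
      by_contra hcon
      obtain ⟨rfl, rfl⟩ | ⟨rfl, rfl⟩ : (i = 0 ∧ m = 0) ∨ (i = 1 ∧ m = 0) := by omega
      · rw [coeff_sub_monomial_two, hc0] at hc; simp at hc
      · rw [coeff_sub_monomial_two, hγ'] at hc; simp at hc
  have e1 : K.toFun 1 - C δ * (X 0 ^ 0 * X 1 ^ 1) ∈ weightIdeal ![2, 3] (3 + 1) :=
    mem_weightIdeal_two fun i m hc => by
      by_contra hcon
      obtain ⟨rfl, rfl⟩ | ⟨rfl, rfl⟩ | ⟨rfl, rfl⟩ :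
        (i = 0 ∧ m = 0) ∨ (i = 1 ∧ m = 0) ∨ (i = 0 ∧ m = 1) := by omega
      · rw [coeff_sub_monomial_two, hc1] at hc; simp at hc
      · rw [coeff_sub_monomial_two, h0] at hc; simp at hc
      · rw [coeff_sub_monomial_two, hδ'] at hc; simp at hc
  have hD := prod_sub_prod_mem_weightIdeal (w := ![2, 3]) (v := ![2, 3]) (ε := 1)
    (u := ![K.toFun 0, K.toFun 1])
    (u' := ![C γ * (X 0 ^ 1 * X 1 ^ 0), C δ * (X 0 ^ 0 * X 1 ^ 1)])
    (by
      rw [Fin.forall_fin_succ, Fin.forall_fin_succ]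
      refine ⟨C_mul_mem_weightIdeal _ ?_, C_mul_mem_weightIdeal _ ?_, fun i => i.elim0⟩
      · rw [pow_one, pow_zero, mul_one]
        exact X_mem_weightIdeal 0
      · rw [pow_one, pow_zero, one_mul]
        exact X_mem_weightIdeal 1)
    (by
      rw [Fin.forall_fin_succ, Fin.forall_fin_succ]
      exact ⟨e0, e1, fun i => i.elim0⟩)
    (duo a b)
  rw [prod_two, prod_two] at hD
  simp only [Matrix.cons_val, duo_zero, duo_one, weight_two] at hD
  rw [coeff_eq_of_sub_mem_weightIdeal hD (by rw [weight_two]; simp only [Matrix.cons_val]; omega)]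
  have : (C γ * (X 0 ^ 1 * X 1 ^ 0)) ^ a * (C δ * (X 0 ^ 0 * X 1 ^ 1)) ^ b =
      C (γ ^ a * δ ^ b) * (X 0 ^ a * X 1 ^ b : MvPowerSeries (Fin 2) ℂ) := by
    rw [map_mul, map_pow, map_pow]; ring
  rw [this, coeff_C_mul, X_pow_two, coeff_monomial]
  split_ifs <;> simp

/-- The coefficients of `f ∘ K^m` are exponential polynomials in `m`. -/
theorem exists_expPoly (h0 : K.jacobian 1 0 = 0) {γ δ : ℝ} (hγ : 0 < γ) (hδ : 0 < δ)
    (hγK : K.jacobian 0 0 = γ) (hδK : K.jacobian 1 1 = δ) (f : MvPowerSeries (Fin 2) ℂ)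
    (d : Fin 2 →₀ ℕ) :
    ∃ u ∈ expPoly, ∀ m : ℕ, u m = coeff d ((subst K.toFun)^[m] f) := by
  induction hN : d 0 * 2 + d 1 * 3 using Nat.strong_induction_on generalizing d with
  | _ N ih =>
  set T : Finset (ℕ × ℕ) := (Finset.range (N + 1)) ×ˢ (Finset.range (N + 1)) with hT
  set T' := T.filter fun x => x.1 * 2 + x.2 * 3 < N with hT'
  have hIH : ∀ x ∈ T', ∃ u ∈ expPoly, ∀ m : ℕ, u m = coeff (duo x.1 x.2) ((subst K.toFun)^[m] f) :=
    fun x hx => ih _ (Finset.mem_filter.1 hx).2 _ (by simp)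
  choose! U hU hUm using hIH
  -- Composition with K is triangular for these weights: heavier exponents do not contribute, among
  -- those of equal weight only d itself does, and lighter ones are known by induction. This leaves
  -- a recurrence of order one with positive multiplier.
  have hrec : ∀ m : ℕ, coeff d ((subst K.toFun)^[m + 1] f) =
      ((γ ^ d 0 * δ ^ d 1 : ℝ) : ℂ) * coeff d ((subst K.toFun)^[m] f) +
        (∑ x ∈ T', coeff d (K.toFun 0 ^ x.1 * K.toFun 1 ^ x.2) • U x) m := by
    intro m
    rw [Function.iterate_succ_apply', coeff_subst K.hasSubst]
    set g := (subst K.toFun)^[m] f with hg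
    have hinj : Set.InjOn (fun x : ℕ × ℕ => duo x.1 x.2) (insert (d 0, d 1) T' : Finset (ℕ × ℕ)) :=
      fun x _ y _ hxy => Prod.ext (duo_inj.1 hxy).1 (duo_inj.1 hxy).2
    have hterm : ∀ e : Fin 2 →₀ ℕ, (e.prod fun s n => K.toFun s ^ n) =
        K.toFun 0 ^ e 0 * K.toFun 1 ^ e 1 := fun e => prod_two _ _
    simp only [hterm]
    rw [finsum_eq_sum_of_support_subset (s := (insert (d 0, d 1) T').image fun x => duo x.1 x.2)]
    · rw [Finset.sum_image hinj, Finset.sum_insert]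
      · congr 1
        · rw [duo_eta, coeff_pow_mul_pow h0 _ _ _ le_rfl, if_pos (duo_eta d).symm, hγK, hδK,
            smul_eq_mul, mul_comm]
          push_cast; rfl
        · rw [Finset.sum_apply]
          refine Finset.sum_congr rfl fun x hx => ?_
          rw [Pi.smul_apply, hUm x hx, duo_zero, duo_one, smul_eq_mul, smul_eq_mul, mul_comm]
      · intro h
        have := (Finset.mem_filter.1 h).2
        simp only at this
        omega
    · intro e he
      rw [Finset.coe_image]
      refine ⟨(e 0, e 1), ?_, duo_eta e⟩
      by_contra hcon
      apply he
      have hne : (e 0, e 1) ≠ (d 0, d 1) := fun h => hcon (by rw [h]; simp)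
      have hge : N ≤ e 0 * 2 + e 1 * 3 := by
        by_contra hlt
        refine hcon (Finset.mem_coe.2 (Finset.mem_insert_of_mem (Finset.mem_filter.2
          ⟨Finset.mem_product.2 ⟨Finset.mem_range.2 ?_, Finset.mem_range.2 ?_⟩, ?_⟩))) <;>
        simp only <;> omega
      change coeff e g • coeff d (K.toFun 0 ^ e 0 * K.toFun 1 ^ e 1) = 0
      rw [coeff_pow_mul_pow h0 _ _ _ (by omega), if_neg, smul_zero]
      intro h
      apply hne
      rw [h, duo_zero, duo_one]
  have hsum : ∑ x ∈ T', coeff d (K.toFun 0 ^ x.1 * K.toFun 1 ^ x.2) • U x ∈ expPoly :=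
    sum_mem fun x hx => expPoly.smul_mem (hU x hx) _
  exact expPoly.exists_recurrence (by positivity) hsum hrec

end FormalBihol

/-! ### Graph maps depending on a parameter -/

section

variable {R : Type*} [CommRing R] [Algebra ℂ R]

/-- The defect in the equation `IsGraphMap φ ψ F G`, for series over a `ℂ`-algebra with a
conjugation. -/
def graphMapDefect (c : R →+* R) (φ ψ : MvPowerSeries (Fin 3) ℂ) (F G : MvPowerSeries (Fin 2) R) :
    MvPowerSeries (Fin 3) R :=
  let on : MvPowerSeries (Fin 2) R → MvPowerSeries (Fin 3) R :=
    subst ![X 0, X 2 + C (algebraMap ℂ R Complex.I) * map (algebraMap ℂ R) φ]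
  let onConj : MvPowerSeries (Fin 2) R → MvPowerSeries (Fin 3) R := fun f =>
    subst ![X 1, X 2 + C (algebraMap ℂ R (-Complex.I)) * map (algebraMap ℂ R) φ] (map c f)
  C (algebraMap ℂ R (1 / (2 * Complex.I))) * (on G - onConj G) -
    subst ![on F, onConj F, C (algebraMap ℂ R (1 / 2)) * (on G + onConj G)]
      (map (algebraMap ℂ R) ψ)

/-- Evaluating the parameter is a ring homomorphism compatible with substitution and conjugation, so
the defect over R specializes to the one of each individual map. -/
theorem map_graphMapDefect {c : R →+* R} {φ ψ : MvPowerSeries (Fin 3) ℂ}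
    {F G : MvPowerSeries (Fin 2) R} (hφ : constantCoeff φ = 0) (hF : constantCoeff F = 0)
    (hG : constantCoeff G = 0) (ev : R →+* ℂ) (hev : ∀ a, ev (algebraMap ℂ R a) = a)
    (hc : ∀ x, ev (c x) = starRingEnd ℂ (ev x)) :
    map ev (graphMapDefect c φ ψ F G) =
      C (1 / (2 * Complex.I)) * (onGraph φ (map ev G) - onGraphConj φ (conjSeries (map ev G))) -
        subst ![onGraph φ (map ev F), onGraphConj φ (conjSeries (map ev F)),
          C (1 / 2) * (onGraph φ (map ev G) + onGraphConj φ (conjSeries (map ev G)))] ψ := by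
  have hcomp : ∀ f : MvPowerSeries (Fin 3) ℂ, map ev (map (algebraMap ℂ R) f) = f := fun f => by
    ext d; rw [coeff_map, coeff_map, hev]
  have hcf : ∀ f : MvPowerSeries (Fin 2) R, map ev (map c f) = conjSeries (map ev f) := fun f => by
    ext d; rw [coeff_map, coeff_map, hc, coeff_conjSeries, coeff_map]
  have h0 : ∀ (v : Fin 3) (a : ℂ) i, constantCoeff ((![X v, X 2 + C (algebraMap ℂ R a) *
      map (algebraMap ℂ R) φ] : Fin 2 → MvPowerSeries (Fin 3) R) i) = 0 := fun v a i => by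
    fin_cases i <;> simp [hφ]
  have hs := fun v a => hasSubst_of_constantCoeff_zero (h0 v a)
  have hmap : ∀ (v : Fin 3) (a : ℂ) (f : MvPowerSeries (Fin 2) R),
      map ev (subst ![X v, X 2 + C (algebraMap ℂ R a) * map (algebraMap ℂ R) φ] f) =
        subst ![X v, X 2 + C a * φ] (map ev f) := fun v a f => by
    rw [map_subst (hs v a)]
    congr 1
    funext i
    fin_cases i
    · exact map_X ev v
    · change map ev (X 2 + C (algebraMap ℂ R a) * map (algebraMap ℂ R) φ) = X 2 + C a * φ
      rw [map_add, map_mul, map_X, map_C, hev, hcomp]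
  have hon0 : ∀ (v : Fin 3) (a : ℂ) (f : MvPowerSeries (Fin 2) R), constantCoeff f = 0 →
      constantCoeff (subst (![X v, X 2 + C (algebraMap ℂ R a) * map (algebraMap ℂ R) φ] :
        Fin 2 → MvPowerSeries (Fin 3) R) f) = 0 := fun v a f hf =>
    constantCoeff_subst_eq_zero (hs v a) (h0 v a) hf
  have hc0 : ∀ f : MvPowerSeries (Fin 2) R, constantCoeff f = 0 → constantCoeff (map c f) = 0 :=
    fun f hf => by rw [constantCoeff_map, hf, map_zero]
  rw [graphMapDefect, map_sub, map_mul, map_sub, map_C, hev, hmap, hmap, hcf, map_subst, hcomp]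
  · congr 2
    funext i
    fin_cases i
    · exact hmap 0 _ F
    · exact (hmap 1 _ _).trans (by rw [hcf]; rfl)
    · change map ev (C _ * (_ + _)) = _
      rw [map_mul, map_C, hev, map_add, hmap, hmap, hcf]
      rfl
  · refine hasSubst_of_constantCoeff_zero fun i => ?_
    fin_cases i
    · exact hon0 _ _ _ hF
    · exact hon0 _ _ _ (hc0 _ hF)
    · change constantCoeff (C _ * (_ + _)) = 0
      rw [map_mul, map_add, hon0 _ _ _ hG, hon0 _ _ _ (hc0 _ hG), add_zero, mul_zero]

end

/-! ### One-parameter groups -/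

namespace FormalBihol.MapsGraph

variable {K : FormalBihol} {φ : MvPowerSeries (Fin 3) ℂ}

theorem one (hφ : IsNormalGraph φ) : (1 : FormalBihol).MapsGraph φ φ := by
  rw [MapsGraph, isGraphMap_iff_dvd _ hφ.constantCoeff]
  exact ⟨1, by rw [complexify_one, subst_self, one_mul, id]⟩

theorem mul {H : FormalBihol} (h : H.MapsGraph φ φ) (k : K.MapsGraph φ φ) (hφ : IsNormalGraph φ) :
    (H * K).MapsGraph φ φ := by
  rw [MapsGraph, isGraphMap_iff_dvd _ hφ.constantCoeff] at *
  obtain ⟨a, ha⟩ := h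
  obtain ⟨b, hb⟩ := k
  exact ⟨subst K.complexify a * b, by
    rw [subst_complexify, ha, subst_mul K.hasSubst_complexify, hb, mul_assoc]⟩

theorem pow (k : K.MapsGraph φ φ) (hφ : IsNormalGraph φ) (m : ℕ) : (K ^ m).MapsGraph φ φ := by
  induction m with
  | zero => rw [pow_zero]; exact one hφ
  | succ m ih => rw [pow_succ]; exact ih.mul k hφ

theorem jacobian_pow (k : K.MapsGraph φ φ) (hφ : IsNormalGraph φ) (m : ℕ) :
    (K ^ m).jacobian 0 0 = K.jacobian 0 0 ^ m ∧ (K ^ m).jacobian 1 1 = K.jacobian 1 1 ^ m := by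
  induction m with
  | zero => simp [jacobian_one]
  | succ m ih =>
    rw [pow_succ, jacobian_zero_zero_mul k hφ, jacobian_one_one_mul (k.pow hφ m) hφ, ih.1, ih.2,
      pow_succ, pow_succ]
    exact ⟨rfl, rfl⟩

/-- A self-map of a graph with positive diagonal embeds into a one-parameter family of such maps
with exponential polynomials as coefficients. -/
theorem exists_flow (k : K.MapsGraph φ φ) (hφ : IsNormalGraph φ) {γ δ : ℝ} (hγ : 0 < γ)
    (hδ : 0 < δ) (hγK : K.jacobian 0 0 = γ) (hδK : K.jacobian 1 1 = δ) :
    ∃ P : ℝ → FormalBihol, (∀ t, (P t).MapsGraph φ φ) ∧ (∀ m : ℕ, P m = K ^ m) ∧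
      ∀ i d, (fun t => coeff d ((P t).toFun i)) ∈ expPoly := by
  have h0 := k.jacobian_one_zero hφ hφ
  choose u hu hum using fun (i : Fin 2) (d : Fin 2 →₀ ℕ) =>
    K.exists_expPoly h0 hγ hδ hγK hδK (X i) d
  have hum' : ∀ i d (m : ℕ), u i d m = coeff d ((K ^ m).toFun i) := fun i d m => by
    rw [hum, toFun_pow]
  -- The interpolated coefficients form series over the ring of exponential polynomials, whose
  -- evaluations at t are the maps of the flow.
  set A : Fin 2 → MvPowerSeries (Fin 2) expPoly := fun i d => ⟨u i d, hu i d⟩ with hA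
  have hAc : ∀ i d, coeff d (A i) = ⟨u i d, hu i d⟩ := fun _ _ => rfl
  have hev : ∀ i d t, coeff d (map (expPoly.eval t) (A i)) = u i d t := fun i d t => by
    rw [coeff_map, hAc]; rfl
  have hevm : ∀ i (m : ℕ), map (expPoly.eval m) (A i) = (K ^ m).toFun i := fun i m => by
    ext d
    rw [hev, hum']
  have hA0 : ∀ i, constantCoeff (A i) = 0 := fun i => by
    rw [← coeff_zero_eq_constantCoeff_apply]
    refine expPoly.ext_nat fun m => ?_
    rw [← coeff_map, hevm, coeff_zero_eq_constantCoeff_apply, (K ^ m).constantCoeff_eq_zero]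
  have hpow : ∀ {l : ℝ}, 0 < l → ∀ m : ℕ, expMonomial 0 (Real.log l) m = (l : ℂ) ^ m := by
    intro l hl m
    simp only [expMonomial, pow_zero, one_mul]
    rw [mul_comm, Real.exp_nat_mul, Real.exp_log hl, Complex.ofReal_pow]
  -- The diagonal is interpolated by γ^t and δ^t, which never vanish, and the entry below it stays
  -- zero; so the Jacobian is invertible for every t.
  have u00 : u 0 (duo 1 0) = expMonomial 0 (Real.log γ) :=
    expPoly.eq_of_forall_nat (hu _ _) (expPoly.expMonomial_mem _ _) fun m => by
      rw [hum', hpow hγ, ← jacobian_apply_zero, (k.jacobian_pow hφ m).1, hγK]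
  have u11 : u 1 (duo 0 1) = expMonomial 0 (Real.log δ) :=
    expPoly.eq_of_forall_nat (hu _ _) (expPoly.expMonomial_mem _ _) fun m => by
      rw [hum', hpow hδ, ← jacobian_apply_one, (k.jacobian_pow hφ m).2, hδK]
  have u10 : u 1 (duo 1 0) = 0 :=
    expPoly.eq_of_forall_nat (hu _ _) (zero_mem _) fun m => by
      rw [hum', ← jacobian_apply_zero, (k.pow hφ m).jacobian_one_zero hφ hφ]; rfl
  have hne : ∀ c t, expMonomial 0 c t ≠ 0 := fun c t => by
    simp only [expMonomial, pow_zero, one_mul]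
    exact_mod_cast (Real.exp_pos _).ne'
  -- Each coefficient of the defect is an exponential polynomial that vanishes at every natural
  -- number m, because K^m preserves the graph.
  have hdefect : graphMapDefect expPoly.conj φ φ (A 0) (A 1) = 0 := by
    ext1 d
    refine expPoly.ext_nat fun m => ?_
    rw [← coeff_map, map_graphMapDefect hφ.constantCoeff (hA0 0) (hA0 1) _
      (expPoly.eval_algebraMap _) (expPoly.eval_conj _), hevm, hevm,
      sub_eq_zero.2 (show _ = _ from k.pow hφ m), map_zero]
  let P : ℝ → FormalBihol := fun t =>
    { toFun := fun i => map (expPoly.eval t) (A i)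
      constantCoeff_eq_zero := fun i => by rw [constantCoeff_map, hA0, map_zero]
      det_ne_zero := by
        rw [Matrix.det_fin_two]
        simp only [Matrix.of_apply, single_zero_one, single_one_one, hev, u00, u11, u10,
          Pi.zero_apply, mul_zero, sub_zero]
        exact mul_ne_zero (hne _ _) (hne _ _) }
  refine ⟨P, fun t => ?_, fun m => FormalBihol.ext (funext fun i => hevm i m), fun i d => ?_⟩
  · have h1 := congrArg (map (expPoly.eval t)) hdefect
    rw [map_graphMapDefect hφ.constantCoeff (hA0 0) (hA0 1) _
      (expPoly.eval_algebraMap _) (expPoly.eval_conj _), map_zero, sub_eq_zero] at h1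
    exact h1
  · have : (fun t => coeff d ((P t).toFun i)) = u i d := funext fun t => hev i d t
    rw [this]
    exact hu i d

end FormalBihol.MapsGraph

/-! ### Jets of maps tangent to the identity -/

theorem degree_fin_two (d : Fin 2 →₀ ℕ) : d.degree = d 0 + d 1 := by
  rw [Finsupp.degree_eq_sum, Fin.sum_univ_two]

namespace FormalBihol

theorem coeff_X_zero_duo (a m : ℕ) :
    coeff (duo a m) (X 0 : MvPowerSeries (Fin 2) ℂ) = if a = 1 ∧ m = 0 then 1 else 0 := by
  rw [show (X 0 : MvPowerSeries (Fin 2) ℂ) = X 0 ^ 1 * X 1 ^ 0 by ring, X_pow_two, coeff_monomial]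
  simp only [duo_inj]

theorem coeff_X_one_duo (a m : ℕ) :
    coeff (duo a m) (X 1 : MvPowerSeries (Fin 2) ℂ) = if a = 0 ∧ m = 1 then 1 else 0 := by
  rw [show (X 1 : MvPowerSeries (Fin 2) ℂ) = X 0 ^ 0 * X 1 ^ 1 by ring, X_pow_two, coeff_monomial]
  simp only [duo_inj]

/-- Composition with a map tangent to the identity to order `N - 1`, up to order `N`. -/
theorem coeff_mul_mul {N : ℕ} (A B K : FormalBihol)
    (hK : ∀ i, (N : ℕ∞) ≤ (K.toFun i - X i).order) (j : Fin 2) {d : Fin 2 →₀ ℕ}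
    (hd : d.degree ≤ N) :
    coeff d ((A * K * B).toFun j) = coeff d ((A * B).toFun j) +
      ∑ i, A.jacobian j i * coeff d (subst B.toFun (K.toFun i - X i)) := by
  have hX : HasSubst (X : Fin 2 → MvPowerSeries (Fin 2) ℂ) :=
    hasSubst_of_constantCoeff_zero fun i => constantCoeff_X i
  set L : MvPowerSeries (Fin 2) ℂ := ∑ i, coeff (Finsupp.single i 1) (A.toFun j) • X i with hL
  have hsL : ∀ {u : Fin 2 → MvPowerSeries (Fin 2) ℂ}, HasSubst u →
      subst u L = ∑ i, coeff (Finsupp.single i 1) (A.toFun j) • u i := by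
    intro u hu
    rw [hL, ← coe_substAlgHom hu, map_sum]
    refine Finset.sum_congr rfl fun i _ => ?_
    rw [map_smul, coe_substAlgHom, subst_X hu]
  -- A minus its linear part has no terms of degree at most one, so changing its argument in degrees
  -- ≥ N changes it only in degrees ≥ N + 1.
  have h1 : ((N + 1 : ℕ) : ℕ∞) ≤ (subst K.toFun (A.toFun j) - A.toFun j -
      ∑ i, A.jacobian j i • (K.toFun i - X i)).order := by
    refine nat_le_order fun e he => ?_
    have h2 := coeff_subst_congr K.constantCoeff_eq_zero
      (fun i : Fin 2 => constantCoeff_X (R := ℂ) i) hK 1 (A.toFun j - L)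
      (fun d hd _ => coeff_sub_linear (A.constantCoeff_eq_zero j) d hd) e he
    rw [subst_sub K.hasSubst, subst_sub hX, subst_self, id, hsL K.hasSubst, map_sub, map_sub] at h2
    simp only [smul_sub, Finset.sum_sub_distrib, map_sub]
    change _ = coeff e (A.toFun j) - coeff e L at h2
    change _ - _ - (coeff e (∑ i, A.jacobian j i • K.toFun i) - coeff e L) = 0
    have h3 : coeff e (∑ i, A.jacobian j i • K.toFun i) =
      coeff e (∑ i, coeff (Finsupp.single i 1) (A.toFun j) • K.toFun i) := rfl
    rw [h3]
    linear_combination h2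
  have h4 : coeff d (subst B.toFun (subst K.toFun (A.toFun j) - A.toFun j -
      ∑ i, A.jacobian j i • (K.toFun i - X i))) = 0 := by
    apply coeff_of_lt_order
    refine lt_of_lt_of_le ?_ (le_order_subst_of_le B.constantCoeff_eq_zero h1)
    exact_mod_cast Nat.lt_succ_of_le hd
  rw [subst_sub B.hasSubst, subst_sub B.hasSubst, map_sub, map_sub] at h4
  have h5 : subst B.toFun (∑ i, A.jacobian j i • (K.toFun i - X i)) =
      ∑ i, A.jacobian j i • subst B.toFun (K.toFun i - X i) := by
    rw [← coe_substAlgHom B.hasSubst, map_sum]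
    exact Finset.sum_congr rfl fun i _ => map_smul _ _ _
  rw [h5, map_sum] at h4
  simp only [map_smul, smul_eq_mul] at h4
  rw [mul_toFun, mul_toFun, mul_toFun]
  linear_combination h4

/-- In the lowest order the deviations from the identity add up. This makes the jets of powers
affine in the exponent. -/
theorem coeff_mul_of_tangent {N : ℕ} {A K : FormalBihol} (hA : A.jacobian = 1)
    (hK : ∀ i, (N : ℕ∞) ≤ (K.toFun i - X i).order) (j : Fin 2) {d : Fin 2 →₀ ℕ}
    (hd : d.degree ≤ N) :
    coeff d ((A * K).toFun j) = coeff d (A.toFun j) +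
      (coeff d (K.toFun j) - coeff d (X j : MvPowerSeries (Fin 2) ℂ)) := by
  have h := coeff_mul_mul A 1 K hK j hd
  rw [mul_one, mul_one, hA] at h
  rw [h, add_right_inj, Finset.sum_eq_single j]
  · rw [Matrix.one_apply_eq, one_mul, one_toFun, subst_self, id, map_sub]
  · intro i _ hi
    rw [Matrix.one_apply_ne hi.symm, zero_mul]
  · intro h; exact absurd (Finset.mem_univ j) h

theorem jacobian_of_tangent {N : ℕ} (hN : 2 ≤ N) {K : FormalBihol}
    (hK : ∀ i, (N : ℕ∞) ≤ (K.toFun i - X i).order) : K.jacobian = 1 := by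
  rw [← jacobian_X]
  ext i j
  change coeff (Finsupp.single j 1) (K.toFun i) =
    coeff (Finsupp.single j 1) (X i : MvPowerSeries (Fin 2) ℂ)
  rw [← sub_eq_zero, ← map_sub]
  apply coeff_of_lt_order
  refine lt_of_lt_of_le ?_ (hK i)
  rw [Finsupp.degree_single]
  exact_mod_cast hN

namespace MapsGraph

variable {K : FormalBihol} {φ : MvPowerSeries (Fin 3) ℂ} {t t' : ℕ × ℕ × ℕ}

/-- Among the terms of F − z of degree at most j only w^j could survive, and
`IsGraphMap.coeff_fst_pure` removes it. The resonant coefficient is real by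
`IsGraphMap.coeff_snd_of_le`. -/
theorem tangent (h : K.MapsGraph φ φ) (hφ : IsNormalGraph φ) (ht : IsInvariantTriple φ t)
    (hnt : ∃ t', IsInvariantTriple φ t' ∧ t ≠ t') {j : ℕ} (hj : 1 ≤ j)
    (hid : AgreesWithId (K.toFun 0) (K.toFun 1) j) :
    (∀ i, ((j + 1 : ℕ) : ℕ∞) ≤ (K.toFun i - X i).order) ∧
      starRingEnd ℂ (coeff (duo 0 (j + 1)) (K.toFun 1)) = coeff (duo 0 (j + 1)) (K.toFun 1) := by
  obtain ⟨t', ht', htt⟩ := hnt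
  have hF := K.constantCoeff_eq_zero 0
  have hG := K.constantCoeff_eq_zero 1
  obtain ⟨s, hs, hs2⟩ := IsInvariantTriple.exists_two_le hφ ht ht' htt
  have h0 : coeff (duo 0 j) (K.toFun 0) = 0 :=
    IsGraphMap.coeff_fst_pure h (hs.vanishesBelow hφ) hs2 (hs.one_le_snd hφ) hs.coeff_ne_zero hF hG
      hj hid
  constructor
  · intro i
    refine nat_le_order fun d hd => ?_
    rw [degree_fin_two] at hd
    rw [map_sub, sub_eq_zero, ← duo_eta d]
    fin_cases i
    · change coeff _ (K.toFun 0) = coeff _ (X 0)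
      rw [coeff_X_zero_duo]
      rcases Nat.lt_or_ge (d 1) j with hm | hm
      · exact hid.coeff_fst hm
      · rw [show d 0 = 0 by omega, show d 1 = j by omega, h0, if_neg (by omega)]
    · change coeff _ (K.toFun 1) = coeff _ (X 1)
      rw [coeff_X_one_duo]
      exact hid.coeff_snd (by omega)
  · have := h.coeff_snd_of_le hφ hφ hF hG (IsInvariantTriple.coeff_one_zero hφ ht ht' htt)
      (r := j + 1) (by omega) (fun m hm => by
        rcases Nat.lt_or_ge m j with hm' | hm'
        · rw [hid.coeff_fst hm', if_neg (by omega)]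
        · rw [show m = j by omega, h0]) (a := 0) (m := j + 1) le_rfl
    rw [if_pos rfl] at this
    exact this.symm

end MapsGraph

end FormalBihol

/-! ### Injectivity of jet evaluation -/

namespace FormalHypersurface

open FormalBihol

variable {M : FormalHypersurface} {Φ : FormalBihol} {φ : MvPowerSeries (Fin 3) ℂ}
  {t : ℕ × ℕ × ℕ} {N : ℕ}

/-- The quotient of two automorphisms with equal N-jets has the N-jet of the identity, hence
diagonal (1, 1) and no coefficient in the only possibly resonant order N. -/
theorem IsNormalCoord.injOn_eval (h : M.IsNormalCoord Φ φ) (hΛ : M.Lambda.Nontrivial)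
    (ht : t ∈ M.Lambda) (hne : t.1 ≠ t.2.1) (hN : 1 ≤ N)
    (hr : ∀ k, 2 ≤ k → k ≠ N → M.Nonresonant t k) :
    Set.InjOn (JetGroup.eval N) (M.Aut : Set FormalBihol) := by
  intro H hH H' hH' he
  have h1 : JetGroup.eval N (Φ * (H⁻¹ * H') * Φ⁻¹) = JetGroup.eval N 1 := by
    simp only [map_mul, map_inv, he, inv_mul_cancel, map_one, mul_one, mul_inv_cancel]
  have h2 : (Φ * (H⁻¹ * H') * Φ⁻¹).jetCoeffs N = (1 : FormalBihol).jetCoeffs N :=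
    congrArg JetGroup.coords h1
  have hc : ∀ i a m, 1 ≤ a + m → a + m ≤ N → coeff (duo a m) ((Φ * (H⁻¹ * H') * Φ⁻¹).toFun i) =
      coeff (duo a m) (X i : MvPowerSeries (Fin 2) ℂ) := fun i a m ha hm =>
    congrFun (congrFun h2 i) ⟨duo a m, by rw [degree_fin_two]; exact ⟨ha, hm⟩⟩
  have h3 := h.eq_one hΛ ht hne (M.Aut.mul_mem (M.Aut.inv_mem hH) hH')
    (by rw [jacobian_apply_zero, hc _ _ _ (by omega) (by omega), coeff_X_zero_duo]; simp)
    (by rw [jacobian_apply_one, hc _ _ _ (by omega) (by omega), coeff_X_one_duo]; simp)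
    (fun k hk => by
      by_cases hkN : k = N
      · left
        rw [hc _ _ _ (by omega) (by omega), coeff_X_one_duo, if_neg (by omega)]
      · exact Or.inr (hr k hk hkN))
  exact inv_mul_eq_one.1 h3

theorem IsNormalCoord.finite_range_character (h : M.IsNormalCoord Φ φ) [Finite M.N] :
    Finite h.character.range := by
  refine Finite.of_injective (fun x : h.character.range => (⟨x.1, ?_⟩ : M.N)) fun x y hxy =>
    Subtype.ext (congrArg (fun z : M.N => z.1) hxy)
  obtain ⟨H, hH⟩ := x.2
  rw [← hH]
  exact h.character_mem H

/-- The cosets of the trivial kernel are points. -/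
theorem IsNormalCoord.isClosedLieSubgroup_zero (h : M.IsNormalCoord Φ φ) [Finite M.N]
    (hinj : Set.InjOn (JetGroup.eval N) (M.Aut : Set FormalBihol)) (hker : h.character.ker = ⊥) :
    IsClosedLieSubgroup 0 (M.Aut.map (JetGroup.eval N)) := by
  have := h.finite_range_character
  refine isClosedLieSubgroup_of_ker M.Aut h.character hinj fun H => ?_
  have e : ((fun g : M.Aut => ((H * g : M.Aut) : FormalBihol).jetCoeffs N) '' h.character.ker) =
      {y | y - (H : FormalBihol).jetCoeffs N ∈ (⊥ : Submodule ℝ (JetSpace N))} := by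
    rw [hker, Subgroup.coe_bot, Set.image_singleton, mul_one]
    ext y
    exact (sub_eq_zero (G := JetSpace N)).symm
  rw [e]
  have h2 := isEmbeddedSubmanifold_affine ((H : FormalBihol).jetCoeffs N)
    (⊥ : Submodule ℝ (JetSpace N))
  rw [finrank_bot] at h2
  exact ⟨isClosed_affine _ _, h2⟩

/-! ### The kernel of the character: automorphisms with positive diagonal. -/

theorem IsNormalCoord.jacobian_of_mem_ker (h : M.IsNormalCoord Φ φ) {H : M.Aut}
    (hH : H ∈ h.character.ker) :
    (Φ * (H : FormalBihol) * Φ⁻¹).jacobian 0 0 =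
        (‖(Φ * (H : FormalBihol) * Φ⁻¹).jacobian 0 0‖ : ℝ) ∧
      (Φ * (H : FormalBihol) * Φ⁻¹).jacobian 1 1 =
        (‖(Φ * (H : FormalBihol) * Φ⁻¹).jacobian 1 1‖ : ℝ) := by
  have hm := h.mapsGraph H.2
  rw [MonoidHom.mem_ker] at hH
  exact ⟨eq_norm_of_unitPart_eq_one (hm.jacobian_zero_zero_ne h.1 h.1) (congrArg Prod.fst hH),
    eq_norm_of_unitPart_eq_one (hm.jacobian_one_one_ne h.1 h.1) (congrArg Prod.snd hH)⟩

theorem IsNormalCoord.mem_ker_of_jacobian (h : M.IsNormalCoord Φ φ) {H : M.Aut} {γ δ : ℝ}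
    (hγ : 0 < γ) (hδ : 0 < δ) (h0 : (Φ * (H : FormalBihol) * Φ⁻¹).jacobian 0 0 = γ)
    (h1 : (Φ * (H : FormalBihol) * Φ⁻¹).jacobian 1 1 = δ) : H ∈ h.character.ker := by
  have hu : ∀ {x : ℝ}, 0 < x → unitPart (x : ℂ) = 1 := by
    intro x hx
    apply Circle.ext
    have hx0 : (x : ℂ) ≠ 0 := by exact_mod_cast hx.ne'
    rw [coe_unitPart hx0, Complex.norm_real, Real.norm_of_nonneg hx.le, div_self hx0,
      Circle.coe_one]
  rw [MonoidHom.mem_ker]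
  change (unitPart _, unitPart _) = _
  rw [h0, h1, hu hγ, hu hδ]
  rfl

theorem IsNormalCoord.mem_aut_of_mapsGraph (h : M.IsNormalCoord Φ φ) {P : FormalBihol}
    (hP : P.MapsGraph φ φ) : Φ⁻¹ * P * Φ ∈ M.Aut := by
  rw [mem_aut_iff h h, show Φ * (Φ⁻¹ * P * Φ) * Φ⁻¹ = P by group]
  exact hP

/-- The case of a resonance of order at least two. -/
theorem IsNormalCoord.isClosedLieSubgroup_of_two_le (h : M.IsNormalCoord Φ φ)
    (hΛ : M.Lambda.Nontrivial) (ht : t ∈ M.Lambda) (hne : t.1 ≠ t.2.1) [Finite M.N] (hN : 2 ≤ N)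
    (hr : ∀ k, 1 ≤ k → k ≠ N → M.Nonresonant t k) (hker : h.character.ker ≠ ⊥) :
    IsClosedLieSubgroup 1 (M.Aut.map (JetGroup.eval N)) := by
  have := h.finite_range_character
  have hinj := h.injOn_eval hΛ ht hne (by omega) fun k hk hkN => hr k (by omega) hkN
  have hjac : ∀ {H : M.Aut}, H ∈ h.character.ker →
      (Φ * (H : FormalBihol) * Φ⁻¹).jacobian 0 0 = 1 ∧
        (Φ * (H : FormalBihol) * Φ⁻¹).jacobian 1 1 = 1 := by
    intro H hH
    obtain ⟨n1, n2⟩ := h.norm_jacobian ht (hr 1 le_rfl (by omega)) H.2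
    obtain ⟨e1, e2⟩ := h.jacobian_of_mem_ker hH
    rw [e1, e2, n1, n2]
    simp
  obtain ⟨j, rfl⟩ : ∃ j, N = j + 1 := ⟨N - 1, by omega⟩
  have hti := h.isInvariantTriple.1 ht
  have htan : ∀ {K : FormalBihol}, K.MapsGraph φ φ → K.jacobian 0 0 = 1 → K.jacobian 1 1 = 1 →
      (∀ i, ((j + 1 : ℕ) : ℕ∞) ≤ (K.toFun i - X i).order) ∧
        starRingEnd ℂ (coeff (duo 0 (j + 1)) (K.toFun 1)) = coeff (duo 0 (j + 1)) (K.toFun 1) :=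
    fun {K} hK k0 k1 => hK.tangent h.1 hti (h.exists_ne hΛ t) (by omega)
      (hK.agreesWithId h.1 hti hne (h.exists_ne hΛ t) k0 k1 fun i h1 hi => by
        obtain ⟨t', ht', htt, h2⟩ := hr (i + 1) (by omega) (by omega)
        exact Or.inr ⟨t', h.isInvariantTriple.1 ht', htt, h2⟩)
  obtain ⟨⟨H₁, hH₁⟩, hH₁ne'⟩ := Subgroup.ne_bot_iff_exists_ne_one.1 hker
  have hH₁ne : H₁ ≠ 1 := fun h1 => hH₁ne' (Subtype.ext h1)
  set K := Φ * (H₁ : FormalBihol) * Φ⁻¹ with hK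
  have hKm : K.MapsGraph φ φ := h.mapsGraph H₁.2
  obtain ⟨k0, k1⟩ := hjac hH₁
  rw [← hK] at k0 k1
  have hKt := htan hKm k0 k1
  set c := coeff (duo 0 (j + 1)) (K.toFun 1) with hc
  -- All other orders are nonresonant, so a nontrivial kernel element is detected by this
  -- coefficient alone.
  have hc0 : c ≠ 0 := by
    intro hc0
    refine hH₁ne (Subtype.ext (h.eq_one hΛ ht hne H₁.2 k0 k1 fun k hk => ?_))
    by_cases hkN : k = j + 1
    · rw [hkN]; exact Or.inl hc0
    · exact Or.inr (hr k (by omega) hkN)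
  obtain ⟨P, hPm, hPn, hPe⟩ := hKm.exists_flow h.1 one_pos one_pos (by simpa using k0)
    (by simpa using k1)
  have hpow : ∀ (m : ℕ), (K ^ m).jacobian = 1 ∧ ∀ i (d : Fin 2 →₀ ℕ), d.degree ≤ j + 1 →
      coeff d ((K ^ m).toFun i) = coeff d (X i) + m * (coeff d (K.toFun i) - coeff d (X i)) := by
    intro m
    induction m with
    | zero => exact ⟨by rw [pow_zero, jacobian_one], fun i d _ => by simp [one_toFun]⟩
    | succ m ih =>
      rw [pow_succ]
      refine ⟨by rw [jacobian_mul, ih.1, jacobian_of_tangent hN hKt.1, one_mul], fun i d hd => ?_⟩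
      rw [coeff_mul_of_tangent ih.1 hKt.1 i hd, ih.2 i d hd]
      push_cast; ring
  -- The jets of the powers are affine in m, and both sides are exponential polynomials; hence the
  -- formula holds for real exponents.
  have hPc : ∀ s i (d : Fin 2 →₀ ℕ), d.degree ≤ j + 1 →
      coeff d ((P s).toFun i) = coeff d (X i) + s * (coeff d (K.toFun i) - coeff d (X i)) := by
    intro s i d hd
    have h1 : (coeff d (X i : MvPowerSeries (Fin 2) ℂ)) • expMonomial 0 0 +
        (coeff d (K.toFun i) - coeff d (X i)) • expMonomial 1 0 ∈ expPoly :=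
      add_mem (expPoly.smul_mem (expPoly.expMonomial_mem _ _) _)
        (expPoly.smul_mem (expPoly.expMonomial_mem _ _) _)
    have h2 := expPoly.eq_of_forall_nat (hPe i d) h1 fun m => by
      rw [hPn, (hpow m).2 i d hd]
      simp [expMonomial, mul_comm]
    have h3 := congrFun h2 s
    rw [h3]
    simp [expMonomial, mul_comm]
  have hPt : ∀ s i, ((j + 1 : ℕ) : ℕ∞) ≤ ((P s).toFun i - X i).order := by
    intro s i
    refine nat_le_order fun d hd => ?_
    have h1 : coeff d (K.toFun i - X i) = 0 :=
      coeff_of_lt_order (lt_of_lt_of_le (by exact_mod_cast hd) (hKt.1 i))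
    rw [map_sub] at h1
    rw [map_sub, hPc s i d (by omega), h1]
    ring
  have hPj : ∀ s, (P s).jacobian = 1 := fun s => jacobian_of_tangent hN (hPt s)
  have hconj : ∀ s, Φ * (Φ⁻¹ * P s * Φ) * Φ⁻¹ = P s := fun s => by group
  let Q : ℝ → M.Aut := fun s => ⟨Φ⁻¹ * P s * Φ, h.mem_aut_of_mapsGraph (hPm s)⟩
  have hQker : ∀ s, Q s ∈ h.character.ker := fun s => by
    refine h.mem_ker_of_jacobian one_pos one_pos ?_ ?_ <;>
    · change (Φ * (Φ⁻¹ * P s * Φ) * Φ⁻¹).jacobian _ _ = _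
      rw [hconj, hPj]; simp
  -- The resonant coefficients are real and additive, so the quotient s of those of g and K makes
  -- the one of (Q s)⁻¹ g vanish. The flow therefore exhausts the kernel.
  have hsurj : ∀ g ∈ h.character.ker, ∃ s, Q s = g := by
    intro g hg
    obtain ⟨g0, g1⟩ := hjac hg
    have hgm := h.mapsGraph g.2
    have hgt := htan hgm g0 g1
    set G := Φ * (g : FormalBihol) * Φ⁻¹ with hG
    obtain ⟨x, hx⟩ := Complex.conj_eq_iff_real.1 hgt.2
    obtain ⟨y, hy⟩ := Complex.conj_eq_iff_real.1 hKt.2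
    refine ⟨x / y, ?_⟩
    set s : ℝ := x / y with hs
    have hd := (h.character.ker).mul_mem ((h.character.ker).inv_mem (hQker s)) hg
    have hd' := hjac hd
    set D := Φ * (((Q s)⁻¹ * g : M.Aut) : FormalBihol) * Φ⁻¹ with hDdef
    have hD : P s * D = G := by
      have : ((Q s)⁻¹ * g : M.Aut).1 = (Φ⁻¹ * P s * Φ)⁻¹ * g := rfl
      rw [hDdef, hG, this]
      group
    have hDt := htan (h.mapsGraph ((Q s)⁻¹ * g).2) hd'.1 hd'.2
    have h1 := coeff_mul_of_tangent (hPj s) hDt.1 1 (d := duo 0 (j + 1))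
      (by rw [degree_fin_two]; simp)
    rw [← hDdef, hD, hPc s 1 _ (by rw [degree_fin_two]; simp), coeff_X_one_duo, if_neg (by omega),
      hx, ← hc] at h1
    have hy0 : (y : ℂ) ≠ 0 := by rw [← hy]; exact hc0
    have h2 : coeff (duo 0 (j + 1)) (D.toFun 1) = 0 := by
      have h3 : (s : ℂ) * c = x := by
        rw [hy, hs]; push_cast; field_simp
      rw [sub_zero, h3] at h1
      linear_combination -h1
    have h4 := h.eq_one hΛ ht hne ((Q s)⁻¹ * g).2 hd'.1 hd'.2 fun k hk => by
      by_cases hkN : k = j + 1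
      · rw [hkN]; exact Or.inl h2
      · exact Or.inr (hr k (by omega) hkN)
    exact inv_mul_eq_one.1 (Subtype.ext h4)
  refine isClosedLieSubgroup_of_ker M.Aut h.character hinj fun H => ?_
  set A : FormalBihol := (H : FormalBihol) * Φ⁻¹ with hA
  set v : JetSpace (j + 1) := fun i I => ∑ l, A.jacobian i l *
    coeff I.1 (subst Φ.toFun (K.toFun l - X l)) with hv
  -- In original coordinates and after translation by H, the jets run through an affine line with
  -- direction v.
  have hjet : ∀ s, ((H * Q s : M.Aut) : FormalBihol).jetCoeffs (j + 1) =
      (H : FormalBihol).jetCoeffs (j + 1) + s • v := by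
    intro s
    have e : ((H * Q s : M.Aut) : FormalBihol) = A * P s * Φ := by
      change (H : FormalBihol) * (Φ⁻¹ * P s * Φ) = _
      rw [hA]; group
    have e' : (H : FormalBihol) = A * Φ := by rw [hA]; group
    funext i I
    rw [e, e']
    change coeff I.1 ((A * P s * Φ).toFun i) = coeff I.1 ((A * Φ).toFun i) + (s : ℂ) * v i I
    rw [coeff_mul_mul A Φ (P s) (hPt s) i I.2.2, hv, Finset.mul_sum]
    congr 1
    refine Finset.sum_congr rfl fun l _ => ?_
    have h1 : ((j + 2 : ℕ) : ℕ∞) ≤ ((P s).toFun l - X l - (s : ℂ) • (K.toFun l - X l)).order := by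
      refine nat_le_order fun d hd => ?_
      rw [map_sub, map_sub, map_smul, map_sub, hPc s l d (by omega), smul_eq_mul]
      ring
    have h2 := le_order_subst_of_le Φ.constantCoeff_eq_zero h1
    rw [subst_sub Φ.hasSubst, subst_smul Φ.hasSubst] at h2
    have h3 := coeff_of_lt_order (lt_of_lt_of_le
      (show ((I.1.degree : ℕ) : ℕ∞) < ((j + 2 : ℕ) : ℕ∞) by
        have := I.2.2
        exact_mod_cast (by omega)) h2)
    rw [map_sub, map_smul, sub_eq_zero, smul_eq_mul] at h3
    rw [h3]; ring
  -- Otherwise H and H H₁ would have the same jet, against injectivity of jet evaluation.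
  have hv0 : v ≠ 0 := by
    intro hv0
    obtain ⟨s, hs⟩ := hsurj H₁ hH₁
    have h1 := hjet s
    rw [hv0, smul_zero, add_zero, hs] at h1
    have h2 : ((H * H₁ : M.Aut) : FormalBihol) = H :=
      hinj (H * H₁).2 H.2 (Subtype.ext h1)
    exact hH₁ne (mul_eq_left.1 (Subtype.ext h2))
  have e : ((fun g : M.Aut => ((H * g : M.Aut) : FormalBihol).jetCoeffs (j + 1)) ''
      h.character.ker) = {y | y - (H : FormalBihol).jetCoeffs (j + 1) ∈ Submodule.span ℝ {v}} := by
    ext y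
    constructor
    · rintro ⟨g, hg, rfl⟩
      obtain ⟨s, rfl⟩ := hsurj g hg
      refine Submodule.mem_span_singleton.2 ⟨s, ?_⟩
      simp only [hjet, add_sub_cancel_left]
    · intro hy
      obtain ⟨s, hs⟩ := Submodule.mem_span_singleton.1 hy
      refine ⟨Q s, hQker s, ?_⟩
      simp only [hjet, hs, add_sub_cancel]
  rw [e]
  have h2 := isEmbeddedSubmanifold_affine ((H : FormalBihol).jetCoeffs (j + 1))
    (Submodule.span ℝ {v})
  rw [finrank_span_singleton hv0] at h2
  exact ⟨isClosed_affine _ _, h2⟩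

end FormalHypersurface

/-! ### First-order jets -/

/-- The first-order jet with a given linear part. -/
def linearJet : Matrix (Fin 2) (Fin 2) ℂ →ₗ[ℝ] JetSpace 1 where
  toFun B i I := ∑ l, (I.1 l : ℂ) * B i l
  map_add' B B' := by
    funext i I
    simp only [Matrix.add_apply, mul_add, Finset.sum_add_distrib, Pi.add_apply]
  map_smul' c B := by
    funext i I
    simp only [Matrix.smul_apply, Pi.smul_apply, Finset.smul_sum, mul_smul_comm, RingHom.id_apply]

theorem linearJet_injective : Function.Injective linearJet := by
  rw [← LinearMap.ker_eq_bot, LinearMap.ker_eq_bot']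
  intro B hB
  have h : ∀ (i : Fin 2) (a m : ℕ), a + m = 1 → (a : ℂ) * B i 0 + (m : ℂ) * B i 1 = 0 := by
    intro i a m h
    have := congrFun (congrFun hB i) ⟨duo a m, by rw [degree_fin_two, duo_zero, duo_one]; omega⟩
    change ∑ l, ((duo a m l : ℕ) : ℂ) * B i l = 0 at this
    rwa [Fin.sum_univ_two, duo_zero, duo_one] at this
  ext i l
  fin_cases l
  · simpa using h i 1 0 rfl
  · simpa using h i 0 1 rfl

theorem FormalBihol.jetCoeffs_one (H : FormalBihol) : H.jetCoeffs 1 = linearJet H.jacobian := by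
  funext i I
  obtain ⟨d, h1, h2⟩ := I
  change coeff d (H.toFun i) = ∑ l, (d l : ℂ) * H.jacobian i l
  rw [degree_fin_two] at h1 h2
  rw [Fin.sum_univ_two, jacobian_apply_zero, jacobian_apply_one]
  rcases Nat.eq_zero_or_pos (d 0) with h | h
  · have h' : d 1 = 1 := by omega
    rw [h, h']
    nth_rewrite 1 [← duo_eta d]
    rw [h, h']; simp
  · have h0 : d 0 = 1 := by omega
    have h' : d 1 = 0 := by omega
    rw [h0, h']
    nth_rewrite 1 [← duo_eta d]
    rw [h0, h']; simp

/-! ### Resonance of order one -/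

/-- Fraction one means (α' + n')(μ − 1) = (α + n)(μ' − 1). Then μ = 0 forces μ' = 0 and μ = 1 forces
μ' = 1, while μ ≠ μ'. This makes the exponent of the power curve negative. -/
theorem two_le_of_tripleRatio_eq_one {φ : MvPowerSeries (Fin 3) ℂ} (hφ : IsNormalGraph φ)
    {t t' : ℕ × ℕ × ℕ} (ht : IsInvariantTriple φ t) (ht' : IsInvariantTriple φ t')
    (hs : t.1 + t.2.1 ≠ t'.1 + t'.2.1) (h : tripleRatio t t' = 1) : 2 ≤ t.2.2 := by
  have htt : t ≠ t' := by rintro rfl; exact hs rfl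
  have hd : ((t'.1 : ℚ) + t'.2.1) - (t.1 + t.2.1) ≠ 0 := by
    intro h9
    apply hs
    have : (t.1 : ℚ) + t.2.1 = t'.1 + t'.2.1 := by linarith
    exact_mod_cast this
  rw [tripleRatio, div_eq_iff hd, one_mul] at h
  have h1 := ht.one_le_fst hφ
  have h2 := ht'.one_le_fst hφ
  have h3 := ht.snd_ne ht' htt
  have e : (t'.1 + t'.2.1) * t.2.2 + (t.1 + t.2.1) =
      (t.1 + t.2.1) * t'.2.2 + (t'.1 + t'.2.1) := by
    have : ((t'.1 : ℚ) + t'.2.1) * t.2.2 + (t.1 + t.2.1) =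
      (t.1 + t.2.1) * t'.2.2 + (t'.1 + t'.2.1) := by linarith
    exact_mod_cast this
  by_contra hlt
  obtain h0 | h0 : t.2.2 = 0 ∨ t.2.2 = 1 := by omega
  · rw [h0, mul_zero, zero_add] at e
    have : 1 ≤ t'.2.2 := by omega
    have := Nat.mul_le_mul_left (t.1 + t.2.1) this
    omega
  · rw [h0, mul_one] at e
    have e2 : (t.1 + t.2.1) * 1 = (t.1 + t.2.1) * t'.2.2 := by omega
    have := Nat.eq_of_mul_eq_mul_left (by omega) e2
    omega

namespace FormalHypersurface

open FormalBihol

variable {M : FormalHypersurface} {Φ : FormalBihol} {φ : MvPowerSeries (Fin 3) ℂ}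
  {t : ℕ × ℕ × ℕ}

theorem IsNormalCoord.isClosedLieSubgroup_one (h : M.IsNormalCoord Φ φ)
    (hΛ : M.Lambda.Nontrivial) (ht : t ∈ M.Lambda) (hne : t.1 ≠ t.2.1) [Finite M.N]
    (hμ : 2 ≤ t.2.2) (hr : ∀ k, 2 ≤ k → M.Nonresonant t k) (hker : h.character.ker ≠ ⊥) :
    IsClosedLieSubgroup 1 (M.Aut.map (JetGroup.eval 1)) := by
  have := h.finite_range_character
  have hinj := h.injOn_eval hΛ ht hne le_rfl fun k hk _ => hr k hk
  have hti := h.isInvariantTriple.1 ht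
  -- The relation (α + n) log γ = (1 − μ) log δ for positive γ and δ means γ = δ^q.
  set q : ℝ := (1 - t.2.2) / (t.1 + t.2.1) with hq
  have hpos := MapsGraph.fst_add_snd_pos h.1 hti
  have hμ' : (2 : ℝ) ≤ t.2.2 := by exact_mod_cast hμ
  have hq0 : q < 0 := div_neg_of_neg_of_pos (by linarith) hpos
  have hjac : ∀ {H : M.Aut}, H ∈ h.character.ker → ∃ δ : ℝ, 0 < δ ∧
      (Φ * (H : FormalBihol) * Φ⁻¹).jacobian 0 0 = ((δ ^ q : ℝ) : ℂ) ∧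
        (Φ * (H : FormalBihol) * Φ⁻¹).jacobian 1 1 = (δ : ℂ) := by
    intro H hH
    have hm := h.mapsGraph H.2
    obtain ⟨e1, e2⟩ := h.jacobian_of_mem_ker hH
    have g0 := norm_pos_iff.2 (hm.jacobian_zero_zero_ne h.1 h.1)
    have d0 := norm_pos_iff.2 (hm.jacobian_one_one_ne h.1 h.1)
    have hlog := hm.log_relation h.1 hti
    refine ⟨_, d0, ?_, e2⟩
    rw [e1]
    congr 1
    rw [Real.rpow_def_of_pos d0, ← Real.log_injOn_pos.eq_iff g0 (Real.exp_pos _), Real.log_exp, hq]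
    field_simp
    linarith
  have htriv : ∀ {H : M.Aut}, (Φ * (H : FormalBihol) * Φ⁻¹).jacobian 0 0 = 1 →
      (Φ * (H : FormalBihol) * Φ⁻¹).jacobian 1 1 = 1 → H = 1 := fun {H} h0 h1 =>
    Subtype.ext (h.eq_one hΛ ht hne H.2 h0 h1 fun k hk => Or.inr (hr k hk))
  obtain ⟨⟨H₁, hH₁⟩, hH₁ne'⟩ := Subgroup.ne_bot_iff_exists_ne_one.1 hker
  have hH₁ne : H₁ ≠ 1 := fun h1 => hH₁ne' (Subtype.ext h1)
  obtain ⟨δ, hδ, k0, k1⟩ := hjac hH₁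
  set γ : ℝ := δ ^ q with hγ
  have hγ0 : 0 < γ := Real.rpow_pos_of_pos hδ q
  have hlogγ : Real.log γ = q * Real.log δ := Real.log_rpow hδ q
  have hδ1 : Real.log δ ≠ 0 := by
    intro hl
    have h1 : δ = 1 := Real.eq_one_of_pos_of_log_eq_zero hδ hl
    have h2 : γ = 1 := by rw [hγ, h1, Real.one_rpow]
    exact hH₁ne (htriv (by rw [k0, h2, Complex.ofReal_one]) (by rw [k1, h1, Complex.ofReal_one]))
  -- As q < 0 and δ ≠ 1, the eigenvalues differ and the triangular Jacobian is diagonalizable; E₁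
  -- and E₂ below are its spectral projections.
  have hγδ : (γ : ℂ) - δ ≠ 0 := by
    rw [sub_ne_zero]
    intro he
    have h1 : γ = δ := by exact_mod_cast he
    rw [h1] at hlogγ
    have h2 : (1 - q) * Real.log δ = 0 := by linarith
    rcases mul_eq_zero.1 h2 with h3 | h3
    · linarith
    · exact hδ1 h3
  set K := Φ * (H₁ : FormalBihol) * Φ⁻¹ with hK
  have hKm : K.MapsGraph φ φ := h.mapsGraph H₁.2
  set β : ℂ := K.jacobian 0 1 / (γ - δ) with hβ
  set E₁ : Matrix (Fin 2) (Fin 2) ℂ := !![1, β; 0, 0] with hE₁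
  set E₂ : Matrix (Fin 2) (Fin 2) ℂ := !![0, -β; 0, 1] with hE₂
  have e11 : E₁ * E₁ = E₁ := by rw [hE₁, Matrix.mul_fin_two]; simp
  have e12 : E₁ * E₂ = 0 := by
    rw [hE₁, hE₂, Matrix.mul_fin_two]; ext i l; fin_cases i <;> fin_cases l <;> simp
  have e21 : E₂ * E₁ = 0 := by
    rw [hE₁, hE₂, Matrix.mul_fin_two]; ext i l; fin_cases i <;> fin_cases l <;> simp
  have e22 : E₂ * E₂ = E₂ := by rw [hE₂, Matrix.mul_fin_two]; simp
  have hKE : K.jacobian = (γ : ℂ) • E₁ + (δ : ℂ) • E₂ := by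
    have hb : K.jacobian 0 1 = γ * β + δ * (-β) := by
      rw [hβ]; field_simp; ring
    ext i l
    fin_cases i <;> fin_cases l
    · simpa [hE₁, hE₂] using k0
    · simpa [hE₁, hE₂] using hb
    · simpa [hE₁, hE₂] using hKm.jacobian_one_zero h.1 h.1
    · simpa [hE₁, hE₂] using k1
  have hpow : ∀ m : ℕ, (K ^ m).jacobian = (γ ^ m : ℂ) • E₁ + (δ ^ m : ℂ) • E₂ := by
    intro m
    induction m with
    | zero =>
      rw [pow_zero, jacobian_one, pow_zero, pow_zero, one_smul, one_smul, hE₁, hE₂]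
      ext i l
      fin_cases i <;> fin_cases l <;> simp
    | succ m ih =>
      rw [pow_succ, jacobian_mul, ih, hKE]
      simp only [add_mul, mul_add, smul_mul_smul_comm, e11, e12, e21, e22, smul_zero, add_zero,
        zero_add, pow_succ]
  obtain ⟨P, hPm, hPn, hPe⟩ := hKm.exists_flow h.1 hγ0 hδ k0 k1
  set x : ℝ → ℝ := fun s => Real.exp (Real.log δ * s) with hx
  have hx0 : ∀ s, 0 < x s := fun s => Real.exp_pos _
  have hxq : ∀ s, x s ^ q = Real.exp (Real.log γ * s) := fun s => by
    rw [hx, ← Real.exp_mul, hlogγ]; congr 1; ring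
  have hmon : ∀ {l : ℝ}, 0 < l → ∀ m : ℕ, expMonomial 0 (Real.log l) m = (l : ℂ) ^ m := by
    intro l hl m
    simp only [expMonomial, pow_zero, one_mul]
    rw [mul_comm, Real.exp_nat_mul, Real.exp_log hl, Complex.ofReal_pow]
  have hPj : ∀ s, (P s).jacobian = (x s ^ q) • E₁ + (x s) • E₂ := by
    intro s
    ext i l
    have h1 : (fun s => (P s).jacobian i l) ∈ expPoly := hPe i (Finsupp.single l 1)
    have h2 : E₁ i l • expMonomial 0 (Real.log γ) + E₂ i l • expMonomial 0 (Real.log δ) ∈ expPoly :=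
      add_mem (expPoly.smul_mem (expPoly.expMonomial_mem _ _) _)
        (expPoly.smul_mem (expPoly.expMonomial_mem _ _) _)
    have h3 := congrFun (expPoly.eq_of_forall_nat h1 h2 fun m => by
      rw [hPn, hpow]
      simp only [Pi.add_apply, Pi.smul_apply, smul_eq_mul, hmon hγ0, hmon hδ, Matrix.add_apply,
        Matrix.smul_apply]
      ring) s
    rw [h3, hxq]
    simp only [Pi.add_apply, Pi.smul_apply, smul_eq_mul, expMonomial, pow_zero, one_mul,
      Matrix.add_apply, Matrix.smul_apply, Complex.real_smul, hx]
    ring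
  have hP00 : ∀ s, (P s).jacobian 0 0 = ((x s ^ q : ℝ) : ℂ) := fun s => by
    rw [hPj, hE₁, hE₂]; simp
  have hP11 : ∀ s, (P s).jacobian 1 1 = ((x s : ℝ) : ℂ) := fun s => by
    rw [hPj, hE₁, hE₂]; simp
  have hconj : ∀ s, Φ * (Φ⁻¹ * P s * Φ) * Φ⁻¹ = P s := fun s => by group
  let Q : ℝ → M.Aut := fun s => ⟨Φ⁻¹ * P s * Φ, h.mem_aut_of_mapsGraph (hPm s)⟩
  have hQker : ∀ s, Q s ∈ h.character.ker := fun s => by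
    refine h.mem_ker_of_jacobian (Real.rpow_pos_of_pos (hx0 s) q) (hx0 s) ?_ ?_
    · change (Φ * (Φ⁻¹ * P s * Φ) * Φ⁻¹).jacobian _ _ = _
      rw [hconj, hP00]
    · change (Φ * (Φ⁻¹ * P s * Φ) * Φ⁻¹).jacobian _ _ = _
      rw [hconj, hP11]
  -- Since log δ ≠ 0, δ^s runs through all positive numbers; the flow thus realizes every possible
  -- diagonal (y^q, y).
  have hxs : ∀ y : ℝ, 0 < y → ∃ s, x s = y := fun y hy =>
    ⟨Real.log y / Real.log δ, by
      simp only [hx]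
      rw [mul_div_cancel₀ _ hδ1, Real.exp_log hy]⟩
  have hsurj : ∀ g ∈ h.character.ker, ∃ s, Q s = g := by
    intro g hg
    obtain ⟨y, hy, g0, g1⟩ := hjac hg
    obtain ⟨s, rfl⟩ := hxs y hy
    refine ⟨s, inv_mul_eq_one.1 ?_⟩
    set G := Φ * (g : FormalBihol) * Φ⁻¹ with hG
    have hDm := h.mapsGraph ((Q s)⁻¹ * g).2
    set D := Φ * (((Q s)⁻¹ * g : M.Aut) : FormalBihol) * Φ⁻¹ with hDdef
    have hD : P s * D = G := by
      have : ((Q s)⁻¹ * g : M.Aut).1 = (Φ⁻¹ * P s * Φ)⁻¹ * g := rfl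
      rw [hDdef, hG, this]
      group
    have d0 := MapsGraph.jacobian_zero_zero_mul (H := P s) hDm h.1
    have d1 := MapsGraph.jacobian_one_one_mul (K := D) (hPm s) h.1
    rw [hD, g0, hP00] at d0
    rw [hD, g1, hP11] at d1
    have n0 : ((x s ^ q : ℝ) : ℂ) ≠ 0 := by
      exact_mod_cast (Real.rpow_pos_of_pos (hx0 s) q).ne'
    have n1 : ((x s : ℝ) : ℂ) ≠ 0 := by exact_mod_cast (hx0 s).ne'
    exact htriv (mul_left_cancel₀ n0 (by rw [mul_one]; exact d0.symm))
      (mul_left_cancel₀ n1 (by rw [mul_one]; exact d1.symm))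
  refine isClosedLieSubgroup_of_ker M.Aut h.character hinj fun H => ?_
  set A : FormalBihol := (H : FormalBihol) * Φ⁻¹ with hA
  have hjet : ∀ s, ((H * Q s : M.Aut) : FormalBihol).jetCoeffs 1 =
      (x s ^ q) • linearJet (A.jacobian * E₁ * Φ.jacobian) +
        x s • linearJet (A.jacobian * E₂ * Φ.jacobian) := by
    intro s
    have e : ((H * Q s : M.Aut) : FormalBihol) = A * P s * Φ := by
      change (H : FormalBihol) * (Φ⁻¹ * P s * Φ) = _
      rw [hA]; group
    rw [e, jetCoeffs_one, jacobian_mul, jacobian_mul, hPj, ← LinearMap.map_smul linearJet,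
      ← LinearMap.map_smul linearJet, ← LinearMap.map_add linearJet]
    congr 1
    rw [mul_add, add_mul, Matrix.mul_smul, Matrix.mul_smul, Matrix.smul_mul, Matrix.smul_mul]
  -- Undoing the outer Jacobians reduces this to E₁ and E₂, which have different diagonals.
  have hind : LinearIndependent ℝ ![linearJet (A.jacobian * E₁ * Φ.jacobian),
      linearJet (A.jacobian * E₂ * Φ.jacobian)] := by
    rw [LinearIndependent.pair_iff]
    intro a b hab
    rw [← LinearMap.map_smul linearJet, ← LinearMap.map_smul linearJet,
      ← LinearMap.map_add linearJet] at hab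
    have h1 := (LinearMap.map_eq_zero_iff _ linearJet_injective).1 hab
    have h2 : A.jacobian * (a • E₁ + b • E₂) * Φ.jacobian = 0 := by
      rw [← h1, mul_add, add_mul, Matrix.mul_smul, Matrix.mul_smul, Matrix.smul_mul,
        Matrix.smul_mul]
    have h3 : A⁻¹.jacobian * (A.jacobian * (a • E₁ + b • E₂) * Φ.jacobian) * Φ⁻¹.jacobian =
        a • E₁ + b • E₂ := by
      rw [← mul_assoc, ← mul_assoc, ← jacobian_mul, inv_mul_cancel, jacobian_one, one_mul, mul_assoc,
        ← jacobian_mul, mul_inv_cancel, jacobian_one, mul_one]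
    rw [h2, mul_zero, zero_mul] at h3
    have h4 := congrFun (congrFun h3 0) 0
    have h5 := congrFun (congrFun h3 1) 1
    simp [hE₁, hE₂] at h4 h5
    exact ⟨Complex.ofReal_eq_zero.1 h4.symm, Complex.ofReal_eq_zero.1 h5.symm⟩
  have e : ((fun g : M.Aut => ((H * g : M.Aut) : FormalBihol).jetCoeffs 1) '' h.character.ker) =
      powerCurve q (linearJet (A.jacobian * E₁ * Φ.jacobian))
        (linearJet (A.jacobian * E₂ * Φ.jacobian)) := by
    ext y
    constructor
    · rintro ⟨g, hg, rfl⟩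
      obtain ⟨s, rfl⟩ := hsurj g hg
      exact ⟨x s, hx0 s, (hjet s).symm⟩
    · rintro ⟨r, hr, rfl⟩
      obtain ⟨s, rfl⟩ := hxs r hr
      exact ⟨Q s, hQker s, hjet s⟩
  rw [e]
  exact ⟨isClosed_powerCurve hq0 hind, isEmbeddedSubmanifold_powerCurve hind⟩

/-- The resonant case. -/
theorem IsNormalCoord.exists_isClosedLieSubgroup (h : M.IsNormalCoord Φ φ)
    (hΛ : M.Lambda.Nontrivial) (ht : t ∈ M.Lambda) (hne : t.1 ≠ t.2.1) [Finite M.N] {N : ℕ}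
    (hN : 0 < N) (hr : ∀ t' ∈ M.Lambda, t' ≠ t → t.1 + t.2.1 ≠ t'.1 + t'.2.1 ∧
      tripleRatio t t' = N) :
    Set.InjOn (JetGroup.eval N) (M.Aut : Set FormalBihol) ∧
      ∃ d : ℕ, d ≤ 1 ∧ IsClosedLieSubgroup d (M.Aut.map (JetGroup.eval N)) := by
  obtain ⟨t', ht', htt⟩ := hΛ.exists_ne t
  obtain ⟨h1, h2⟩ := hr t' ht' htt
  have hnr : ∀ k, 1 ≤ k → k ≠ N → M.Nonresonant t k := fun k _ hkN =>
    ⟨t', ht', htt.symm, Or.inr (by rw [h2]; exact_mod_cast hkN.symm)⟩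
  have hinj := h.injOn_eval hΛ ht hne hN fun k hk hkN => hnr k (by omega) hkN
  refine ⟨hinj, ?_⟩
  by_cases hker : h.character.ker = ⊥
  · exact ⟨0, zero_le_one, h.isClosedLieSubgroup_zero hinj hker⟩
  · refine ⟨1, le_rfl, ?_⟩
    obtain rfl | hN2 : N = 1 ∨ 2 ≤ N := by omega
    · exact h.isClosedLieSubgroup_one hΛ ht hne (two_le_of_tripleRatio_eq_one h.1
        (h.isInvariantTriple.1 ht) (h.isInvariantTriple.1 ht') h1 (by rw [h2, Nat.cast_one]))
        (fun k hk => hnr k (by omega) (by omega)) hker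
    · exact h.isClosedLieSubgroup_of_two_le hΛ ht hne hN2 hnr hker

end FormalHypersurface

end

/-! ### Assembly of the three statements. -/

theorem theorem2 (M : FormalHypersurface) (α n μ : ℕ)
    (hΛ : M.Lambda.Nontrivial) (hmem : (α, n, μ) ∈ M.Lambda) (hne : α ≠ n) :
    -- `Aut_f(M,p)` embeds by jet evaluation as a closed Lie subgroup of dimension at most one
    (∃ k : ℕ, 1 ≤ k ∧ Set.InjOn (JetGroup.eval k) (M.Aut : Set FormalBihol) ∧
      ∃ d : ℕ, d ≤ 1 ∧ IsClosedLieSubgroup d (M.Aut.map (JetGroup.eval k))) ∧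
    -- the finite case
    (((∃ t ∈ M.Lambda, t ≠ (α, n, μ) ∧ α + n = t.1 + t.2.1) ∨
        ¬ ∃ N : ℕ, 0 < N ∧ ∀ t ∈ M.Lambda, t ≠ (α, n, μ) → tripleRatio (α, n, μ) t = N) →
      Finite M.N ∧
      (∃ e : M.Aut →* Circle × Circle, Function.Injective e ∧ (∀ H, e H ∈ M.N) ∧
        ∀ (Φ : FormalBihol) (φ : MvPowerSeries (Fin 3) ℂ), M.IsNormalCoord Φ φ →
          ∀ H : M.Aut,
            ((e H).1 : ℂ) = (Φ * (H : FormalBihol) * Φ⁻¹).jacobian 0 0 ∧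
            ((e H).2 : ℂ) = (Φ * (H : FormalBihol) * Φ⁻¹).jacobian 1 1) ∧
      Finite M.Aut ∧ (Nat.card M.Aut : ℤ) ≤ 2 * ((n : ℤ) - α)) ∧
    -- the case of a constant positive integer fraction, with its jet order
    (∀ N : ℕ, 0 < N →
      (∀ t ∈ M.Lambda, t ≠ (α, n, μ) →
        α + n ≠ t.1 + t.2.1 ∧ tripleRatio (α, n, μ) t = N) →
      Set.InjOn (JetGroup.eval N) (M.Aut : Set FormalBihol) ∧
      ∃ d : ℕ, d ≤ 1 ∧ IsClosedLieSubgroup d (M.Aut.map (JetGroup.eval N))) := by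
  obtain ⟨Φ, φ, h, ht⟩ := id hmem
  have hlt : α < n := lt_of_le_of_ne (IsInvariantTriple.fst_le_snd ht h.1) hne
  obtain ⟨hNfin, hNcard⟩ := M.finite_N hmem hlt
  have hcase : ((∃ t ∈ M.Lambda, t ≠ (α, n, μ) ∧ α + n = t.1 + t.2.1) ∨
      ¬ ∃ N : ℕ, 0 < N ∧ ∀ t ∈ M.Lambda, t ≠ (α, n, μ) → tripleRatio (α, n, μ) t = N) →
      ∀ k, 1 ≤ k → M.Nonresonant (α, n, μ) k := by
    rintro (⟨t, ht, htt, hs⟩ | hN) k hk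
    · exact ⟨t, ht, htt.symm, Or.inl hs⟩
    -- If order k were resonant, k would be the common value of all fractions.
    · by_contra hcon
      refine hN ⟨k, hk, fun t ht htt => ?_⟩
      by_contra hne'
      exact hcon ⟨t, ht, htt.symm, Or.inr hne'⟩
  have hthree : ∀ N : ℕ, 0 < N → (∀ t ∈ M.Lambda, t ≠ (α, n, μ) →
      α + n ≠ t.1 + t.2.1 ∧ tripleRatio (α, n, μ) t = N) →
      Set.InjOn (JetGroup.eval N) (M.Aut : Set FormalBihol) ∧
      ∃ d : ℕ, d ≤ 1 ∧ IsClosedLieSubgroup d (M.Aut.map (JetGroup.eval N)) := fun N hN hr =>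
    h.exists_isClosedLieSubgroup hΛ hmem hne hN hr
  refine ⟨?_, fun hc => ?_, hthree⟩
  · by_cases hc : (∃ t ∈ M.Lambda, t ≠ (α, n, μ) ∧ α + n = t.1 + t.2.1) ∨
      ¬ ∃ N : ℕ, 0 < N ∧ ∀ t ∈ M.Lambda, t ≠ (α, n, μ) → tripleRatio (α, n, μ) t = N
    · have hnr := hcase hc
      have hinj := h.injOn_eval hΛ hmem hne le_rfl fun k hk _ => hnr k (by omega)
      -- In the finite case first jets already separate automorphisms, and the image has dimension
      -- zero.
      refine ⟨1, le_rfl, hinj, 0, zero_le_one, h.isClosedLieSubgroup_zero hinj ?_⟩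
      exact (MonoidHom.ker_eq_bot_iff _).2 (h.character_injective hΛ hmem hne hnr)
    · rw [not_or, not_not] at hc
      obtain ⟨hc1, N, hN, hc2⟩ := hc
      exact ⟨N, hN, hthree N hN fun t ht htt => ⟨fun hs => hc1 ⟨t, ht, htt, hs⟩, hc2 t ht htt⟩⟩
  · have hnr := hcase hc
    have hinj := h.character_injective hΛ hmem hne hnr
    have hinj' : Function.Injective fun H : M.Aut => (⟨h.character H, h.character_mem H⟩ : M.N) :=
      fun H H' he => hinj (congrArg Subtype.val he)
    refine ⟨hNfin, ⟨h.character, hinj, h.character_mem, fun Φ' φ' h' H =>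
      h.character_apply hmem (hnr 1 le_rfl) h' H⟩, Finite.of_injective _ hinj', ?_⟩
    have := Nat.card_le_card_of_injective _ hinj'
    omega
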